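/- **Setting.** Let $p,q\in(0,1)$ be real and generic ($p^aq^b=1$ with $a,b\in\mathbb Z$ only for $a=b=0$), let $n\ge 0$ be an integer and $[1,n]=\{1,\dots,n\}$. Put $\theta(z)=\prod_{j\ge0}(1-zp^j)(1-p^{j+1}/z)$ for $z\in\mathbb C^\times$ and $E(s)=q^s\theta(q^{-2s})$ for $s\in\mathbb C$. Let $\mathfrak h$ be the space of traceless diagonal $n\times n$ matrices, $M$ the field of meromorphic functions on $\mathfrak h^*$, $\omega(i)\in\mathfrak h^*$ the functional $\mathrm{diag}(h_1,\dots,h_n)\mapsto h_i$, and $\zeta_{ij}=\zeta(E_{ii}-E_{jj})$ for $\zeta\in\mathfrak h^*$. Let $$\alpha(s,z)=\frac{\theta(z)\theta(q^{2(s+1)})}{\theta(q^2z)\theta(q^{2s})},\qquad \beta(s,z)=\frac{\theta(q^2)\theta(q^{-2s}z)}{\theta(q^2z)\theta(q^{-2s})},$$ and let $R^{ab}_{xy}(\zeta,z)$ be $1$ if $a=b=x=y$, $\alpha(\zeta_{xy},z)$ if $a\ne b$, $(x,y)=(a,b)$, $\beta(\zeta_{xy},z)$ if $a\neq b$, $(x,y)=(b,a)$,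 and $0$ otherwise. $\mathcal F=\mathcal F_{\rm ell}(M(n))$ is the unital associative $\mathbb C$-algebra generated by $e_{ij}(z)$ ($i,j\in[1,n]$, $z\in\mathbb C^\times$) and two commuting copies $\{f(\lambda)\}$, $\{f(\rho)\}$ of $M$, with relations $f(\lambda)e_{ij}(z)=e_{ij}(z)f(\lambda+\omega(i))$, $f(\rho)e_{ij}(z)=e_{ij}(z)f(\rho+\omega(j))$ and $$\sum_{x,y}\lim_{w\to z_1/z_2}\bigl(\varphi(w)R^{xy}_{ac}(\lambda,w)\bigr)e_{xb}(z_1)e_{yd}(z_2)=\sum_{x,y}\lim_{w\to z_1/z_2}\bigl(\varphi(w)R_{xy}^{bd}(\rho,w)\bigr)e_{cy}(z_2)e_{ax}(z_1)$$ for all $a,b,c,d$, $z_1,z_2$ and all meromorphic $\varphi$ on $\mathbb C^\times$ for which the limits exist. The left exterior algebra $\Lambda$ is generated by $v_i(z)$ and a copy $\{f(\zeta)\}$ of $M$, with $f(\zeta)v_i(z)=v_i(z)f(\zeta+\omega(i))$, $v_i(z)v_i(w)=0$ and, for $k\ne j$, $\alpha(\zeta_{kj},z/w)v_k(z)v_j(w)+\beta(\zeta_{kj},z/w)v_j(z)v_k(w)=0$.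 The right exterior algebra $\Lambda'$ is generated by $w^i(z)$ and a copy of $M$, with $f(\zeta)w^i(z)=w^i(z)f(\zeta+\omega(i))$, $w^i(z)w^i(w)=0$ and, for $k\neq j$, $\alpha(\zeta_{kj},z/w)w^j(w)w^k(z)+\beta(\zeta_{jk},z/w)w^k(w)w^j(z)=0$. (In both cases the last relation is again understood with both coefficients multiplied by $\varphi$ and passage to the limit whenever the limits exist.) For $I=\{i_1<\dots<i_d\}\subseteq[1,n]$ put $F_I(\zeta)=\prod_{i<j,\ i,j\in I}E(\zeta_{ij}+1)$, $F^I(\zeta)=\prod_{i<j,\ i,j\in I}E(\zeta_{ij})$, $$v_I(z)=F_I(\zeta)^{-1}v_{i_d}(q^{2(d-1)}z)\cdots v_{i_1}(z),\qquad w^I(z)=F^I(\zeta)\,w^{i_1}(z)\cdots w^{i_d}(q^{2(d-1)}z),$$ and for a permutation $\sigma$ put $$\mathrm{sgn}_I(\sigma;\zeta)=\prod_{\substack{i<j,\ i,j\in I\\ \sigma(i)>\sigma(j)}}\frac{E(\zeta_{\sigma(i)\sigma(j)}+1)}{E(\zeta_{\sigma(j)\sigma(i)}+1)},\qquad \mathrm{sgn}^I(\sigma;\zeta)=\prod_{\substack{i<j,\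 i,j\in I\\ \sigma(i)>\sigma(j)}}\frac{E(\zeta_{\sigma(j)\sigma(i)})}{E(\zeta_{\sigma(i)\sigma(j)})}.$$ The left and right elliptic minors are $0$ if $\#I\ne\#J$, and for $\#I=\#J=d$, $J=\{j_1<\dots<j_d\}$, they are $$\overleftarrow\xi{}_I^J(z)=\frac{F_J(\rho)}{F_I(\lambda)}\sum_{\tau\in S_J}\mathrm{sgn}_J(\tau;\rho)\,e_{i_d\tau(j_d)}(q^{2(d-1)}z)\cdots e_{i_1\tau(j_1)}(z),$$ $$\overrightarrow\xi{}_I^J(z)=\frac{F^J(\rho)}{F^I(\lambda)}\sum_{\sigma\in S_I}\mathrm{sgn}^I(\sigma;\lambda)^{-1}\,e_{\sigma(i_1)j_1}(z)\cdots e_{\sigma(i_d)j_d}(q^{2(d-1)}z).$$ **Theorem (Laplace expansions).** (a) For all $I,J\subseteq[1,n]$ there are unique $S_l(I,J;\zeta),S_r(I,J;\zeta)\in M$ such that, for every (equivalently, for some) $z\in\mathbb C^\times$, $$v_I(q^{2\#J}z)v_J(z)=S_l(I,J;\zeta)v_{I\cup J}(z),\qquad w^I(z)w^J(q^{2\#I}z)=S_r(I,J;\zeta)w^{I\cup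 J}(z).$$ Both vanish if $I\cap J\ne\emptyset$, and otherwise $S_l(I,J;\zeta)=\prod_{i\in I,j\in J}E(\zeta_{ji}+1)$ and $S_r(I,J;\zeta)=\prod_{i\in I,j\in J}E(\zeta_{ij})^{-1}$. (b) $\overleftarrow\xi{}_I^J(z)=\overrightarrow\xi{}_I^J(z)$ for all $I,J,z$; denote the common element by $\xi_I^J(z)$. (c) For all $I_1,I_2,J\subseteq[1,n]$ and $z\in\mathbb C^\times$, with $I=I_1\cup I_2$, $$S_l(I_1,I_2;\lambda)\,\xi_I^J(z)=\sum_{J_1\cup J_2=J}S_l(J_1,J_2;\rho)\,\xi_{I_1}^{J_1}(q^{2\#I_2}z)\,\xi_{I_2}^{J_2}(z).$$ (d) For all $J_1,J_2,I\subseteq[1,n]$ and $z\in\mathbb C^\times$, with $J=J_1\cup J_2$, $$S_r(J_1,J_2;\rho)\,\xi_I^J(z)=\sum_{I_1\cup I_2=I}S_r(I_1,I_2;\lambda)\,\xi_{I_1}^{J_1}(z)\,\xi_{I_2}^{J_2}(q^{2\#J_1}z).$$ The sums in (c) and (d) are over all pairs of subsets of $[1,n]$ with the given union. -/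

import Mathlib

open Filter Topology

namespace EllipticGL

noncomputable section

/-! ### Parameters, theta function, dynamical variable -/

/-- Generic real parameters `p, q` in the open unit interval. -/
structure Params where
  p : ℝ
  q : ℝ
  p_pos : 0 < p
  p_lt_one : p < 1
  q_pos : 0 < q
  q_lt_one : q < 1
  generic : ∀ a b : ℤ, p ^ a * q ^ b = 1 → a = 0 ∧ b = 0

/-- `q` as an element of the multiplicative group of nonzero complex numbers. -/
def Params.qUnit (P : Params) : ℂˣ :=
  Units.mk0 (P.q : ℂ) (Complex.ofReal_ne_zero.mpr P.q_pos.ne')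

/-- `q ^ s` for complex `s`. -/
def qpow (P : Params) (s : ℂ) : ℂ := (P.q : ℂ) ^ s

/-- `θ(z) = ∏_{j ≥ 0} (1 - z p ^ j) (1 - p ^ (j + 1) / z)`, for `z ≠ 0`. -/
def theta (P : Params) (z : ℂ) : ℂ :=
  ∏' j : ℕ, (1 - z * (P.p : ℂ) ^ j) * (1 - (P.p : ℂ) ^ (j + 1) / z)

/-- `E(s) = q ^ s θ(q ^ (-2 s))`. -/
def ellE (P : Params) (s : ℂ) : ℂ := qpow P s * theta P (qpow P (-2 * s))

/-- The traceless diagonal matrices, given by their diagonals, inside `ℂ ^ n`. -/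
def cartanSubmodule (n : ℕ) : Submodule ℂ (Fin n → ℂ) where
  carrier := {h | ∑ i, h i = 0}
  zero_mem' := by simp
  add_mem' := by
    intro a b ha hb
    simp only [Set.mem_ofPred_eq, Pi.add_apply, Finset.sum_add_distrib] at *
    rw [ha, hb, add_zero]
  smul_mem' := by
    intro c a ha
    simp only [Set.mem_ofPred_eq, Pi.smul_apply, smul_eq_mul] at *
    rw [← Finset.mul_sum, ha, mul_zero]

/-- The Cartan subalgebra of `sl(n)`. -/
def Cartan (n : ℕ) : Type := cartanSubmodule n

instance (n : ℕ) : NormedAddCommGroup (Cartan n) :=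
  inferInstanceAs (NormedAddCommGroup (cartanSubmodule n))

instance (n : ℕ) : NormedSpace ℂ (Cartan n) :=
  inferInstanceAs (NormedSpace ℂ (cartanSubmodule n))

instance (n : ℕ) : FiniteDimensional ℂ (Cartan n) :=
  inferInstanceAs (FiniteDimensional ℂ (cartanSubmodule n))

/-- The dual space of the Cartan subalgebra (every linear functional is continuous, as the space
is finite-dimensional). -/
abbrev Dual (n : ℕ) : Type := Cartan n →L[ℂ] ℂ

/-- The weight `ω(i)`: `diag(h₁, …, hₙ) ↦ hᵢ`. -/
def weight {n : ℕ} (i : Fin n) : Dual n :=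
  LinearMap.toContinuousLinearMap
    ({ toFun := fun h => h.1 i
       map_add' := fun _ _ => rfl
       map_smul' := fun _ _ => rfl } : Cartan n →ₗ[ℂ] ℂ)

/-- The traceless diagonal matrix `E_ii - E_jj`. -/
def coroot {n : ℕ} (i j : Fin n) : Cartan n :=
  ⟨Pi.single i 1 - Pi.single j 1, by
    change ∑ k, (Pi.single i (1 : ℂ) - Pi.single j (1 : ℂ) : Fin n → ℂ) k = 0
    simp [Finset.sum_sub_distrib]⟩

/-- `ζ_ij = ζ(E_ii - E_jj)`. -/
def coord {n : ℕ} (i j : Fin n) (ζ : Dual n) : ℂ := ζ (coroot i j)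

/-! ### The field of meromorphic functions on the dual of the Cartan subalgebra -/

/-- The ring of entire functions. -/
def Entire (n : ℕ) : Subalgebra ℂ (Dual n → ℂ) where
  carrier := {f | AnalyticOnNhd ℂ f Set.univ}
  mul_mem' := fun hf hg => AnalyticOnNhd.mul hf hg
  add_mem' := fun hf hg => AnalyticOnNhd.add hf hg
  algebraMap_mem' := fun _ => analyticOnNhd_const

instance (n : ℕ) : NoZeroDivisors (Entire n) where
  eq_zero_or_eq_zero_of_mul_eq_zero := by
    rintro ⟨f, hf⟩ ⟨g, hg⟩ h
    by_contra hcon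
    push Not at hcon
    obtain ⟨hf0, hg0⟩ := hcon
    apply hg0
    have hne : ∃ x, f x ≠ 0 := by
      by_contra hall
      push Not at hall
      exact hf0 (Subtype.ext (funext hall))
    obtain ⟨x, hx⟩ := hne
    have hev : ∀ᶠ y in 𝓝 x, f y ≠ 0 :=
      (hf x (Set.mem_univ x)).continuousAt.eventually_ne hx
    have hg0' : g =ᶠ[𝓝 x] 0 := by
      filter_upwards [hev] with y hy
      have : f y * g y = 0 := congrFun (congrArg Subtype.val h) y
      exact (mul_eq_zero.mp this).resolve_left hy
    exact Subtype.ext (AnalyticOnNhd.eq_of_eventuallyEq hg analyticOnNhd_const hg0')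

instance (n : ℕ) : IsDomain (Entire n) := NoZeroDivisors.to_isDomain _

/-- The field of meromorphic functions. On a finite-dimensional complex vector space every
meromorphic function is a quotient of two entire functions, so the field is the field of fractions
of the ring of entire functions. -/
abbrev Mer (n : ℕ) : Type := FractionRing (Entire n)

/-- `(T_α f)(ζ) = f(ζ + α)` on entire functions. -/
def shiftEntire {n : ℕ} (α : Dual n) : Entire n ≃+* Entire n where
  toFun f := ⟨fun ζ => f.1 (ζ + α), fun ζ _ =>
    (f.2 (ζ + α) (Set.mem_univ _)).fun_comp (f := fun ζ => ζ + α)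
      (analyticAt_id.add analyticAt_const)⟩
  invFun f := ⟨fun ζ => f.1 (ζ + -α), fun ζ _ =>
    (f.2 (ζ + -α) (Set.mem_univ _)).fun_comp (f := fun ζ => ζ + -α)
      (analyticAt_id.add analyticAt_const)⟩
  left_inv f := Subtype.ext (funext fun ζ => congrArg f.1 (neg_add_cancel_right ζ α))
  right_inv f := Subtype.ext (funext fun ζ => congrArg f.1 (add_neg_cancel_right ζ α))
  map_mul' _ _ := rfl
  map_add' _ _ := rfl

/-- `(T_α f)(ζ) = f(ζ + α)` on meromorphic functions. -/
def shift {n : ℕ} (α : Dual n) : Mer n ≃+* Mer n :=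
  IsFractionRing.ringEquivOfRingEquiv (shiftEntire α)

theorem theta_differentiableAt (P : Params) {z : ℂ} (hz : z ≠ 0) :
    DifferentiableAt ℂ (theta P) z := by
  have hp0 := P.p_pos
  have hp1 := P.p_lt_one
  have hzn : 0 < ‖z‖ := norm_pos_iff.mpr hz
  set K : Set ℂ := {w | ‖z‖ / 2 < ‖w‖ ∧ ‖w‖ < 2 * ‖z‖} with hK
  have hKo : IsOpen K :=
    (isOpen_lt continuous_const continuous_norm).inter (isOpen_lt continuous_norm continuous_const)
  have hzK : z ∈ K := ⟨by linarith, by linarith⟩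
  have hK0 : ∀ w ∈ K, w ≠ 0 := fun w hw => norm_pos_iff.mp (lt_trans (by positivity) hw.1)
  set f : ℕ → ℂ → ℂ := fun j w =>
    -(w * (P.p : ℂ) ^ j) - (P.p : ℂ) ^ (j + 1) / w + (P.p : ℂ) ^ j * (P.p : ℂ) ^ (j + 1) with hf
  have hcont : ∀ j, DifferentiableOn ℂ (f j) K := by
    intro j w hw
    have := hK0 w hw
    apply DifferentiableAt.differentiableWithinAt
    fun_prop (disch := assumption)
  set C : ℝ := 2 * ‖z‖ + 2 / ‖z‖ + 1 with hC
  have hsum : Summable (fun j : ℕ => C * P.p ^ j) :=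
    (summable_geometric_of_lt_one hp0.le hp1).mul_left C
  have hbound : ∀ j, ∀ w ∈ K, ‖f j w‖ ≤ C * P.p ^ j := by
    intro j w hw
    have hpn : ‖(P.p : ℂ)‖ = P.p := by simp [abs_of_pos hp0]
    have hw0 : 0 < ‖w‖ := norm_pos_iff.mpr (hK0 w hw)
    have hpj : 0 < P.p ^ j := by positivity
    have hpj1 : P.p ^ (j + 1) ≤ P.p ^ j := pow_le_pow_of_le_one hp0.le hp1.le (Nat.le_succ j)
    have hpjle : P.p ^ (j + 1) ≤ 1 := pow_le_one₀ hp0.le hp1.le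
    have h1 : ‖w * (P.p : ℂ) ^ j‖ ≤ 2 * ‖z‖ * P.p ^ j := by
      rw [norm_mul, norm_pow, hpn]
      exact mul_le_mul_of_nonneg_right hw.2.le hpj.le
    have h2 : ‖(P.p : ℂ) ^ (j + 1) / w‖ ≤ 2 / ‖z‖ * P.p ^ j := by
      rw [norm_div, norm_pow, hpn, div_le_iff₀ hw0]
      have h3 : 1 ≤ 2 / ‖z‖ * ‖w‖ := by
        have h4 := hw.1
        rw [div_mul_eq_mul_div, le_div_iff₀ hzn]
        linarith
      nlinarith
    have h3 : ‖(P.p : ℂ) ^ j * (P.p : ℂ) ^ (j + 1)‖ ≤ 1 * P.p ^ j := by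
      rw [norm_mul, norm_pow, norm_pow, hpn]
      nlinarith
    calc ‖f j w‖ ≤ ‖w * (P.p : ℂ) ^ j‖ + ‖(P.p : ℂ) ^ (j + 1) / w‖
          + ‖(P.p : ℂ) ^ j * (P.p : ℂ) ^ (j + 1)‖ := by
          refine (norm_add_le _ _).trans (add_le_add_left ?_ _)
          refine (norm_sub_le _ _).trans ?_
          rw [norm_neg]
      _ ≤ C * P.p ^ j := by rw [hC]; linarith
  have hprod := Summable.hasProdLocallyUniformlyOn_nat_one_add hKo hsum
    (Eventually.of_forall hbound) (fun j => (hcont j).continuousOn)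
  have hdiff : DifferentiableOn ℂ (fun w => ∏' j, (1 + f j w)) K := by
    refine TendstoLocallyUniformlyOn.differentiableOn
      (hasProdLocallyUniformlyOn_iff_tendstoLocallyUniformlyOn.mp hprod)
      (Eventually.of_forall fun s => ?_) hKo
    exact DifferentiableOn.fun_finsetProd (fun j _ => (hcont j).const_add 1)
  have heq : (fun w => ∏' j, (1 + f j w)) =ᶠ[𝓝 z] theta P := by
    filter_upwards [hKo.mem_nhds hzK] with w hw
    have hw0 := hK0 w hw
    refine tprod_congr fun j => ?_
    simp only [hf]
    field_simp
    ring
  exact (hdiff.differentiableAt (hKo.mem_nhds hzK)).congr_of_eventuallyEq heq.symm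

theorem ellE_differentiable (P : Params) : Differentiable ℂ (ellE P) := by
  have hq : (P.q : ℂ) ≠ 0 := Complex.ofReal_ne_zero.mpr P.q_pos.ne'
  have hqp : Differentiable ℂ (qpow P) := fun s =>
    (differentiableAt_id.const_cpow (Or.inl hq) : DifferentiableAt ℂ (fun s => (P.q : ℂ) ^ s) s)
  intro s
  have h1 : DifferentiableAt ℂ (fun s : ℂ => qpow P (-2 * s)) s :=
    (hqp (-2 * s)).comp s (differentiableAt_id.const_mul (-2))
  have h2 : qpow P (-2 * s) ≠ 0 := by
    simp [qpow, Complex.cpow_eq_zero_iff, hq]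
  have h3 : DifferentiableAt ℂ (fun s : ℂ => theta P (qpow P (-2 * s))) s :=
    (theta_differentiableAt P h2).fun_comp' s h1
  exact (hqp s).mul h3

theorem ellE_coord_analytic (P : Params) {n : ℕ} (i j : Fin n) (c : ℂ) :
    AnalyticOnNhd ℂ (fun ζ : Dual n => ellE P (coord i j ζ + c)) Set.univ := by
  intro ζ _
  have h1 : AnalyticAt ℂ (fun ζ : Dual n => coord i j ζ + c) ζ :=
    have h0 : AnalyticAt ℂ (coord i j) ζ :=
      (ContinuousLinearMap.apply ℂ ℂ (coroot i j)).analyticAt ζ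
    h0.add analyticAt_const
  exact ((ellE_differentiable P).analyticAt (coord i j ζ + c)).fun_comp
    (f := fun ζ : Dual n => coord i j ζ + c) h1

/-- The function `ζ ↦ E(ζ_ij + c)` as an element of the field of meromorphic functions. -/
def Edyn (P : Params) {n : ℕ} (i j : Fin n) (c : ℂ) : Mer n :=
  algebraMap (Entire n) (Mer n)
    ⟨fun ζ => ellE P (coord i j ζ + c), ellE_coord_analytic P i j c⟩

/-! ### The elliptic R-matrix -/

/-- `α(s, z) = θ(z) θ(q ^ (2 (s + 1))) / (θ(q ^ 2 z) θ(q ^ (2 s)))`. -/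
def alpha (P : Params) (s z : ℂ) : ℂ :=
  theta P z * theta P (qpow P (2 * (s + 1))) /
    (theta P ((P.q : ℂ) ^ 2 * z) * theta P (qpow P (2 * s)))

/-- `β(s, z) = θ(q ^ 2) θ(q ^ (-2 s) z) / (θ(q ^ 2 z) θ(q ^ (-2 s)))`. -/
def beta (P : Params) (s z : ℂ) : ℂ :=
  theta P ((P.q : ℂ) ^ 2) * theta P (qpow P (-2 * s) * z) /
    (theta P ((P.q : ℂ) ^ 2 * z) * theta P (qpow P (-2 * s)))

/-- The matrix element `R^{ab}_{xy}(ζ, z)`, i.e. the coefficient of `e_x ⊗ e_y` in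
`R(ζ, z) (e_a ⊗ e_b)`. -/
def Rmat (P : Params) {n : ℕ} (x y a b : Fin n) (ζ : Dual n) (z : ℂ) : ℂ :=
  if a = b then (if x = a ∧ y = a then 1 else 0)
  else if x = a ∧ y = b then alpha P (coord x y ζ) z
  else if x = b ∧ y = a then beta P (coord x y ζ) z
  else 0

/-- The limit `lim_{w → z} φ(w) g(ζ, w)` exists for generic `ζ` and is the meromorphic function
`r` of `ζ`. -/
def IsSpectralLimit {n : ℕ} (φ : ℂ → ℂ) (g : Dual n → ℂ → ℂ) (z : ℂ) (r : Mer n) : Prop :=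
  ∃ f h : Entire n, h ≠ 0 ∧ r = algebraMap (Entire n) (Mer n) f / algebraMap (Entire n) (Mer n) h ∧
    ∀ ζ : Dual n, h.1 ζ ≠ 0 →
      Tendsto (fun w => φ w * g ζ w) (𝓝[≠] z) (𝓝 (f.1 ζ / h.1 ζ))

/-! ### The algebra of the elliptic quantum matrix semigroup -/

/-- Generators: the elements `f(λ)`, `f(ρ)` of two copies of the field of meromorphic functions,
and `e_ij(z)`. -/
inductive FGen (n : ℕ) : Type
  | lam (f : Mer n)
  | rho (f : Mer n)
  | e (i j : Fin n) (z : ℂˣ)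

/-- The generators in the free algebra. -/
abbrev FGen.free {n : ℕ} (x : FGen n) : FreeAlgebra ℂ (FGen n) := FreeAlgebra.ι ℂ x

/-- Defining relations: `f ↦ f(λ)` and `f ↦ f(ρ)` are homomorphisms of `ℂ`-algebras with commuting
images, the commutation relations of `f(λ)`, `f(ρ)` with `e_ij(z)`, and the RLL relations, where
the entries of the R-matrix are multiplied by a meromorphic function of the spectral variable
(and the limit is taken) in order to include the residual relations. -/
inductive FRel (P : Params) (n : ℕ) :
    FreeAlgebra ℂ (FGen n) → FreeAlgebra ℂ (FGen n) → Prop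
  | lam_const (c : ℂ) :
      FRel P n (FGen.lam (algebraMap ℂ (Mer n) c)).free (algebraMap ℂ _ c)
  | lam_add (f g : Mer n) :
      FRel P n (FGen.lam (f + g)).free ((FGen.lam f).free + (FGen.lam g).free)
  | lam_mul (f g : Mer n) :
      FRel P n (FGen.lam (f * g)).free ((FGen.lam f).free * (FGen.lam g).free)
  | rho_const (c : ℂ) :
      FRel P n (FGen.rho (algebraMap ℂ (Mer n) c)).free (algebraMap ℂ _ c)
  | rho_add (f g : Mer n) :
      FRel P n (FGen.rho (f + g)).free ((FGen.rho f).free + (FGen.rho g).free)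
  | rho_mul (f g : Mer n) :
      FRel P n (FGen.rho (f * g)).free ((FGen.rho f).free * (FGen.rho g).free)
  | lam_rho (f g : Mer n) :
      FRel P n ((FGen.lam f).free * (FGen.rho g).free) ((FGen.rho g).free * (FGen.lam f).free)
  | lam_e (f : Mer n) (i j : Fin n) (z : ℂˣ) :
      FRel P n ((FGen.lam f).free * (FGen.e i j z).free)
        ((FGen.e i j z).free * (FGen.lam (shift (weight i) f)).free)
  | rho_e (f : Mer n) (i j : Fin n) (z : ℂˣ) :
      FRel P n ((FGen.rho f).free * (FGen.e i j z).free)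
        ((FGen.e i j z).free * (FGen.rho (shift (weight j) f)).free)
  | rll (φ : ℂ → ℂ) (hφ : MeromorphicOn φ {0}ᶜ) (a b c d : Fin n) (z₁ z₂ : ℂˣ)
      (r s : Fin n → Fin n → Mer n)
      (hr : ∀ x y, IsSpectralLimit φ (Rmat P a c x y) (z₁ / z₂ : ℂˣ) (r x y))
      (hs : ∀ x y, IsSpectralLimit φ (Rmat P x y b d) (z₁ / z₂ : ℂˣ) (s x y)) :
      FRel P n
        (∑ x, ∑ y, (FGen.lam (r x y)).free * (FGen.e x b z₁).free * (FGen.e y d z₂).free)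
        (∑ x, ∑ y, (FGen.rho (s x y)).free * (FGen.e c y z₂).free * (FGen.e a x z₁).free)

/-- The algebra `F_ell(M(n))`. -/
abbrev Fell (P : Params) (n : ℕ) : Type := RingQuot (FRel P n)

/-- The left moment map `f ↦ f(λ)`. -/
def muL (P : Params) {n : ℕ} (f : Mer n) : Fell P n :=
  RingQuot.mkAlgHom ℂ (FRel P n) (FGen.lam f).free

/-- The right moment map `f ↦ f(ρ)`. -/
def muR (P : Params) {n : ℕ} (f : Mer n) : Fell P n :=
  RingQuot.mkAlgHom ℂ (FRel P n) (FGen.rho f).free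

/-- The generator `e_ij(z)`. -/
def e (P : Params) {n : ℕ} (i j : Fin n) (z : ℂˣ) : Fell P n :=
  RingQuot.mkAlgHom ℂ (FRel P n) (FGen.e i j z).free

/-! ### The left and right elliptic exterior algebras -/

/-- Generators of an elliptic exterior algebra: the elements `f(ζ)` of the field of meromorphic
functions, and `v_i(z)` (respectively `w^i(z)`). -/
inductive EGen (n : ℕ) : Type
  | scal (f : Mer n)
  | v (i : Fin n) (z : ℂˣ)

/-- The generators in the free algebra. -/
abbrev EGen.free {n : ℕ} (x : EGen n) : FreeAlgebra ℂ (EGen n) := FreeAlgebra.ι ℂ x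

/-- Defining relations of the left exterior algebra. The relation `cross` is
`α(ζ_kj, z/w) v_k(z) v_j(w) + β(ζ_kj, z/w) v_j(z) v_k(w) = 0`, together with its residual
relations, obtained by multiplying the coefficients by a meromorphic function of the spectral
variable and taking the limit. -/
inductive LRel (P : Params) (n : ℕ) :
    FreeAlgebra ℂ (EGen n) → FreeAlgebra ℂ (EGen n) → Prop
  | scal_const (c : ℂ) :
      LRel P n (EGen.scal (algebraMap ℂ (Mer n) c)).free (algebraMap ℂ _ c)
  | scal_add (f g : Mer n) :
      LRel P n (EGen.scal (f + g)).free ((EGen.scal f).free + (EGen.scal g).free)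
  | scal_mul (f g : Mer n) :
      LRel P n (EGen.scal (f * g)).free ((EGen.scal f).free * (EGen.scal g).free)
  | scal_v (f : Mer n) (i : Fin n) (z : ℂˣ) :
      LRel P n ((EGen.scal f).free * (EGen.v i z).free)
        ((EGen.v i z).free * (EGen.scal (shift (weight i) f)).free)
  | sq (i : Fin n) (z w : ℂˣ) : LRel P n ((EGen.v i z).free * (EGen.v i w).free) 0
  | cross (φ : ℂ → ℂ) (hφ : MeromorphicOn φ {0}ᶜ) (k j : Fin n) (hkj : k ≠ j) (z w : ℂˣ)
      (r s : Mer n)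
      (hr : IsSpectralLimit φ (fun ζ u => alpha P (coord k j ζ) u) (z / w : ℂˣ) r)
      (hs : IsSpectralLimit φ (fun ζ u => beta P (coord k j ζ) u) (z / w : ℂˣ) s) :
      LRel P n
        ((EGen.scal r).free * (EGen.v k z).free * (EGen.v j w).free
          + (EGen.scal s).free * (EGen.v j z).free * (EGen.v k w).free) 0

/-- Defining relations of the right exterior algebra. The relation `cross` is
`α(ζ_kj, z/w) w^j(w) w^k(z) + β(ζ_jk, z/w) w^k(w) w^j(z) = 0`, together with its residual
relations. -/
inductive RRel (P : Params) (n : ℕ) :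
    FreeAlgebra ℂ (EGen n) → FreeAlgebra ℂ (EGen n) → Prop
  | scal_const (c : ℂ) :
      RRel P n (EGen.scal (algebraMap ℂ (Mer n) c)).free (algebraMap ℂ _ c)
  | scal_add (f g : Mer n) :
      RRel P n (EGen.scal (f + g)).free ((EGen.scal f).free + (EGen.scal g).free)
  | scal_mul (f g : Mer n) :
      RRel P n (EGen.scal (f * g)).free ((EGen.scal f).free * (EGen.scal g).free)
  | scal_v (f : Mer n) (i : Fin n) (z : ℂˣ) :
      RRel P n ((EGen.scal f).free * (EGen.v i z).free)
        ((EGen.v i z).free * (EGen.scal (shift (weight i) f)).free)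
  | sq (i : Fin n) (z w : ℂˣ) : RRel P n ((EGen.v i z).free * (EGen.v i w).free) 0
  | cross (φ : ℂ → ℂ) (hφ : MeromorphicOn φ {0}ᶜ) (k j : Fin n) (hkj : k ≠ j) (z w : ℂˣ)
      (r s : Mer n)
      (hr : IsSpectralLimit φ (fun ζ u => alpha P (coord k j ζ) u) (z / w : ℂˣ) r)
      (hs : IsSpectralLimit φ (fun ζ u => beta P (coord j k ζ) u) (z / w : ℂˣ) s) :
      RRel P n
        ((EGen.scal r).free * (EGen.v j w).free * (EGen.v k z).free
          + (EGen.scal s).free * (EGen.v k w).free * (EGen.v j z).free) 0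

/-- The left elliptic exterior algebra `Λ`. -/
abbrev ExtL (P : Params) (n : ℕ) : Type := RingQuot (LRel P n)

/-- The right elliptic exterior algebra `Λ'`. -/
abbrev ExtR (P : Params) (n : ℕ) : Type := RingQuot (RRel P n)

/-- `f(ζ)` in `Λ`. -/
def scalL (P : Params) {n : ℕ} (f : Mer n) : ExtL P n :=
  RingQuot.mkAlgHom ℂ (LRel P n) (EGen.scal f).free

/-- `v_i(z)` in `Λ`. -/
def v (P : Params) {n : ℕ} (i : Fin n) (z : ℂˣ) : ExtL P n :=
  RingQuot.mkAlgHom ℂ (LRel P n) (EGen.v i z).free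

/-- `f(ζ)` in `Λ'`. -/
def scalR (P : Params) {n : ℕ} (f : Mer n) : ExtR P n :=
  RingQuot.mkAlgHom ℂ (RRel P n) (EGen.scal f).free

/-- `w^i(z)` in `Λ'`. -/
def w (P : Params) {n : ℕ} (i : Fin n) (z : ℂˣ) : ExtR P n :=
  RingQuot.mkAlgHom ℂ (RRel P n) (EGen.v i z).free

/-! ### Normalizing factors, sign functions, normalized monomials -/

/-- `F_I(ζ) = ∏_{i < j in I} E(ζ_ij + 1)`. -/
def normLow (P : Params) {n : ℕ} (I : Finset (Fin n)) : Mer n :=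
  ∏ x ∈ (I ×ˢ I).filter (fun x => x.1 < x.2), Edyn P x.1 x.2 1

/-- `F^I(ζ) = ∏_{i < j in I} E(ζ_ij)`. -/
def normUp (P : Params) {n : ℕ} (I : Finset (Fin n)) : Mer n :=
  ∏ x ∈ (I ×ˢ I).filter (fun x => x.1 < x.2), Edyn P x.1 x.2 0

/-- The left elliptic sign function `sgn_I(σ; ζ)`. -/
def sgnLow (P : Params) {n : ℕ} (I : Finset (Fin n)) (σ : Equiv.Perm (Fin n)) : Mer n :=
  ∏ x ∈ (I ×ˢ I).filter (fun x => x.1 < x.2 ∧ σ x.2 < σ x.1),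
    Edyn P (σ x.1) (σ x.2) 1 / Edyn P (σ x.2) (σ x.1) 1

/-- The right elliptic sign function `sgn^I(σ; ζ)`. -/
def sgnUp (P : Params) {n : ℕ} (I : Finset (Fin n)) (σ : Equiv.Perm (Fin n)) : Mer n :=
  ∏ x ∈ (I ×ˢ I).filter (fun x => x.1 < x.2 ∧ σ x.2 < σ x.1),
    Edyn P (σ x.2) (σ x.1) 0 / Edyn P (σ x.1) (σ x.2) 0

/-- `q ^ (2 m) z`. -/
def qz (P : Params) (m : ℕ) (z : ℂˣ) : ℂˣ := P.qUnit ^ (2 * m) * z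

/-- `v_I(z) = F_I(ζ)⁻¹ v_{i_d}(q ^ (2 (d - 1)) z) ⋯ v_{i_1}(z)` where `I = {i_1 < ⋯ < i_d}`. -/
def vSet (P : Params) {n : ℕ} (I : Finset (Fin n)) (z : ℂˣ) : ExtL P n :=
  scalL P (normLow P I)⁻¹ *
    (List.ofFn fun k : Fin I.card => v P (I.orderEmbOfFin rfl k.rev) (qz P k.rev z)).prod

/-- `w^I(z) = F^I(ζ) w^{i_1}(z) ⋯ w^{i_d}(q ^ (2 (d - 1)) z)` where `I = {i_1 < ⋯ < i_d}`. -/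
def wSet (P : Params) {n : ℕ} (I : Finset (Fin n)) (z : ℂˣ) : ExtR P n :=
  scalR P (normUp P I) *
    (List.ofFn fun k : Fin I.card => w P (I.orderEmbOfFin rfl k) (qz P k z)).prod

/-! ### Elliptic minors -/

/-- The permutations of `{1, …, n}` that fix every element outside `I`. -/
def permsOf {n : ℕ} (I : Finset (Fin n)) : Finset (Equiv.Perm (Fin n)) :=
  Finset.univ.filter fun σ => ∀ x, x ∉ I → σ x = x

/-- The left elliptic minor: zero if `#I ≠ #J`, and for `I = {i_1 < ⋯ < i_d}`,
`J = {j_1 < ⋯ < j_d}` it is `F_J(ρ) / F_I(λ)` times the sum over the permutations `τ` of `J` of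
`sgn_J(τ; ρ) e_{i_d, τ(j_d)}(q ^ (2 (d - 1)) z) ⋯ e_{i_1, τ(j_1)}(z)`. -/
def leftMinor (P : Params) {n : ℕ} (I J : Finset (Fin n)) (z : ℂˣ) : Fell P n :=
  if h : J.card = I.card then
    muL P (normLow P I)⁻¹ * muR P (normLow P J) *
      ∑ τ ∈ permsOf J, muR P (sgnLow P J τ) *
        (List.ofFn fun k : Fin I.card =>
          e P (I.orderEmbOfFin rfl k.rev) (τ (J.orderEmbOfFin h k.rev)) (qz P k.rev z)).prod
  else 0

/-- The right elliptic minor: zero if `#I ≠ #J`, and for `I = {i_1 < ⋯ < i_d}`,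
`J = {j_1 < ⋯ < j_d}` it is `F^J(ρ) / F^I(λ)` times the sum over the permutations `σ` of `I` of
`sgn^I(σ; λ)⁻¹ e_{σ(i_1), j_1}(z) ⋯ e_{σ(i_d), j_d}(q ^ (2 (d - 1)) z)`. -/
def rightMinor (P : Params) {n : ℕ} (I J : Finset (Fin n)) (z : ℂˣ) : Fell P n :=
  if h : J.card = I.card then
    muL P (normUp P I)⁻¹ * muR P (normUp P J) *
      ∑ σ ∈ permsOf I, muL P (sgnUp P I σ)⁻¹ *
        (List.ofFn fun k : Fin I.card =>
          e P (σ (I.orderEmbOfFin rfl k)) (J.orderEmbOfFin h k) (qz P k z)).prod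
  else 0

/-- `S_l(I, J; ζ)`: `∏_{i ∈ I, j ∈ J} E(ζ_ji + 1)` for disjoint sets, and zero otherwise. -/
def Sl (P : Params) {n : ℕ} (I J : Finset (Fin n)) : Mer n :=
  if Disjoint I J then ∏ i ∈ I, ∏ j ∈ J, Edyn P j i 1 else 0

/-- `S_r(I, J; ζ)`: `∏_{i ∈ I, j ∈ J} E(ζ_ij)⁻¹` for disjoint sets, and zero otherwise. -/
def Sr (P : Params) {n : ℕ} (I J : Finset (Fin n)) : Mer n :=
  if Disjoint I J then ∏ i ∈ I, ∏ j ∈ J, (Edyn P i j 0)⁻¹ else 0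

end

end EllipticGL

open EllipticGL

/-!
All computations take place at spectral parameters in one geometric progression `q ^ (2 k) z`, and
the relations that matter are those between two such points. The elements of the dynamical
R-matrix may have poles there; multiplication by `regFactor`, essentially `θ(q ^ 2 w)`, removes
them, and the limits are quotients of values of `E` (`alphaReg`, `betaReg`).

*Products of normalized monomials.* At neighbouring points the relations of either exterior algebra
say that `x_i(k + 1) x_j(k) / G i j` is symmetric in `i, j`, for a kernel `G`: `E(ζ_ji + 1)` on the
left and `E(ζ_ij)⁻¹` on the right. This is the notion of an `ExteriorSystem`. It follows that a
monomial divided by the product of `G` over its pairs of factors depends on the set of its factors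
only (`ExteriorSystem.mono_perm`). The product of the monomials of disjoint `I` and `J` therefore
differs from that of `I ∪ J` by `∏ G i j` over `I × J`, and it vanishes if `I` meets `J`. The
structure functions are unique because the algebras act on functions on the subsets of `[1, n]`,
a generator adding its index to a subset, in such a way that the normalized monomial of `I` sends
the vacuum to the basis vector of `I` (`fockGen_cross`, `fockL_prod_apply`, `fockR_prod_apply`).

*Laplace expansions.* The matrix `e_ij` coacts on the exterior algebra, by
`x_i ↦ ∑ j, e_ij ⊗ x_j`; in matrix coefficients this is again a representation of the relations of
an exterior system (`MatrixSystem.toExteriorSystem`). The minors are the matrix coefficients of the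
normalized monomials, with the signed sums over permutations as explicit form
(`MatrixSystem.minor_eq_sum`). Applying the product formula to both the monomials in the
coaction and those coacted upon gives the Laplace expansion (`MatrixSystem.row_S_mul_minor`). The
left minors come from the left kernel, and this gives the expansion in rows. The right minors come
from the right kernel and the transposed matrix, and this gives the expansion in columns.

*Left and right minors agree.* The proof is by induction on the size. The RLL relations between the
first and the last point of the progression, multiplied by minors of size two less and summed over
a row and a column, contain both the expansion of a left minor along its rightmost factor and that
of a right minor along its rightmost factor. The terms with coefficient `alphaReg` supply all but
one summand of each expansion. Those with coefficient `betaReg` are summed by the partial fraction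
identity `ellMer_partialFraction` for `E` (`sum_S_mul_betaReg`) and supply the missing summand.
The identity is deduced by induction from Weierstrass' three-term identity `ellE_weierstrass`, which
holds because the theta functions of degree two form a two-dimensional space: they are determined by
two of their Laurent coefficients (`eq_zero_of_laurentCoeff_eq_zero`). Genericity of `p` and `q`
enters through the nonvanishing of `E` at nonzero integers (`ellE_intCast_ne_zero`).
-/

namespace EllipticGL

/-! ### The theta function -/

/-- The product `∏_{j ≥ 0} (1 - z p ^ j)`; the theta function is the product of two of these. -/
noncomputable def thetaHalf (P : Params) (z : ℂ) : ℂ := ∏' j : ℕ, (1 - z * (P.p : ℂ) ^ j)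

theorem Params.p_ne_zero (P : Params) : (P.p : ℂ) ≠ 0 :=
  Complex.ofReal_ne_zero.mpr P.p_pos.ne'

theorem Params.q_ne_zero (P : Params) : (P.q : ℂ) ≠ 0 :=
  Complex.ofReal_ne_zero.mpr P.q_pos.ne'

theorem summable_norm_mul_p_pow (P : Params) (z : ℂ) :
    Summable fun j : ℕ => ‖-(z * (P.p : ℂ) ^ j)‖ := by
  have h : Summable fun j : ℕ => ‖z‖ * P.p ^ j :=
    (summable_geometric_of_lt_one P.p_pos.le P.p_lt_one).mul_left _
  refine h.congr fun j => ?_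
  rw [norm_neg, norm_mul, norm_pow, Complex.norm_real, Real.norm_of_nonneg P.p_pos.le]

theorem multipliable_thetaHalf (P : Params) (z : ℂ) :
    Multipliable fun j : ℕ => 1 - z * (P.p : ℂ) ^ j := by
  simpa [sub_eq_add_neg] using multipliable_one_add_of_summable (summable_norm_mul_p_pow P z)

theorem thetaHalf_ne_zero (P : Params) {z : ℂ} (h : ∀ j : ℕ, z * (P.p : ℂ) ^ j ≠ 1) :
    thetaHalf P z ≠ 0 := by
  have := tprod_one_add_ne_zero_of_summable (f := fun j : ℕ => -(z * (P.p : ℂ) ^ j))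
    (fun j hj => h j (by linear_combination -hj)) (summable_norm_mul_p_pow P z)
  simpa [thetaHalf, sub_eq_add_neg] using this

theorem thetaHalf_eq (P : Params) (z : ℂ) :
    thetaHalf P z = (1 - z) * thetaHalf P (P.p * z) := by
  have h := tprod_eq_zero_mul' (f := fun j : ℕ => 1 - z * (P.p : ℂ) ^ j)
    ((multipliable_thetaHalf P (P.p * z)).congr fun j => by ring)
  rw [thetaHalf, h, thetaHalf]
  congr 1
  · simp
  · exact tprod_congr fun j => by ring

theorem theta_eq (P : Params) (z : ℂ) : theta P z = thetaHalf P z * thetaHalf P (P.p / z) := by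
  rw [theta, thetaHalf, thetaHalf, ← (multipliable_thetaHalf P z).tprod_mul
    (multipliable_thetaHalf P (P.p / z))]
  exact tprod_congr fun j => by ring

theorem theta_ne_zero (P : Params) {z : ℂ} (hz : z ≠ 0) (h : ∀ k : ℤ, z ≠ (P.p : ℂ) ^ k) :
    theta P z ≠ 0 := by
  have hp := P.p_ne_zero
  rw [theta_eq]
  refine mul_ne_zero (thetaHalf_ne_zero P fun j hj => h (-j) ?_)
    (thetaHalf_ne_zero P fun j hj => h (j + 1) ?_)
  · rw [zpow_neg, zpow_natCast]
    exact eq_inv_of_mul_eq_one_left hj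
  · rw [div_mul_eq_mul_div, div_eq_one_iff_eq hz] at hj
    rw [← hj, zpow_add₀ hp, zpow_natCast, zpow_one, mul_comm]

theorem theta_p_mul (P : Params) {z : ℂ} (hz : z ≠ 0) : theta P (P.p * z) = -z⁻¹ * theta P z := by
  have hp := P.p_ne_zero
  rw [theta_eq, theta_eq, thetaHalf_eq P z, show (P.p : ℂ) / (P.p * z) = z⁻¹ by field_simp,
    thetaHalf_eq P z⁻¹, show (P.p : ℂ) * z⁻¹ = P.p / z by ring]
  field_simp
  ring

theorem theta_inv (P : Params) {z : ℂ} (hz : z ≠ 0) : theta P z⁻¹ = -z⁻¹ * theta P z := by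
  have hp := P.p_ne_zero
  rw [← theta_p_mul P hz, theta_eq, theta_eq, show (P.p : ℂ) / (P.p * z) = z⁻¹ by field_simp,
    show (P.p : ℂ) / z⁻¹ = P.p * z by field_simp, mul_comm]

/-! ### Theta functions of degree two -/

/-- The Laurent coefficient `∮ g(z) z ^ (-n - 1) dz`, without the factor `2πi`. -/
noncomputable def laurentCoeff (g : ℂ → ℂ) (n : ℤ) : ℂ := ∮ z in C(0, 1), g z * z ^ (-n - 1)

/-- Shifting the contour from `|z| = 1` to `|z| = p` turns the multiplier `z ^ (-2)` into a
two-step recursion for the Laurent coefficients. -/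
theorem laurentCoeff_eq (P : Params) {g : ℂ → ℂ} (hg : DifferentiableOn ℂ g {0}ᶜ)
    (hp : ∀ z ≠ 0, g (P.p * z) = z ^ (-2 : ℤ) * g z) (n : ℤ) :
    laurentCoeff g n = (P.p : ℂ) ^ (-n) * laurentCoeff g (n + 2) := by
  have hp0 := P.p_pos
  have hpc := P.p_ne_zero
  have hd : ∀ z : ℂ, z ≠ 0 → DifferentiableAt ℂ (fun z => g z * z ^ (-n - 1)) z := fun z hz =>
    (hg.differentiableAt (isOpen_compl_singleton.mem_nhds hz)).mul
      (differentiableAt_zpow.mpr (Or.inl hz))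
  have h1 : laurentCoeff g n = ∮ z in C(0, P.p), g z * z ^ (-n - 1) := by
    refine Complex.circleIntegral_eq_of_differentiable_on_annulus_off_countable hp0
      P.p_lt_one.le (s := ∅) Set.countable_empty (fun z hz => ?_) fun z hz => ?_
    · refine (hd z ?_).continuousAt.continuousWithinAt
      rintro rfl
      exact hz.2 (by simpa using hp0)
    · refine hd z ?_
      rintro rfl
      exact hz.1.2 (by simpa using hp0.le)
  rw [h1, laurentCoeff, circleIntegral, circleIntegral, ← intervalIntegral.integral_const_mul]
  refine intervalIntegral.integral_congr fun t _ => ?_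
  have hc : circleMap 0 P.p t = P.p * circleMap 0 1 t := by simp [circleMap]
  have hc0 : circleMap 0 1 t ≠ 0 := circleMap_ne_center one_ne_zero
  simp only [deriv_circleMap, smul_eq_mul]
  rw [hc, hp _ hc0, mul_zpow, show -(n + 2) - 1 = -2 + (-n - 1) by ring, zpow_add₀ hc0,
    show (-n : ℤ) = (-n - 1) + 1 by ring, zpow_add₀ hpc, zpow_one]
  ring_nf

/-- A theta function of degree two is determined by two of its Laurent coefficients. -/
theorem eq_zero_of_laurentCoeff_eq_zero (P : Params) {g : ℂ → ℂ} (hg : DifferentiableOn ℂ g {0}ᶜ)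
    (hp : ∀ z ≠ 0, g (P.p * z) = z ^ (-2 : ℤ) * g z) (h0 : laurentCoeff g 0 = 0)
    (h1 : laurentCoeff g 1 = 0) : ∀ z ≠ 0, g z = 0 := by
  have hpc := P.p_ne_zero
  have hrec := laurentCoeff_eq P hg hp
  have hup : ∀ n, laurentCoeff g n = 0 → laurentCoeff g (n + 2) = 0 := fun n hn => by
    have := hrec n
    rw [hn] at this
    exact (mul_eq_zero.mp this.symm).resolve_left (zpow_ne_zero _ hpc)
  have hall : ∀ n : ℤ, laurentCoeff g n = 0 ∧ laurentCoeff g (n + 1) = 0 := by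
    intro n
    induction n using Int.induction_on with
    | zero => exact ⟨h0, h1⟩
    | succ k ih => exact ⟨ih.2, by simpa [add_assoc] using hup _ ih.1⟩
    | pred k ih =>
      refine ⟨?_, by simpa using ih.1⟩
      rw [hrec, show -(k : ℤ) - 1 + 2 = -k + 1 by ring, ih.2, mul_zero]
  -- All Fourier coefficients of the restriction of `g` to the unit circle vanish.
  have : Fact (0 < 2 * Real.pi) := ⟨by positivity⟩
  let f : C(AddCircle (2 * Real.pi), ℂ) :=
    ⟨fun t => g (AddCircle.toCircle t), by
      refine continuous_iff_continuousAt.mpr fun t => ?_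
      have hne : ((AddCircle.toCircle t : Circle) : ℂ) ≠ 0 := Circle.coe_ne_zero _
      have hc : ContinuousAt g ((AddCircle.toCircle t : Circle) : ℂ) :=
        (hg.differentiableAt (isOpen_compl_singleton.mem_nhds hne)).continuousAt
      exact hc.comp (f := fun t : AddCircle (2 * Real.pi) => ((AddCircle.toCircle t : Circle) : ℂ))
        (continuous_subtype_val.comp AddCircle.continuous_toCircle).continuousAt⟩
  have hcirc : ∀ t : ℝ, ((AddCircle.toCircle (t : AddCircle (2 * Real.pi)) : Circle) : ℂ)
      = circleMap 0 1 t := by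
    intro t
    rw [AddCircle.toCircle_apply_mk, Circle.coe_exp, circleMap]
    have : (2 * Real.pi : ℝ) ≠ 0 := by positivity
    rw [div_self this]
    simp
  have hcoeff : fourierCoeff f = 0 := by
    funext n
    have h := (hall n).1
    rw [fourierCoeff_eq_intervalIntegral _ _ 0, zero_add]
    have h2 : laurentCoeff g n
        = Complex.I * ∫ x in (0 : ℝ)..2 * Real.pi, @fourier (2 * Real.pi) (-n) x • f x := by
      rw [laurentCoeff, circleIntegral, ← intervalIntegral.integral_const_mul]
      refine intervalIntegral.integral_congr fun t _ => ?_
      have hc0 : circleMap 0 1 t ≠ 0 := circleMap_ne_center one_ne_zero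
      have hf : (@fourier (2 * Real.pi) (-n) (t : AddCircle (2 * Real.pi)))
          = circleMap 0 1 t ^ (-n) := by
        rw [fourier_apply, AddCircle.toCircle_zsmul, Circle.coe_zpow, hcirc]
      simp only [deriv_circleMap, smul_eq_mul, f, ContinuousMap.coe_mk]
      rw [hf, hcirc, zpow_sub_one₀ hc0]
      field_simp
    rw [h] at h2
    rw [(mul_eq_zero.mp h2.symm).resolve_left Complex.I_ne_zero, smul_zero]
    rfl
  have hz : ∀ t, f t = 0 := fun t => by
    have h := has_pointwise_sum_fourier_series_of_summable (f := f)
      (by rw [hcoeff]; exact summable_zero) t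
    rw [hcoeff] at h
    simpa using h.unique (by simp [hasSum_zero])
  have hunit : ∀ z : ℂ, ‖z‖ = 1 → g z = 0 := by
    intro z hz1
    have h := hz (Complex.arg z : ℝ)
    have h2 : circleMap 0 1 (Complex.arg z) = z := by
      have := Complex.norm_mul_exp_arg_mul_I z
      rw [hz1] at this
      simpa [circleMap] using this
    have h3 : g (AddCircle.toCircle ((Complex.arg z : ℝ) : AddCircle (2 * Real.pi))) = 0 := h
    rwa [hcirc, h2] at h3
  have han : AnalyticOnNhd ℂ g {0}ᶜ := hg.analyticOnNhd isOpen_compl_singleton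
  have hconn : IsPreconnected ({0}ᶜ : Set ℂ) :=
    (isConnected_compl_singleton_of_one_lt_rank (by simp) 0).isPreconnected
  have hfreq : ∃ᶠ z in 𝓝[≠] (1 : ℂ), g z = (fun _ => (0 : ℂ)) z := by
    have htend : Tendsto (fun t : ℝ => circleMap 0 1 t) (𝓝[>] 0) (𝓝[≠] (1 : ℂ)) := by
      refine tendsto_nhdsWithin_iff.mpr ⟨?_, ?_⟩
      · have : Tendsto (fun t : ℝ => circleMap 0 1 t) (𝓝 0) (𝓝 (circleMap 0 1 0)) :=
          (continuous_circleMap 0 1).continuousAt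
        simpa [circleMap] using this.mono_left nhdsWithin_le_nhds
      · have : ∀ᶠ t : ℝ in 𝓝[>] 0, t ∈ Set.Ioo (0 : ℝ) 1 := Ioo_mem_nhdsGT one_pos
        filter_upwards [this] with t ht h1
        have h2 := congrArg Complex.im (show circleMap 0 1 t = 1 from h1)
        simp only [circleMap, Complex.ofReal_one, one_mul, zero_add, Complex.exp_ofReal_mul_I_im,
          Complex.one_im] at h2
        exact (Real.sin_pos_of_pos_of_lt_pi ht.1 (by linarith [ht.2, Real.pi_gt_three])).ne' h2
    refine htend.frequently (Eventually.frequently (Eventually.of_forall fun t => ?_))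
    exact hunit _ (by simp)
  intro z hz0
  exact han.eqOn_of_preconnected_of_frequently_eq analyticOnNhd_const hconn
    (by simp : (1 : ℂ) ∈ ({0}ᶜ : Set ℂ)) hfreq hz0

/-! ### Weierstrass' three-term identity -/

theorem qpow_ne_zero (P : Params) (s : ℂ) : qpow P s ≠ 0 := by
  simp [qpow, Complex.cpow_eq_zero_iff, P.q_ne_zero]

theorem qpow_add (P : Params) (s t : ℂ) : qpow P (s + t) = qpow P s * qpow P t :=
  Complex.cpow_add _ _ P.q_ne_zero

theorem qpow_neg (P : Params) (s : ℂ) : qpow P (-s) = (qpow P s)⁻¹ := Complex.cpow_neg _ _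

theorem qpow_intCast (P : Params) (k : ℤ) : qpow P k = (P.q : ℂ) ^ k := Complex.cpow_intCast _ _

theorem ellE_neg (P : Params) (s : ℂ) : ellE P (-s) = -ellE P s := by
  have h := qpow_ne_zero P s
  have h2 : qpow P (-2 * s) = (qpow P s)⁻¹ * (qpow P s)⁻¹ := by
    rw [show -2 * s = -s + -s by ring, qpow_add, qpow_neg]
  have h3 : qpow P (-2 * -s) = (qpow P (-2 * s))⁻¹ := by
    rw [← qpow_neg]; congr 1; ring
  rw [ellE, ellE, h3, theta_inv P (qpow_ne_zero _ _), qpow_neg, h2]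
  field_simp

theorem theta_qpow (P : Params) (s : ℂ) : theta P (qpow P (2 * s)) = -(qpow P s * ellE P s) := by
  have h := qpow_ne_zero P s
  have : ellE P (-s) = qpow P (-s) * theta P (qpow P (2 * s)) := by
    rw [ellE]; congr 3; ring
  rw [ellE_neg, qpow_neg] at this
  field_simp at this
  linear_combination -this

/-- `E` vanishes at no nonzero integer, because `p` and `q` are generic. -/
theorem ellE_intCast_ne_zero (P : Params) {m : ℤ} (hm : m ≠ 0) : ellE P m ≠ 0 := by
  refine mul_ne_zero (qpow_ne_zero _ _) (theta_ne_zero P (qpow_ne_zero _ _) fun k hk => hm ?_)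
  have h1 : qpow P (-2 * m) = ((P.q ^ (-2 * m) : ℝ) : ℂ) := by
    rw [show (-2 : ℂ) * m = ((-2 * m : ℤ) : ℂ) by push_cast; ring, qpow_intCast]
    push_cast; rfl
  rw [h1, ← Complex.ofReal_zpow] at hk
  have h2 : P.q ^ (-2 * m) = P.p ^ k := by exact_mod_cast hk
  have h3 := P.generic (-k) (-2 * m) (by
    rw [h2, ← zpow_add₀ P.p_pos.ne']; simp)
  have := h3.2
  omega

/-- The kernel `E(s + t) E(s - t)` is, up to a factor, a theta function of degree two in
`q ^ (-2 s)`. As these form a two-dimensional space, any three values of `t` are dependent. -/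
theorem exists_ellE_kernel_relation (P : Params) (t : Fin 3 → ℂ) :
    ∃ c : Fin 3 → ℂ, c ≠ 0 ∧ ∀ s, ∑ j, c j * (ellE P (s + t j) * ellE P (s - t j)) = 0 := by
  let y : Fin 3 → ℂ := fun j => qpow P (-2 * t j)
  have hy : ∀ j, y j ≠ 0 := fun j => qpow_ne_zero _ _
  let g : Fin 3 → ℂ → ℂ := fun j x => theta P (x * y j) * theta P (x / y j)
  have hg : ∀ j, DifferentiableOn ℂ (g j) {0}ᶜ := by
    intro j x hx
    have hx0 : x ≠ 0 := hx
    refine DifferentiableAt.differentiableWithinAt (DifferentiableAt.mul ?_ ?_)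
    · exact (theta_differentiableAt P (mul_ne_zero hx0 (hy j))).fun_comp' x (by fun_prop)
    · exact (theta_differentiableAt P (div_ne_zero hx0 (hy j))).fun_comp' x (by fun_prop)
  have hgp : ∀ j, ∀ x ≠ 0, g j (P.p * x) = x ^ (-2 : ℤ) * g j x := by
    intro j x hx
    have h := hy j
    simp only [g]
    rw [mul_assoc, mul_div_assoc, theta_p_mul P (mul_ne_zero hx h),
      theta_p_mul P (div_ne_zero hx h),
      zpow_neg]
    field_simp
  obtain ⟨c, hc0, hc⟩ : ∃ c : Fin 3 → ℂ, c ≠ 0 ∧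
      ∀ i : Fin 2, ∑ j, laurentCoeff (g j) (i : ℕ) * c j = 0 := by
    let M := Matrix.of fun (i : Fin 2) (j : Fin 3) => laurentCoeff (g j) (i : ℕ)
    obtain ⟨c, hc, hc0⟩ := Submodule.exists_mem_ne_zero_of_ne_bot
      (LinearMap.ker_ne_bot_of_finrank_lt (f := M.mulVecLin) (by simp))
    exact ⟨c, hc0, fun i => congrFun hc i⟩
  refine ⟨c, hc0, fun s => ?_⟩
  have hlin : ∀ n : ℤ, laurentCoeff (fun x => ∑ j, c j * g j x) n
      = ∑ j, laurentCoeff (g j) n * c j := by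
    intro n
    simp only [laurentCoeff, Finset.sum_mul]
    have hci : ∀ j ∈ (Finset.univ : Finset (Fin 3)),
        CircleIntegrable (fun z => c j * g j z * z ^ (-n - 1)) 0 1 := by
      intro j _
      refine ContinuousOn.circleIntegrable zero_le_one fun z hz => ?_
      have hz0 : z ≠ 0 := by
        rintro rfl
        simp at hz
      exact ((((hg j).differentiableAt (isOpen_compl_singleton.mem_nhds hz0)).continuousAt.const_mul
        (c j)).mul (continuousAt_zpow₀ z _ (Or.inl hz0))).continuousWithinAt
    rw [circleIntegral.integral_fun_sum hci]
    refine Finset.sum_congr rfl fun j _ => ?_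
    rw [mul_comm _ (c j), ← circleIntegral.integral_const_mul]
    simp only [mul_assoc]
  have hzero := eq_zero_of_laurentCoeff_eq_zero P (g := fun x => ∑ j, c j * g j x)
    (DifferentiableOn.fun_sum fun j _ => (hg j).const_mul (c j))
    (fun x hx => by
      simp only [hgp _ x hx, Finset.mul_sum]
      exact Finset.sum_congr rfl fun j _ => by ring)
    (by rw [hlin]; exact_mod_cast hc 0) (by rw [hlin]; exact_mod_cast hc 1)
    (qpow P (-2 * s)) (qpow_ne_zero _ _)
  have hker : ∀ j, ellE P (s + t j) * ellE P (s - t j)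
      = qpow P s * qpow P s * g j (qpow P (-2 * s)) := by
    intro j
    have h1 : qpow P (-2 * (s + t j)) = qpow P (-2 * s) * y j := by
      rw [mul_add, qpow_add]
    have h2 : qpow P (-2 * (s - t j)) = qpow P (-2 * s) / y j := by
      rw [mul_sub, sub_eq_add_neg, qpow_add, qpow_neg, div_eq_mul_inv]
    have h3 : qpow P (s + t j) * qpow P (s - t j) = qpow P s * qpow P s := by
      rw [← qpow_add, ← qpow_add]; congr 1; ring
    simp only [ellE, g, h1, h2]
    linear_combination theta P (qpow P (-2 * s) * y j) * theta P (qpow P (-2 * s) / y j) * h3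
  simp only [hker, mul_left_comm _ (qpow P s * qpow P s), ← Finset.mul_sum]
  rw [hzero, mul_zero]

/-- Weierstrass' identity: the antisymmetric kernel `E(s + t) E(s - t)` has rank at most two, so
its `4 × 4` Pfaffians vanish. -/
theorem ellE_weierstrass (P : Params) (a b c d : ℂ) :
    ellE P (a + b) * ellE P (a - b) * (ellE P (c + d) * ellE P (c - d))
      - ellE P (a + c) * ellE P (a - c) * (ellE P (b + d) * ellE P (b - d))
      + ellE P (a + d) * ellE P (a - d) * (ellE P (b + c) * ellE P (b - c)) = 0 := by
  set k : ℂ → ℂ → ℂ := fun s t => ellE P (s + t) * ellE P (s - t) with hk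
  have hanti : ∀ s t, k t s = -k s t := fun s t => by
    simp only [hk]
    rw [add_comm t s, ← neg_sub s t, ellE_neg]; ring
  have hdiag : ∀ s, k s s = 0 := fun s => by
    have := hanti s s
    linear_combination this / 2
  obtain ⟨e, he0, he⟩ := exists_ellE_kernel_relation P ![b, c, d]
  have hs : ∀ s, e 0 * k s b + e 1 * k s c + e 2 * k s d = 0 := fun s => by
    have := he s
    simpa [Fin.sum_univ_three] using this
  change k a b * k c d - k a c * k b d + k a d * k b c = 0
  have ha := hs a
  have hb := hs b
  have hc := hs c
  have hd := hs d
  rw [hdiag, hanti b c] at hc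
  rw [hdiag] at hb
  rw [hdiag, hanti b d, hanti c d] at hd
  have key : ∀ j, e j * (k a b * k c d - k a c * k b d + k a d * k b c) = 0 := by
    intro j
    fin_cases j
    · simp only [Fin.zero_eta, Fin.isValue]
      linear_combination k c d * ha + k a c * hd - k a d * hc
    · simp only [Fin.mk_one, Fin.isValue]
      linear_combination -k b d * ha + k a d * hb - k a b * hd
    · simp only [Fin.reduceFinMk, Fin.isValue]
      linear_combination k b c * ha + k a b * hc - k a c * hb
  by_contra hne
  exact he0 (funext fun j => (mul_eq_zero.mp (key j)).resolve_right hne)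

/-! ### Elliptic functions of the dynamical variable -/

/-- The coordinate `ζ ↦ ζ_ij` as an entire function. -/
noncomputable def coordEntire {n : ℕ} (i j : Fin n) : Entire n :=
  ⟨coord i j, fun ζ _ => (ContinuousLinearMap.apply ℂ ℂ (coroot i j)).analyticAt ζ⟩

/-- The meromorphic function `ζ ↦ E(g(ζ))` attached to an entire function `g`. -/
noncomputable def ellMer (P : Params) {n : ℕ} (g : Entire n) : Mer n :=
  algebraMap (Entire n) (Mer n) ⟨fun ζ => ellE P (g.1 ζ), fun ζ hζ =>
    ((ellE_differentiable P).analyticAt (g.1 ζ)).fun_comp (f := g.1) (g.2 ζ hζ)⟩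

theorem Edyn_eq_ellMer (P : Params) {n : ℕ} (i j : Fin n) (c : ℂ) :
    Edyn P i j c = ellMer P (coordEntire i j + algebraMap ℂ (Entire n) c) := rfl

theorem Edyn_zero_eq_ellMer (P : Params) {n : ℕ} (i j : Fin n) :
    Edyn P i j 0 = ellMer P (coordEntire i j) := by
  rw [Edyn_eq_ellMer, map_zero, add_zero]

theorem ellMer_neg (P : Params) {n : ℕ} (g : Entire n) : ellMer P (-g) = -ellMer P g := by
  rw [ellMer, ellMer, ← map_neg]
  congr 1
  exact Subtype.ext (funext fun ζ => ellE_neg P (g.1 ζ))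

theorem ellMer_zero (P : Params) {n : ℕ} : ellMer P (0 : Entire n) = 0 := by
  rw [ellMer, ← map_zero (algebraMap (Entire n) (Mer n))]
  congr 1
  refine Subtype.ext (funext fun ζ => ?_)
  have h := ellE_neg P 0
  rw [neg_zero] at h
  exact CharZero.eq_neg_self_iff.mp h

theorem ellMer_ne_zero (P : Params) {n : ℕ} {g : Entire n} (ζ : Dual n)
    (h : ellE P (g.1 ζ) ≠ 0) : ellMer P g ≠ 0 := by
  intro h0
  have h1 := (IsFractionRing.injective (Entire n) (Mer n)) (h0.trans (map_zero _).symm)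
  exact h (congrFun (congrArg Subtype.val h1) ζ)

theorem ellMer_natCast_ne_zero (P : Params) {n m : ℕ} (hm : m ≠ 0) :
    ellMer P (m : Entire n) ≠ 0 := by
  refine ellMer_ne_zero P 0 ?_
  have := ellE_intCast_ne_zero P (m := m) (by exact_mod_cast hm)
  exact_mod_cast this

theorem coord_smul_weight {n : ℕ} {i j : Fin n} (hij : i ≠ j) (t : ℂ) :
    coord i j (t • weight i) = t := by
  change t * (Pi.single i (1 : ℂ) - Pi.single j (1 : ℂ) : Fin n → ℂ) i = t
  simp [hij]

theorem Edyn_ne_zero (P : Params) {n : ℕ} {i j : Fin n} (hij : i ≠ j) (c : ℂ) :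
    Edyn P i j c ≠ 0 := by
  rw [Edyn_eq_ellMer]
  refine ellMer_ne_zero P ((1 - c) • weight i) ?_
  have h1 : (coordEntire i j + algebraMap ℂ (Entire n) c).1 ((1 - c) • weight i) = 1 := by
    change coord i j ((1 - c) • weight i) + c = 1
    rw [coord_smul_weight hij]; ring
  rw [h1]
  exact_mod_cast ellE_intCast_ne_zero P one_ne_zero

theorem coord_swap {n : ℕ} (i j : Fin n) (ζ : Dual n) : coord j i ζ = -coord i j ζ := by
  rw [coord, coord, ← map_neg]
  congr 1
  exact Subtype.ext (neg_sub _ _).symm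

theorem coordEntire_swap {n : ℕ} (i j : Fin n) : coordEntire j i = -coordEntire i j :=
  Subtype.ext (funext fun ζ => coord_swap i j ζ)

theorem coordEntire_sub {n : ℕ} (a j k : Fin n) :
    coordEntire a j - coordEntire a k = coordEntire k j := by
  refine Subtype.ext (funext fun ζ => ?_)
  change ζ _ - ζ _ = ζ _
  rw [← map_sub]
  congr 1
  exact Subtype.ext (sub_sub_sub_cancel_left _ _ _)

theorem Edyn_swap (P : Params) {n : ℕ} (i j : Fin n) : Edyn P j i 0 = -Edyn P i j 0 := by
  rw [Edyn_zero_eq_ellMer, Edyn_zero_eq_ellMer, coordEntire_swap, ellMer_neg]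

theorem shift_algebraMap {n : ℕ} (α : Dual n) (f : Entire n) :
    shift α (algebraMap (Entire n) (Mer n) f) = algebraMap (Entire n) (Mer n) (shiftEntire α f) :=
  IsFractionRing.ringEquivOfRingEquiv_algebraMap _ _

theorem coord_add_weight {n : ℕ} {i j k : Fin n} (hi : k ≠ i) (hj : k ≠ j) (ζ : Dual n) :
    coord i j (ζ + weight k) = coord i j ζ := by
  change ζ (coroot i j) + (Pi.single i (1 : ℂ) - Pi.single j (1 : ℂ) : Fin n → ℂ) k = _
  simp [hi, hj, coord]

theorem shift_Edyn (P : Params) {n : ℕ} {i j k : Fin n} (hi : k ≠ i) (hj : k ≠ j) (c : ℂ) :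
    shift (weight k) (Edyn P i j c) = Edyn P i j c := by
  rw [Edyn, shift_algebraMap]
  congr 1
  refine Subtype.ext (funext fun ζ => ?_)
  change ellE P (coord i j (ζ + weight k) + c) = ellE P (coord i j ζ + c)
  rw [coord_add_weight hi hj]

/-! ### An elliptic partial fraction identity -/

/-- Weierstrass' identity, in the arrangement that makes the induction in
`ellMer_partialFraction` work. -/
theorem ellMer_threeTerm (P : Params) {n : ℕ} (a b c d : Entire n) :
    ellMer P (b + c) * ellMer P (a + c) * (ellMer P (d + b) * ellMer P (a - d))
      = ellMer P (d + b + c) * ellMer P (a - d + c) * (ellMer P b * ellMer P a)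
        - ellMer P (a + b + c) * ellMer P c * (ellMer P (d - a + b) * ellMer P d) := by
  simp only [ellMer, ← map_mul, ← map_sub]
  congr 1
  refine Subtype.ext (funext fun ζ => ?_)
  change ellE P (b.1 ζ + c.1 ζ) * ellE P (a.1 ζ + c.1 ζ)
      * (ellE P (d.1 ζ + b.1 ζ) * ellE P (a.1 ζ - d.1 ζ))
    = ellE P (d.1 ζ + b.1 ζ + c.1 ζ) * ellE P (a.1 ζ - d.1 ζ + c.1 ζ)
      * (ellE P (b.1 ζ) * ellE P (a.1 ζ))
    - ellE P (a.1 ζ + b.1 ζ + c.1 ζ) * ellE P (c.1 ζ)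
      * (ellE P (d.1 ζ - a.1 ζ + b.1 ζ) * ellE P (d.1 ζ))
  generalize a.1 ζ = a, b.1 ζ = b, c.1 ζ = c, d.1 ζ = d
  have h := ellE_weierstrass P ((a + b) / 2 + c) ((b - a) / 2) ((a + b) / 2) ((b - a) / 2 + d)
  rw [show (a + b) / 2 + c + (b - a) / 2 = b + c by ring,
    show (a + b) / 2 + c - (b - a) / 2 = a + c by ring,
    show (a + b) / 2 + ((b - a) / 2 + d) = d + b by ring,
    show (a + b) / 2 - ((b - a) / 2 + d) = a - d by ring,
    show (a + b) / 2 + c + (a + b) / 2 = a + b + c by ring,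
    show (a + b) / 2 + c - (a + b) / 2 = c by ring,
    show (b - a) / 2 + ((b - a) / 2 + d) = d - a + b by ring,
    show (b - a) / 2 - ((b - a) / 2 + d) = -d by ring,
    show (a + b) / 2 + c + ((b - a) / 2 + d) = d + b + c by ring,
    show (a + b) / 2 + c - ((b - a) / 2 + d) = a - d + c by ring,
    show (b - a) / 2 + (a + b) / 2 = b by ring,
    show (b - a) / 2 - (a + b) / 2 = -a by ring, ellE_neg, ellE_neg] at h
  linear_combination h

/-- Partial fractions: as functions of a common translation of the `x j`, the products
`E(x k + m) / E(x k) ∏_{j ≠ k} ⋯` span the theta functions of the type of the left-hand side, and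
the coefficients are found by evaluation at the zeros of `E(x k)`. -/
theorem ellMer_partialFraction (P : Params) {n : ℕ} {ι : Type*} [DecidableEq ι] (s : Finset ι)
    (x : ι → Entire n) (hx : ∀ j ∈ s, ellMer P (x j) ≠ 0)
    (hd : ∀ j ∈ s, ∀ k ∈ s, j ≠ k → ellMer P (x j - x k) ≠ 0) :
    ellMer P (s.card : Entire n) * ∏ j ∈ s, ellMer P (x j + 1) / ellMer P (x j)
      = ellMer P (1 : Entire n) * ∑ k ∈ s, ellMer P (x k + (s.card : Entire n)) / ellMer P (x k) *
          ∏ j ∈ s.erase k, ellMer P (x j - x k + 1) / ellMer P (x j - x k) := by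
  induction s using Finset.induction_on generalizing x with
  | empty =>
    simp [ellMer_zero]
  | insert a s ha ih =>
    rcases s.eq_empty_or_nonempty with rfl | hs
    · simp
    have hN : ellMer P (s.card : Entire n) ≠ 0 :=
      ellMer_natCast_ne_zero P (Finset.card_pos.mpr hs).ne'
    have hne : ∀ k ∈ s, k ≠ a := fun k hk h => ha (h ▸ hk)
    have hxs : ∀ j ∈ s, ellMer P (x j) ≠ 0 := fun j hj => hx j (Finset.mem_insert_of_mem hj)
    have hds : ∀ j ∈ s, ∀ k ∈ s, j ≠ k → ellMer P (x j - x k) ≠ 0 := fun j hj k hk =>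
      hd j (Finset.mem_insert_of_mem hj) k (Finset.mem_insert_of_mem hk)
    have hxa : ellMer P (x a) ≠ 0 := hx a (Finset.mem_insert_self _ _)
    have hda : ∀ j ∈ s, ellMer P (x j - x a) ≠ 0 := fun j hj =>
      hd j (Finset.mem_insert_of_mem hj) a (Finset.mem_insert_self _ _) (hne j hj)
    set c : ι → Mer n := fun k =>
      ∏ j ∈ s.erase k, ellMer P (x j - x k + 1) / ellMer P (x j - x k) with hc
    have ih1 := ih x hxs hds
    have ih2 := ih (fun j => x j - x a) hda
      (fun j hj k hk hjk => by simpa using hds j hj k hk hjk)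
    simp only [sub_sub_sub_cancel_right] at ih2
    change _ = _ * ∑ k ∈ s, _ * c k at ih1 ih2
    rw [Finset.card_insert_of_notMem ha, Finset.prod_insert ha, Finset.sum_insert ha,
      Finset.erase_insert ha]
    have herase : ∀ k ∈ s, ∏ j ∈ (insert a s).erase k,
        ellMer P (x j - x k + 1) / ellMer P (x j - x k)
        = ellMer P (x a - x k + 1) / ellMer P (x a - x k) * c k := by
      intro k hk
      rw [Finset.erase_insert_of_ne (hne k hk).symm, Finset.prod_insert]
      exact fun h => ha (Finset.mem_of_mem_erase h)
    rw [Finset.sum_congr rfl fun k hk => by rw [herase k hk]]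
    refine mul_left_cancel₀ hN ?_
    push_cast
    have key : ∀ k ∈ s, ellMer P ((s.card : Entire n) + 1) * (ellMer P (x a + 1) / ellMer P (x a))
          * (ellMer P (x k + (s.card : Entire n)) / ellMer P (x k) * c k)
        = ellMer P (x a + ((s.card : Entire n) + 1)) / ellMer P (x a) * ellMer P (1 : Entire n)
            * (ellMer P (x k - x a + (s.card : Entire n)) / ellMer P (x k - x a) * c k)
          + ellMer P (s.card : Entire n) *
            (ellMer P (x k + ((s.card : Entire n) + 1)) / ellMer P (x k) *
            (ellMer P (x a - x k + 1) / ellMer P (x a - x k) * c k)) := by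
      intro k hk
      have h1 := hxs k hk
      have h2 : ellMer P (x k - x a) = -ellMer P (x a - x k) := by
        rw [← ellMer_neg, neg_sub]
      have h3 : ellMer P (x a - x k) ≠ 0 := fun h => hda k hk (by rw [h2, h, neg_zero])
      have h4 := ellMer_threeTerm P (x a) (s.card : Entire n) 1 (x k)
      rw [h2, ← add_assoc, ← add_assoc]
      field_simp
      linear_combination c k * h4
    have hsum := Finset.sum_congr rfl key
    rw [Finset.sum_add_distrib, ← Finset.mul_sum, ← Finset.mul_sum, ← Finset.mul_sum] at hsum
    linear_combination
      (ellMer P ((s.card : Entire n) + 1) * (ellMer P (x a + 1) / ellMer P (x a))) * ih1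
      + ellMer P (1 : Entire n) * hsum
      - ellMer P (1 : Entire n) *
        (ellMer P (x a + ((s.card : Entire n) + 1)) / ellMer P (x a)) * ih2

/-! ### Exterior algebras with a dynamical kernel -/

section Kernel

/-- A field `K` with shift homomorphisms indexed by `ι` and a kernel `G i j ∈ K`, nonzero for
`i ≠ j` and invariant under the shifts by indices other than `i` and `j`. It holds the structure
functions of an exterior algebra in which `x_i(k + 1) x_j(k) / G i j` is symmetric in `i, j`. -/
structure DynKernel (ι K : Type*) [Field K] where
  shift : ι → K →+* K
  G : ι → ι → K
  G_ne_zero : ∀ {i j}, i ≠ j → G i j ≠ 0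
  shift_G : ∀ {k i j}, k ≠ i → k ≠ j → shift k (G i j) = G i j

variable {ι K : Type*} [Field K]

/-- The product of `G i j` over all pairs of entries of a list, `i` standing to the left of `j`. -/
def DynKernel.pairProd (κ : DynKernel ι K) : List ι → K
  | [] => 1
  | i :: l => (l.map (κ.G i)).prod * κ.pairProd l

/-- The structure function `∏_{i ∈ I, j ∈ J} G i j`, set to zero if `I` meets `J`. -/
def DynKernel.S [DecidableEq ι] (κ : DynKernel ι K) (I J : Finset ι) : K :=
  if Disjoint I J then ∏ i ∈ I, ∏ j ∈ J, κ.G i j else 0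

namespace DynKernel

variable (κ : DynKernel ι K)

theorem pairProd_ne_zero {l : List ι} (hl : l.Nodup) : κ.pairProd l ≠ 0 := by
  induction l with
  | nil => exact one_ne_zero
  | cons i l ih =>
    rw [List.nodup_cons] at hl
    refine mul_ne_zero (List.prod_ne_zero fun h => ?_) (ih hl.2)
    obtain ⟨j, hj, h0⟩ := List.mem_map.mp h
    exact κ.G_ne_zero (i := i) (j := j) (fun h => hl.1 (h ▸ hj)) h0

theorem shift_map_prod {k i : ι} {l : List ι} (hi : k ≠ i) (hl : k ∉ l) :
    κ.shift k (l.map (κ.G i)).prod = (l.map (κ.G i)).prod := by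
  rw [map_list_prod, List.map_map]
  congr 1
  exact List.map_congr_left fun j hj => κ.shift_G hi fun h => hl (h ▸ hj)

theorem shift_pairProd {k : ι} {l : List ι} (hl : k ∉ l) :
    κ.shift k (κ.pairProd l) = κ.pairProd l := by
  induction l with
  | nil => exact map_one _
  | cons i l ih =>
    rw [List.mem_cons, not_or] at hl
    rw [pairProd, map_mul, ih hl.2, κ.shift_map_prod hl.1 hl.2]

theorem pairProd_append (l l' : List ι) : κ.pairProd (l ++ l')
    = (l.map fun i => (l'.map (κ.G i)).prod).prod * (κ.pairProd l * κ.pairProd l') := by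
  induction l with
  | nil => simp [pairProd]
  | cons i l ih =>
    rw [List.cons_append, pairProd, ih, pairProd, List.map_append, List.prod_append, List.map_cons,
      List.prod_cons]
    ring

theorem shift_prod [DecidableEq ι] {k : ι} {I J : Finset ι} (hI : k ∉ I) (hJ : k ∉ J) :
    κ.shift k (∏ i ∈ I, ∏ j ∈ J, κ.G i j) = ∏ i ∈ I, ∏ j ∈ J, κ.G i j := by
  simp only [map_prod]
  exact Finset.prod_congr rfl fun i hi => Finset.prod_congr rfl fun j hj =>
    κ.shift_G (fun h => hI (h ▸ hi)) fun h => hJ (h ▸ hj)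

theorem S_ne_zero [DecidableEq ι] {I J : Finset ι} (h : Disjoint I J) : κ.S I J ≠ 0 := by
  rw [S, if_pos h]
  exact Finset.prod_ne_zero_iff.mpr fun i hi => Finset.prod_ne_zero_iff.mpr fun j hj =>
    κ.G_ne_zero fun hij => Finset.disjoint_left.mp h hi (hij ▸ hj)

end DynKernel

/-- Elements `x_i(k)` of a ring, at the points `k` of a geometric progression of spectral
parameters, that satisfy the relations of an elliptic exterior algebra with kernel `κ`. Only the
relations between neighbouring points `k + 1` and `k` occur. -/
structure ExteriorSystem (κ : DynKernel ι K) (A : Type*) [Ring A] where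
  scal : K →+* A
  gen : ι → ℤ → A
  scal_gen : ∀ f i k, scal f * gen i k = gen i k * scal (κ.shift i f)
  gen_sq : ∀ i k, gen i (k + 1) * gen i k = 0
  gen_swap : ∀ i j, i ≠ j → ∀ k,
    scal (κ.G j i) * (gen i (k + 1) * gen j k) = scal (κ.G i j) * (gen j (k + 1) * gen i k)

namespace ExteriorSystem

variable {κ : DynKernel ι K} {A : Type*} [Ring A] (X : ExteriorSystem κ A)

/-- The monomial `x_{i_d}(m + d - 1) ⋯ x_{i_1}(m)` for the list `[i_d, …, i_1]`. -/
def word : List ι → ℤ → A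
  | [], _ => 1
  | i :: l, m => X.gen i (m + l.length) * word l m

/-- The monomial of a list, normalized so that it depends on the set of entries only. -/
def mono (l : List ι) (m : ℤ) : A := X.scal (κ.pairProd l)⁻¹ * X.word l m

theorem scal_word {f : K} {l : List ι} (hf : ∀ i ∈ l, κ.shift i f = f) (m : ℤ) :
    X.scal f * X.word l m = X.word l m * X.scal f := by
  induction l with
  | nil => simp [word]
  | cons i l ih =>
    rw [word, ← mul_assoc, X.scal_gen, hf i (by simp), mul_assoc,
      ih fun j hj => hf j (List.mem_cons_of_mem _ hj), mul_assoc]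

theorem word_append (l l' : List ι) (m : ℤ) :
    X.word (l ++ l') m = X.word l (m + l'.length) * X.word l' m := by
  induction l with
  | nil => simp [word]
  | cons i l ih =>
    rw [List.cons_append, word, ih, word, mul_assoc, List.length_append]
    congr 2
    push_cast
    ring

theorem mono_cons {i : ι} {l : List ι} (hl : (i :: l).Nodup) (m : ℤ) :
    X.mono (i :: l) m
      = X.scal (l.map (κ.G i)).prod⁻¹ * (X.gen i (m + l.length) * X.mono l m) := by
  rw [mono, mono, word, ← mul_assoc (X.gen i _), DynKernel.pairProd, mul_inv, map_mul, mul_assoc,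
    mul_assoc]
  congr 1
  rw [← mul_assoc, X.scal_gen, map_inv₀ (κ.shift i),
    κ.shift_pairProd (List.nodup_cons.mp hl).1, mul_assoc]

theorem mono_perm {l l' : List ι} (h : l.Perm l') (hl : l.Nodup) (m : ℤ) :
    X.mono l m = X.mono l' m := by
  induction h with
  | nil => rfl
  | cons i h ih =>
    rw [X.mono_cons hl, X.mono_cons ((h.cons i).nodup hl), ih (List.nodup_cons.mp hl).2,
      h.length_eq, (h.map (κ.G i)).prod_eq]
  | swap x y l =>
    have hxy : y ≠ x := fun h => (List.nodup_cons.mp hl).1 (h ▸ List.mem_cons_self)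
    have h1 := κ.G_ne_zero hxy
    have h2 := κ.G_ne_zero hxy.symm
    have hsw := X.gen_swap y x hxy (m + l.length)
    have key : X.scal (κ.G y x)⁻¹ * (X.gen y (m + l.length + 1) * X.gen x (m + l.length))
        = X.scal (κ.G x y)⁻¹ * (X.gen x (m + l.length + 1) * X.gen y (m + l.length)) := by
      have e : (κ.G y x)⁻¹ = ((κ.G y x)⁻¹ * (κ.G x y)⁻¹) * κ.G x y := by field_simp
      rw [e, map_mul, mul_assoc, hsw, ← mul_assoc, ← map_mul]
      congr 2
      field_simp
    set c : K := (l.map (κ.G x)).prod * (l.map (κ.G y)).prod * κ.pairProd l with hc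
    have e1 : X.mono (y :: x :: l) m = X.scal c⁻¹ * (X.scal (κ.G y x)⁻¹ *
        (X.gen y (m + l.length + 1) * X.gen x (m + l.length))) * X.word l m := by
      have hp : κ.pairProd (y :: x :: l) = c * κ.G y x := by
        simp only [hc, DynKernel.pairProd, List.map_cons, List.prod_cons]
        ring
      rw [mono, hp, mul_inv, map_mul]
      simp only [word, mul_assoc, List.length_cons, Nat.cast_add, Nat.cast_one, add_assoc]
    have e2 : X.mono (x :: y :: l) m = X.scal c⁻¹ * (X.scal (κ.G x y)⁻¹ *
        (X.gen x (m + l.length + 1) * X.gen y (m + l.length))) * X.word l m := by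
      have hp : κ.pairProd (x :: y :: l) = c * κ.G x y := by
        simp only [hc, DynKernel.pairProd, List.map_cons, List.prod_cons]
        ring
      rw [mono, hp, mul_inv, map_mul]
      simp only [word, mul_assoc, List.length_cons, Nat.cast_add, Nat.cast_one, add_assoc]
    rw [e1, e2, key]
  | trans h1 h2 ih1 ih2 => rw [ih1 hl, ih2 (h1.nodup hl)]

theorem mono_append {l l' : List ι} (hl : (l ++ l').Nodup) (m : ℤ) :
    X.mono l (m + l'.length) * X.mono l' m
      = X.scal (l.map fun i => (l'.map (κ.G i)).prod).prod * X.mono (l ++ l') m := by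
  have hd := List.nodup_append.mp hl
  have hne : (l.map fun i => (l'.map (κ.G i)).prod).prod ≠ 0 := by
    have := κ.pairProd_ne_zero hl
    rw [κ.pairProd_append] at this
    exact left_ne_zero_of_mul this
  rw [mono, mono, mono, X.word_append, κ.pairProd_append, ← mul_assoc (X.scal _) (X.scal _),
    ← map_mul, mul_assoc, ← mul_assoc (X.word l _), ← X.scal_word (f := (κ.pairProd l')⁻¹),
    ← mul_assoc, ← mul_assoc, ← map_mul, mul_assoc]
  · congr 2
    rw [mul_inv, mul_inv, mul_inv_cancel_left₀ hne]
  · intro i hi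
    rw [map_inv₀, κ.shift_pairProd fun h => hd.2.2 i hi i h rfl]

theorem mono_mul_mono_eq_zero [DecidableEq ι] {i : ι} {l l' : List ι} (hl : l.Nodup)
    (hl' : l'.Nodup) (hi : i ∈ l) (hi' : i ∈ l') (m : ℤ) :
    X.mono l (m + l'.length) * X.mono l' m = 0 := by
  have p1 : l.Perm (l.erase i ++ [i]) :=
    (List.perm_cons_erase hi).trans (List.perm_append_singleton i (l.erase i)).symm
  have p2 := List.perm_cons_erase hi'
  have hlen : (m + l'.length : ℤ) = m + (l'.erase i).length + 1 := by
    rw [p2.length_eq, List.length_cons]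
    push_cast
    ring
  rw [X.mono_perm p1 hl, X.mono_perm p2 hl', mono, mono, X.word_append, hlen, word, word, word,
    List.length_nil, Nat.cast_zero, add_zero, mul_one]
  rw [← mul_assoc (X.scal (κ.pairProd (i :: l'.erase i))⁻¹), X.scal_gen]
  simp only [mul_assoc]
  rw [← mul_assoc (X.gen i _) (X.gen i _), X.gen_sq]
  simp

/-- The normalized monomial of a set. -/
noncomputable def monoSet (I : Finset ι) (m : ℤ) : A := X.mono I.toList m

theorem mono_eq_monoSet [DecidableEq ι] {l : List ι} (hl : l.Nodup) (m : ℤ) :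
    X.mono l m = X.monoSet l.toFinset m :=
  X.mono_perm (List.toFinset_toList hl).symm hl m

theorem monoSet_mul_monoSet [DecidableEq ι] (I J : Finset ι) (m : ℤ) :
    X.monoSet I (m + J.card) * X.monoSet J m = X.scal (κ.S I J) * X.monoSet (I ∪ J) m := by
  rw [monoSet, monoSet, ← Finset.length_toList J]
  by_cases h : Disjoint I J
  · have hn : (I.toList ++ J.toList).Nodup := by
      refine List.nodup_append.mpr ⟨I.nodup_toList, J.nodup_toList, fun a ha b hb hab => ?_⟩
      subst hab
      exact Finset.disjoint_left.mp h (Finset.mem_toList.mp ha) (Finset.mem_toList.mp hb)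
    rw [X.mono_append hn, X.mono_eq_monoSet hn, DynKernel.S, if_pos h]
    simp
  · obtain ⟨i, hi, hi'⟩ := Finset.not_disjoint_iff.mp h
    rw [X.mono_mul_mono_eq_zero I.nodup_toList J.nodup_toList (Finset.mem_toList.mpr hi)
      (Finset.mem_toList.mpr hi'), DynKernel.S, if_neg h, map_zero, zero_mul]

end ExteriorSystem
end Kernel

/-! ### Matrices of generators and their minors -/

section Matrix

/-- Elements `y_ab(k)` of a ring, at the points `k` of a geometric progression of spectral
parameters, with commuting scalars of a row and of a column kind, that satisfy the relations
between neighbouring points under which the matrix coacts on the exterior algebra with kernel `κ`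
(see `MatrixSystem.toExteriorSystem`). -/
structure MatrixSystem {ι K : Type*} [Field K] (κ : DynKernel ι K) (F : Type*) [Ring F] where
  row : K →+* F
  col : K →+* F
  entry : ι → ι → ℤ → F
  row_col : ∀ f g, row f * col g = col g * row f
  row_entry : ∀ f a b k, row f * entry a b k = entry a b k * row (κ.shift a f)
  col_entry : ∀ f a b k, col f * entry a b k = entry a b k * col (κ.shift b f)
  entry_same : ∀ a b d, b ≠ d → ∀ k,
    col (κ.G b d) * (entry a b (k + 1) * entry a d k)
      + col (κ.G d b) * (entry a d (k + 1) * entry a b k) = 0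
  entry_swap : ∀ a c b d, a ≠ c → b ≠ d → ∀ k,
    row (κ.G c a) * (col (κ.G b d) * (entry a b (k + 1) * entry c d k)
        + col (κ.G d b) * (entry a d (k + 1) * entry c b k))
      = row (κ.G a c) * (col (κ.G b d) * (entry c b (k + 1) * entry a d k)
        + col (κ.G d b) * (entry c d (k + 1) * entry a b k))

variable {ι K F : Type*} [Field K] [Ring F]

namespace MatrixSystem

variable {κ : DynKernel ι K} (Y : MatrixSystem κ F)

/-- Multiplication by a row scalar, on vectors indexed by sets of columns. -/
def scalOp : K →+* Module.End ℤ (Finset ι → F) where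
  toFun f :=
    { toFun := fun X J => Y.row f * X J
      map_smul' := fun c X => by funext J; simp [-zsmul_eq_mul]
      map_add' := fun X X' => by funext J; simp [mul_add] }
  map_one' := LinearMap.ext fun X => funext fun J => by simp
  map_zero' := LinearMap.ext fun X => funext fun J => by simp
  map_mul' f g := LinearMap.ext fun X => funext fun J => by simp [mul_assoc]
  map_add' f g := LinearMap.ext fun X => funext fun J => by simp [add_mul]

theorem scalOp_apply (f : K) (X : Finset ι → F) (J : Finset ι) :
    Y.scalOp f X J = Y.row f * X J := rfl

/-- The product of matrix entries with rows and columns from two lists. -/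
def entryWord : List ι → List ι → ℤ → F
  | a :: l, b :: p, m => Y.entry a b (m + l.length) * entryWord l p m
  | [], [], _ => 1
  | _, _, _ => 0

theorem entryWord_of_length_ne {l p : List ι} (h : l.length ≠ p.length) (m : ℤ) :
    Y.entryWord l p m = 0 := by
  induction l generalizing p with
  | nil => cases p with
    | nil => exact absurd rfl h
    | cons b p => rfl
  | cons a l ih => cases p with
    | nil => rfl
    | cons b p => rw [entryWord, ih fun h' => h (by simp [h']), mul_zero]

theorem row_entryWord {f : K} {l : List ι} (hf : ∀ i ∈ l, κ.shift i f = f) (p : List ι) (m : ℤ) :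
    Y.row f * Y.entryWord l p m = Y.entryWord l p m * Y.row f := by
  induction l generalizing p with
  | nil => cases p <;> simp [entryWord]
  | cons a l ih => cases p with
    | nil => simp [entryWord]
    | cons b p =>
      rw [entryWord, ← mul_assoc, Y.row_entry, hf a (by simp), mul_assoc,
        ih fun j hj => hf j (List.mem_cons_of_mem _ hj), mul_assoc]

theorem col_entryWord {f : K} {p : List ι} (hf : ∀ i ∈ p, κ.shift i f = f) (l : List ι) (m : ℤ) :
    Y.col f * Y.entryWord l p m = Y.entryWord l p m * Y.col f := by
  induction p generalizing l with
  | nil => cases l <;> simp [entryWord]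
  | cons b p ih => cases l with
    | nil => simp [entryWord]
    | cons a l =>
      rw [entryWord, ← mul_assoc, Y.col_entry, hf b (by simp), mul_assoc,
        ih fun j hj => hf j (List.mem_cons_of_mem _ hj), mul_assoc]

end MatrixSystem

variable [LinearOrder ι]

/-- The lists without repetitions whose entries form a given set. -/
def arrangements (J : Finset ι) : Finset (List ι) := J.val.lists.toFinset

theorem mem_arrangements {J : Finset ι} {p : List ι} :
    p ∈ arrangements J ↔ p.Nodup ∧ p.toFinset = J := by
  rw [arrangements, Multiset.mem_toFinset, Multiset.mem_lists_iff]
  constructor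
  · intro h
    have hn : p.Nodup := by
      have := J.nodup
      rwa [h, Multiset.quot_mk_to_coe, Multiset.coe_nodup] at this
    refine ⟨hn, Finset.val_injective ?_⟩
    rw [h, List.toFinset_val, hn.dedup]
    rfl
  · rintro ⟨hn, rfl⟩
    rw [List.toFinset_val, hn.dedup]
    rfl

theorem sum_erase_eq_sum_lt {M : Type*} [AddCommMonoid M] (J : Finset ι) (f : ι → ι → M) :
    ∑ b ∈ J, ∑ d ∈ J.erase b, f b d
      = ∑ x ∈ (J ×ˢ J).filter (fun x => x.1 < x.2), (f x.1 x.2 + f x.2 x.1) := by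
  have h1 : ∀ b ∈ J, ∑ d ∈ J.erase b, f b d
      = ∑ d ∈ J, ((if b < d then f b d else 0) + if d < b then f b d else 0) := by
    intro b hb
    rw [← Finset.add_sum_erase J _ hb]
    simp only [lt_irrefl, if_false, add_zero, zero_add]
    refine Finset.sum_congr rfl fun d hd => ?_
    rcases lt_or_gt_of_ne (Finset.ne_of_mem_erase hd) with h | h <;> simp [h, h.not_gt]
  rw [Finset.sum_congr rfl h1, Finset.sum_filter, Finset.sum_product]
  simp only [Finset.sum_add_distrib, ite_add_zero]
  congr 1
  exact Finset.sum_comm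

namespace MatrixSystem

variable {κ : DynKernel ι K} (Y : MatrixSystem κ F)

/-- The coaction of the generator `x_a(k)` of the exterior algebra: `x_a(k)` goes to
`∑_b y_ab(k) ⊗ x_b(k)`, and `x_b(k)` sends the normalized monomial of `J \ {b}` to a multiple
of that of `J`. -/
def genOp (a : ι) (k : ℤ) : Module.End ℤ (Finset ι → F) where
  toFun X J := ∑ b ∈ J, Y.col (∏ j ∈ J.erase b, κ.G b j) * (Y.entry a b k * X (J.erase b))
  map_smul' c X := by funext J; simp [-zsmul_eq_mul, Finset.smul_sum]
  map_add' X X' := by funext J; simp [mul_add, Finset.sum_add_distrib]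

theorem genOp_apply (a : ι) (k : ℤ) (X : Finset ι → F) (J : Finset ι) :
    Y.genOp a k X J
      = ∑ b ∈ J, Y.col (∏ j ∈ J.erase b, κ.G b j) * (Y.entry a b k * X (J.erase b)) := rfl

theorem genOp_genOp (a c : ι) (k : ℤ) (X : Finset ι → F) (J : Finset ι) :
    Y.genOp a (k + 1) (Y.genOp c k X) J
      = ∑ x ∈ (J ×ˢ J).filter (fun x => x.1 < x.2),
        Y.col (∏ j ∈ (J.erase x.1).erase x.2, κ.G x.1 j * κ.G x.2 j) *
          ((Y.col (κ.G x.1 x.2) * (Y.entry a x.1 (k + 1) * Y.entry c x.2 k)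
            + Y.col (κ.G x.2 x.1) * (Y.entry a x.2 (k + 1) * Y.entry c x.1 k))
              * X ((J.erase x.1).erase x.2)) := by
  have h : Y.genOp a (k + 1) (Y.genOp c k X) J = ∑ b ∈ J, ∑ d ∈ J.erase b,
      Y.col (∏ j ∈ (J.erase b).erase d, κ.G b j * κ.G d j) *
        (Y.col (κ.G b d) * (Y.entry a b (k + 1) * Y.entry c d k) * X ((J.erase b).erase d)) := by
    rw [genOp_apply]
    refine Finset.sum_congr rfl fun b _ => ?_
    rw [genOp_apply, Finset.mul_sum, Finset.mul_sum]
    refine Finset.sum_congr rfl fun d hd => ?_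
    have hinv : κ.shift b (∏ j ∈ (J.erase b).erase d, κ.G d j)
        = ∏ j ∈ (J.erase b).erase d, κ.G d j := by
      rw [map_prod]
      exact Finset.prod_congr rfl fun j hj => κ.shift_G (Finset.ne_of_mem_erase hd).symm
        (Finset.ne_of_mem_erase (Finset.mem_of_mem_erase hj)).symm
    rw [← mul_assoc (Y.entry a b _), ← hinv, ← Y.col_entry, ← Finset.mul_prod_erase _ _ hd,
      Finset.prod_mul_distrib]
    simp only [map_mul, mul_assoc]
    rw [← mul_assoc (Y.col (κ.G b d)), ← map_mul, mul_comm, map_mul, mul_assoc,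
      ← mul_assoc (Y.col (κ.G b d)), ← map_mul, mul_comm (κ.G b d), map_mul, mul_assoc]
  rw [h, sum_erase_eq_sum_lt]
  refine Finset.sum_congr rfl fun x _ => ?_
  rw [Finset.erase_right_comm (a := x.2)]
  simp only [mul_comm (κ.G x.2 _), add_mul, mul_add]

/-- The coaction defines a representation of the exterior algebra. -/
def toExteriorSystem : ExteriorSystem κ (Module.End ℤ (Finset ι → F)) where
  scal := Y.scalOp
  gen := Y.genOp
  scal_gen f a k := by
    refine LinearMap.ext fun X => funext fun J => ?_
    simp only [Module.End.mul_apply, scalOp_apply, genOp_apply, Finset.mul_sum]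
    refine Finset.sum_congr rfl fun b _ => ?_
    rw [← mul_assoc, Y.row_col, mul_assoc, ← mul_assoc (Y.row f), Y.row_entry, mul_assoc]
  gen_sq a k := by
    refine LinearMap.ext fun X => funext fun J => ?_
    simp only [Module.End.mul_apply, genOp_genOp]
    refine Finset.sum_eq_zero fun x hx => ?_
    rw [Y.entry_same _ _ _ (Finset.mem_filter.mp hx).2.ne, zero_mul, mul_zero]
  gen_swap a c hac k := by
    refine LinearMap.ext fun X => funext fun J => ?_
    simp only [Module.End.mul_apply, scalOp_apply, genOp_genOp, Finset.mul_sum]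
    refine Finset.sum_congr rfl fun x hx => ?_
    rw [← mul_assoc, Y.row_col, mul_assoc, ← mul_assoc (Y.row (κ.G c a)),
      Y.entry_swap _ _ _ _ hac (Finset.mem_filter.mp hx).2.ne,
      ← mul_assoc (Y.row (κ.G a c)) (Y.col (∏ _ ∈ _, _)), Y.row_col]
    simp only [mul_assoc]

/-- The vector supported at the empty set of columns. -/
def vac : Finset ι → F := fun J => if J = ∅ then 1 else 0

/-- The minor with rows `I` and columns `J`, with spectral parameters starting at `m`: the matrix
coefficient of the coaction on normalized monomials. -/
noncomputable def minor (I : Finset ι) (m : ℤ) (J : Finset ι) : F :=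
  Y.toExteriorSystem.monoSet I m vac J

theorem word_vac_apply (l : List ι) (m : ℤ) (J : Finset ι) :
    Y.toExteriorSystem.word l m vac J
      = ∑ p ∈ arrangements J, Y.col (κ.pairProd p) * Y.entryWord l p m := by
  induction l generalizing J with
  | nil =>
    rw [ExteriorSystem.word, Module.End.one_apply, vac]
    split_ifs with h
    · subst h
      rw [Finset.sum_eq_single_of_mem [] (mem_arrangements.mpr (by simp))]
      · simp [entryWord, DynKernel.pairProd]
      · intro p hp hne
        exact absurd (by simpa using (mem_arrangements.mp hp).2) hne
    · refine (Finset.sum_eq_zero fun p hp => ?_).symm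
      rw [entryWord_of_length_ne, mul_zero]
      intro hl
      have : p = [] := List.length_eq_zero_iff.mp hl.symm
      subst this
      exact h (by simpa using (mem_arrangements.mp hp).2.symm)
  | cons a l ih =>
    rw [ExteriorSystem.word, Module.End.mul_apply]
    change Y.genOp a _ _ J = _
    rw [genOp_apply]
    simp only [ih, Finset.mul_sum]
    rw [Finset.sum_sigma']
    symm
    rw [← Finset.sum_filter_of_ne (p := fun p : List ι => p ≠ [])]
    swap
    · rintro p _ hne rfl
      exact hne (by simp [entryWord])
    refine Finset.sum_bij' (fun p hp => ⟨p.head (Finset.mem_filter.mp hp).2, p.tail⟩)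
      (fun x _ => x.1 :: x.2) ?_ ?_ ?_ ?_ ?_
    · intro p hp
      obtain ⟨hp, hne⟩ := Finset.mem_filter.mp hp
      obtain ⟨b, p, rfl⟩ := List.exists_cons_of_ne_nil hne
      obtain ⟨hn, rfl⟩ := mem_arrangements.mp hp
      rw [List.nodup_cons] at hn
      refine Finset.mem_sigma.mpr ⟨by simp, mem_arrangements.mpr ⟨hn.2, ?_⟩⟩
      simp [hn.1]
    · intro x hx
      obtain ⟨hb, hx⟩ := Finset.mem_sigma.mp hx
      obtain ⟨hn, hx⟩ := mem_arrangements.mp hx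
      refine Finset.mem_filter.mpr ⟨mem_arrangements.mpr ⟨?_, ?_⟩, by simp⟩
      · refine List.nodup_cons.mpr ⟨fun h => ?_, hn⟩
        have : x.1 ∈ J.erase x.1 := hx ▸ List.mem_toFinset.mpr h
        simp at this
      · rw [List.toFinset_cons, hx, Finset.insert_erase hb]
    · intro p hp
      simp
    · intro x hx
      simp
    · intro p hp
      obtain ⟨hp, hne⟩ := Finset.mem_filter.mp hp
      obtain ⟨b, p, rfl⟩ := List.exists_cons_of_ne_nil hne
      obtain ⟨hn, rfl⟩ := mem_arrangements.mp hp
      rw [List.nodup_cons] at hn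
      simp only [List.head_cons, List.tail_cons]
      have he : (b :: p).toFinset.erase b = p.toFinset := by simp [hn.1]
      rw [he, List.prod_toFinset _ hn.2, entryWord, DynKernel.pairProd, map_mul, mul_assoc,
        ← mul_assoc (Y.entry _ _ _), ← κ.shift_pairProd hn.1, ← Y.col_entry, κ.shift_pairProd hn.1,
        mul_assoc]

theorem minor_eq_sum {l : List ι} (hl : l.Nodup) (m : ℤ) (J : Finset ι) :
    Y.minor l.toFinset m J = Y.row (κ.pairProd l)⁻¹ *
      ∑ p ∈ arrangements J, Y.col (κ.pairProd p) * Y.entryWord l p m := by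
  rw [minor, ← ExteriorSystem.mono_eq_monoSet _ hl, ExteriorSystem.mono, Module.End.mul_apply,
    ← word_vac_apply]
  rfl

theorem minor_eq_sum_toList (I : Finset ι) (m : ℤ) (J : Finset ι) :
    Y.minor I m J = Y.row (κ.pairProd I.toList)⁻¹ *
      ∑ p ∈ arrangements J, Y.col (κ.pairProd p) * Y.entryWord I.toList p m := by
  rw [← Y.minor_eq_sum I.nodup_toList, Finset.toList_toFinset]

theorem minor_of_card_ne {I J : Finset ι} (h : I.card ≠ J.card) (m : ℤ) : Y.minor I m J = 0 := by
  rw [minor_eq_sum_toList, Finset.sum_eq_zero, mul_zero]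
  intro p hp
  obtain ⟨hn, rfl⟩ := mem_arrangements.mp hp
  rw [entryWord_of_length_ne, mul_zero]
  rwa [Finset.length_toList, ← List.toFinset_card_of_nodup hn]

theorem row_minor {f : K} {I : Finset ι} (hf : ∀ i ∈ I, κ.shift i f = f) (m : ℤ) (J : Finset ι) :
    Y.row f * Y.minor I m J = Y.minor I m J * Y.row f := by
  rw [minor_eq_sum_toList, ← mul_assoc, ← map_mul, mul_comm f, map_mul, mul_assoc, mul_assoc,
    Finset.mul_sum, Finset.sum_mul]
  congr 1
  refine Finset.sum_congr rfl fun p _ => ?_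
  rw [← mul_assoc, Y.row_col, mul_assoc, Y.row_entryWord fun i hi => hf i (Finset.mem_toList.mp hi),
    mul_assoc]

theorem col_minor {f : K} {J : Finset ι} (hf : ∀ i ∈ J, κ.shift i f = f) (m : ℤ) (I : Finset ι) :
    Y.col f * Y.minor I m J = Y.minor I m J * Y.col f := by
  rw [minor_eq_sum_toList, ← mul_assoc, ← Y.row_col, mul_assoc, mul_assoc,
    Finset.mul_sum, Finset.sum_mul]
  congr 1
  refine Finset.sum_congr rfl fun p hp => ?_
  rw [← mul_assoc, ← map_mul, mul_comm f, map_mul, mul_assoc, Y.col_entryWord, mul_assoc]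
  intro i hi
  exact hf i ((mem_arrangements.mp hp).2 ▸ List.mem_toFinset.mpr hi)

/-- A translation of the spectral parameter translates the minors. -/
theorem minor_shift {Y' : MatrixSystem κ F} {c : ℤ} (hrow : Y'.row = Y.row) (hcol : Y'.col = Y.col)
    (h : ∀ a b k, Y'.entry a b k = Y.entry a b (k + c)) (I : Finset ι) (m : ℤ) (J : Finset ι) :
    Y'.minor I m J = Y.minor I (m + c) J := by
  have hw : ∀ l p, Y'.entryWord l p m = Y.entryWord l p (m + c) := by
    intro l
    induction l with
    | nil => intro p; cases p <;> rfl
    | cons a l ih =>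
      intro p
      cases p with
      | nil => rfl
      | cons b p => rw [entryWord, entryWord, h, ih, add_right_comm]
  rw [minor_eq_sum_toList, minor_eq_sum_toList, hrow, hcol]
  simp only [hw]

/-- The coaction is comultiplicative: a monomial acts on a vector through its minors. -/
theorem word_apply (l : List ι) (m : ℤ) (X : Finset ι → F) (J : Finset ι) :
    Y.toExteriorSystem.word l m X J = ∑ L ∈ J.powerset,
      Y.col (∏ i ∈ L, ∏ j ∈ J \ L, κ.G i j) *
        (Y.toExteriorSystem.word l m vac L * X (J \ L)) := by
  induction l generalizing J with
  | nil =>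
    simp only [ExteriorSystem.word, Module.End.one_apply]
    rw [Finset.sum_eq_single_of_mem ∅ (by simp)]
    · simp [vac]
    · intro L _ hL
      simp [vac, hL]
  | cons a l ih =>
    simp only [ExteriorSystem.word, Module.End.mul_apply]
    change Y.genOp a _ _ J = ∑ L ∈ J.powerset, _ * (Y.genOp a _ _ L * _)
    simp only [genOp_apply, Finset.sum_mul, Finset.mul_sum]
    rw [Finset.sum_congr rfl fun b _ => by rw [ih (J.erase b), Finset.mul_sum, Finset.mul_sum]]
    rw [Finset.sum_sigma', Finset.sum_sigma']
    refine Finset.sum_bij' (i := fun x _ => (⟨insert x.1 x.2, x.1⟩ : Σ _ : Finset ι, ι))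
      (j := fun x _ => (⟨x.2, x.1.erase x.2⟩ : Σ _ : ι, Finset ι))
      ?_ ?_ ?_ ?_ ?_
    · rintro ⟨b, L⟩ hx
      simp only [Finset.mem_sigma, Finset.mem_powerset] at hx ⊢
      exact ⟨Finset.insert_subset hx.1 (hx.2.trans (Finset.erase_subset _ _)),
        Finset.mem_insert_self _ _⟩
    · rintro ⟨L, b⟩ hx
      simp only [Finset.mem_sigma, Finset.mem_powerset] at hx ⊢
      exact ⟨hx.1 hx.2, Finset.erase_subset_erase _ hx.1⟩
    · rintro ⟨b, L⟩ hx
      simp only [Finset.mem_sigma, Finset.mem_powerset] at hx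
      have hb : b ∉ L := fun h => (Finset.mem_erase.mp (hx.2 h)).1 rfl
      simp [hb]
    · rintro ⟨L, b⟩ hx
      simp only [Finset.mem_sigma, Finset.mem_powerset] at hx
      simp [Finset.insert_erase hx.2]
    · rintro ⟨b, L⟩ hx
      simp only [Finset.mem_sigma, Finset.mem_powerset] at hx
      have hb : b ∉ L := fun h => (Finset.mem_erase.mp (hx.2 h)).1 rfl
      have hset : J \ insert b L = J.erase b \ L := by
        ext j; simp only [Finset.mem_sdiff, Finset.mem_insert, Finset.mem_erase]; tauto
      have hbJ : b ∉ J.erase b \ L := by simp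
      have hprod : ∏ j ∈ J.erase b, κ.G b j = (∏ j ∈ J.erase b \ L, κ.G b j) * ∏ j ∈ L, κ.G b j :=
        (Finset.prod_sdiff hx.2).symm
      simp only [Finset.erase_insert hb, hset, Finset.prod_insert hb, hprod, map_mul, mul_assoc]
      rw [← mul_assoc (Y.entry a b _), ← κ.shift_prod hb hbJ, ← Y.col_entry, κ.shift_prod hb hbJ]
      simp only [← mul_assoc, ← map_mul]
      congr 4
      ring

/-- Laplace expansion of minors along the rows. -/
theorem row_S_mul_minor (I₁ I₂ : Finset ι) (m : ℤ) (J : Finset ι) :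
    Y.row (κ.S I₁ I₂) * Y.minor (I₁ ∪ I₂) m J = ∑ L ∈ J.powerset,
      Y.col (κ.S L (J \ L)) * (Y.minor I₁ (m + I₂.card) L * Y.minor I₂ m (J \ L)) := by
  have h := congrArg (fun T : Module.End ℤ (Finset ι → F) => T vac J)
    (Y.toExteriorSystem.monoSet_mul_monoSet I₁ I₂ m)
  simp only [Module.End.mul_apply] at h
  change _ = Y.row (κ.S I₁ I₂) * Y.minor (I₁ ∪ I₂) m J at h
  rw [← h, ExteriorSystem.monoSet, ExteriorSystem.mono, Module.End.mul_apply]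
  change Y.row _ * _ = _
  rw [word_apply, Finset.mul_sum]
  refine Finset.sum_congr rfl fun L _ => ?_
  rw [DynKernel.S, if_pos Finset.disjoint_sdiff, ← mul_assoc, Y.row_col, mul_assoc,
    ← mul_assoc (Y.row _)]
  rfl

theorem minor_empty (m : ℤ) : Y.minor ∅ m ∅ = 1 := by
  simp [minor, ExteriorSystem.monoSet, ExteriorSystem.mono, ExteriorSystem.word,
    DynKernel.pairProd, vac]

theorem minor_singleton (a b : ι) (m : ℤ) : Y.minor {a} m {b} = Y.entry a b m := by
  simp only [minor, ExteriorSystem.monoSet, ExteriorSystem.mono, ExteriorSystem.word,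
    DynKernel.pairProd, Finset.toList_singleton, Module.End.mul_apply]
  change Y.row _ * Y.genOp a _ _ _ = _
  simp [genOp_apply, vac]

/-- Laplace expansion along a single row, which gets the last place in the products. -/
theorem row_S_erase_mul_minor {a : ι} {I : Finset ι} (ha : a ∈ I) (m : ℤ) (J : Finset ι) :
    Y.row (κ.S (I.erase a) {a}) * Y.minor I m J = ∑ b ∈ J,
      Y.col (κ.S (J.erase b) {b}) * (Y.minor (I.erase a) (m + 1) (J.erase b) * Y.entry a b m) := by
  have h := Y.row_S_mul_minor (I.erase a) {a} m J
  have hI : I.erase a ∪ {a} = I := by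
    rw [Finset.union_comm, ← Finset.insert_eq, Finset.insert_erase ha]
  rw [hI, Finset.card_singleton, Nat.cast_one] at h
  rw [h]
  have hsub : J.image (fun b => J.erase b) ⊆ J.powerset := by
    intro L hL
    obtain ⟨b, _, rfl⟩ := Finset.mem_image.mp hL
    exact Finset.mem_powerset.mpr (Finset.erase_subset _ _)
  rw [← Finset.sum_subset hsub, Finset.sum_image]
  · refine Finset.sum_congr rfl fun b hb => ?_
    rw [Finset.sdiff_erase_self hb, minor_singleton]
  · intro b hb b' _ hbb'
    by_contra hne
    have : b ∈ J.erase b' := Finset.mem_erase.mpr ⟨hne, hb⟩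
    rw [show J.erase b' = J.erase b from hbb'.symm] at this
    simp at this
  · intro L hL hL'
    have hLJ := Finset.mem_powerset.mp hL
    rw [Y.minor_of_card_ne (I := {a}), mul_zero, mul_zero]
    intro hc
    obtain ⟨b, hb⟩ := Finset.card_eq_one.mp (hc.symm.trans (Finset.card_singleton a))
    refine hL' (Finset.mem_image.mpr ⟨b, ?_, ?_⟩)
    · exact (Finset.mem_sdiff.mp (hb ▸ Finset.mem_singleton_self b)).1
    · rw [← Finset.sdiff_singleton_eq_erase, ← hb, Finset.sdiff_sdiff_eq_self hLJ]

end MatrixSystem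
end Matrix

/-! ### The left and right kernels -/

/-- The kernel `G i j = E(ζ_ji + 1)` of the left exterior algebra. -/
noncomputable def kernelL (P : Params) (n : ℕ) : DynKernel (Fin n) (Mer n) where
  shift k := (shift (weight k) : Mer n →+* Mer n)
  G i j := Edyn P j i 1
  G_ne_zero h := Edyn_ne_zero P h.symm 1
  shift_G hi hj := shift_Edyn P hj hi 1

/-- The kernel `G i j = E(ζ_ij)⁻¹` of the right exterior algebra. -/
noncomputable def kernelR (P : Params) (n : ℕ) : DynKernel (Fin n) (Mer n) where
  shift k := (shift (weight k) : Mer n →+* Mer n)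
  G i j := (Edyn P i j 0)⁻¹
  G_ne_zero h := inv_ne_zero (Edyn_ne_zero P h 0)
  shift_G {k i j} hi hj := by
    rw [map_inv₀]
    exact congrArg _ (shift_Edyn P hi hj 0)

theorem kernelL_S (P : Params) {n : ℕ} (I J : Finset (Fin n)) : (kernelL P n).S I J = Sl P I J := by
  rw [DynKernel.S, Sl]
  congr

theorem kernelR_S (P : Params) {n : ℕ} (I J : Finset (Fin n)) : (kernelR P n).S I J = Sr P I J := by
  rw [DynKernel.S, Sr]
  congr

/-! ### Products over the pairs of a sorted list -/

theorem DynKernel.pairProd_map_of_pairwise {ι K : Type*} [Field K] [DecidableEq ι]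
    (κ : DynKernel ι K) {r : ι → ι → Prop} [DecidableRel r] (hr : ∀ i j, r i j → ¬ r j i)
    {l : List ι} (hl : l.Pairwise r) (f : ι → ι) :
    κ.pairProd (l.map f)
      = ∏ x ∈ (l.toFinset ×ˢ l.toFinset).filter (fun x => r x.1 x.2), κ.G (f x.1) (f x.2) := by
  rw [Finset.prod_filter, Finset.prod_product]
  induction l with
  | nil => rfl
  | cons a l ih =>
    rw [List.pairwise_cons] at hl
    have ha : a ∉ l.toFinset := fun h =>
      have := hl.1 a (List.mem_toFinset.mp h)
      hr a a this this
    have hnd : l.Nodup := hl.2.imp fun h => by rintro rfl; exact hr _ _ h h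
    have haa : ¬ r a a := fun h => hr a a h h
    rw [List.map_cons, DynKernel.pairProd, ih hl.2, List.toFinset_cons, Finset.prod_insert ha,
      Finset.prod_insert ha, if_neg haa, one_mul, List.map_map, ← List.prod_toFinset _ hnd]
    congr 1
    · refine Finset.prod_congr rfl fun j hj => ?_
      rw [if_pos (hl.1 j (List.mem_toFinset.mp hj)), Function.comp]
    · refine Finset.prod_congr rfl fun i hi => ?_
      rw [Finset.prod_insert ha, if_neg (hr _ _ (hl.1 i (List.mem_toFinset.mp hi))), one_mul]

section Sorted

variable {n : ℕ}

/-- The elements of `I` in increasing order. -/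
def ascList (I : Finset (Fin n)) : List (Fin n) := List.ofFn (I.orderEmbOfFin rfl)

/-- The elements of `I` in decreasing order. -/
def descList (I : Finset (Fin n)) : List (Fin n) :=
  List.ofFn fun k : Fin I.card => I.orderEmbOfFin rfl k.rev

theorem pairwise_ascList (I : Finset (Fin n)) : (ascList I).Pairwise (· < ·) :=
  List.pairwise_ofFn.mpr fun _ _ h => (I.orderEmbOfFin rfl).strictMono h

theorem pairwise_descList (I : Finset (Fin n)) : (descList I).Pairwise (· > ·) :=
  List.pairwise_ofFn.mpr fun _ _ h => (I.orderEmbOfFin rfl).strictMono (Fin.rev_lt_rev.mpr h)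

theorem nodup_ascList (I : Finset (Fin n)) : (ascList I).Nodup := (pairwise_ascList I).imp ne_of_lt

theorem nodup_descList (I : Finset (Fin n)) : (descList I).Nodup :=
  (pairwise_descList I).imp ne_of_gt

theorem toFinset_ascList (I : Finset (Fin n)) : (ascList I).toFinset = I := by
  ext i
  rw [List.mem_toFinset, ascList, List.mem_ofFn, ← Finset.mem_coe, ← I.range_orderEmbOfFin rfl]
  rfl

theorem toFinset_descList (I : Finset (Fin n)) : (descList I).toFinset = I := by
  ext i
  rw [List.mem_toFinset, descList, List.mem_ofFn, ← Finset.mem_coe, ← I.range_orderEmbOfFin rfl]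
  constructor
  · rintro ⟨k, rfl⟩
    exact ⟨k.rev, rfl⟩
  · rintro ⟨k, rfl⟩
    exact ⟨k.rev, by rw [Fin.rev_rev]⟩

theorem ascList_eq {J : Finset (Fin n)} {d : ℕ} (h : J.card = d) :
    ascList J = List.ofFn (J.orderEmbOfFin h) := by
  subst h; rfl

theorem descList_eq {J : Finset (Fin n)} {d : ℕ} (h : J.card = d) :
    descList J = List.ofFn fun k : Fin d => J.orderEmbOfFin h k.rev := by
  subst h; rfl

/-- Reindexing a product over ordered pairs by a permutation that may break the order. -/
theorem prod_lt_perm {K : Type*} [CommMonoid K] {J : Finset (Fin n)} {τ : Equiv.Perm (Fin n)}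
    (hτ : τ ∈ permsOf J) (h : Fin n → Fin n → K) :
    ∏ x ∈ (J ×ˢ J).filter (fun x => x.1 < x.2), h x.1 x.2
      = ∏ x ∈ (J ×ˢ J).filter (fun x => x.1 < x.2),
        if τ x.2 < τ x.1 then h (τ x.2) (τ x.1) else h (τ x.1) (τ x.2) := by
  have hfix : ∀ x, x ∉ J → τ x = x := (Finset.mem_filter.mp hτ).2
  have hmem : ∀ x ∈ J, τ x ∈ J := fun x hx => by
    by_contra hn
    exact hn (by rwa [τ.injective (hfix _ hn)])
  have hmem' : ∀ x ∈ J, τ.symm x ∈ J := fun x hx => by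
    by_contra hn
    have := hfix _ hn
    rw [τ.apply_symm_apply] at this
    exact hn (this ▸ hx)
  let s : Equiv.Perm (Fin n) → Fin n × Fin n → Fin n × Fin n := fun π x =>
    if π x.2 < π x.1 then (π x.2, π x.1) else (π x.1, π x.2)
  have hs : ∀ π : Equiv.Perm (Fin n), (∀ x ∈ J, π x ∈ J) → ∀ x ∈ (J ×ˢ J).filter
      (fun x => x.1 < x.2), s π x ∈ (J ×ˢ J).filter (fun x => x.1 < x.2) := by
    intro π hπ x hx
    obtain ⟨hx, hlt⟩ := Finset.mem_filter.mp hx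
    obtain ⟨h1, h2⟩ := Finset.mem_product.mp hx
    have hne : π x.1 ≠ π x.2 := fun h => hlt.ne (π.injective h)
    simp only [s, Finset.mem_filter, Finset.mem_product]
    split_ifs with hc
    · exact ⟨⟨hπ _ h2, hπ _ h1⟩, hc⟩
    · exact ⟨⟨hπ _ h1, hπ _ h2⟩, lt_of_le_of_ne (not_lt.mp hc) hne⟩
  have hinv : ∀ π π' : Equiv.Perm (Fin n), (∀ x, π' (π x) = x) →
      ∀ x : Fin n × Fin n, x.1 < x.2 → s π' (s π x) = x := by
    intro π π' hp x hlt
    simp only [s]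
    by_cases hc : π x.2 < π x.1
    · simp [hc, hp, hlt]
    · simp [hc, hp, hlt.not_gt]
  symm
  refine Finset.prod_bij' (fun x _ => s τ x) (fun x _ => s τ.symm x) (hs τ hmem) (hs τ.symm hmem')
    (fun x hx => hinv _ _ (by simp) x (Finset.mem_filter.mp hx).2)
    (fun x hx => hinv _ _ (by simp) x (Finset.mem_filter.mp hx).2) fun x _ => ?_
  simp only [s]
  split_ifs <;> rfl

theorem mem_permsOf_mul {J : Finset (Fin n)} {σ τ : Equiv.Perm (Fin n)} (hσ : σ ∈ permsOf J)
    (hτ : τ ∈ permsOf J) : σ * τ ∈ permsOf J := by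
  simp only [permsOf, Finset.mem_filter, Finset.mem_univ, true_and, Equiv.Perm.mul_apply] at *
  intro x hx
  rw [hτ x hx, hσ x hx]

theorem exists_map_eq_of_perm {l p : List (Fin n)} (h : l.Perm p) (hl : l.Nodup) :
    ∃ τ ∈ permsOf l.toFinset, l.map τ = p := by
  induction h with
  | nil => exact ⟨1, by simp [permsOf], rfl⟩
  | cons a h ih =>
    obtain ⟨τ, hτ, rfl⟩ := ih (List.nodup_cons.mp hl).2
    simp only [permsOf, Finset.mem_filter, Finset.mem_univ, true_and, List.mem_toFinset] at hτ
    refine ⟨τ, ?_, by rw [List.map_cons, hτ a (List.nodup_cons.mp hl).1]⟩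
    simp only [permsOf, Finset.mem_filter, Finset.mem_univ, true_and, List.mem_toFinset,
      List.mem_cons, not_or]
    exact fun x hx => hτ x hx.2
  | swap a b l =>
    simp only [List.nodup_cons, List.mem_cons, not_or] at hl
    refine ⟨Equiv.swap a b, ?_, ?_⟩
    · simp only [permsOf, Finset.mem_filter, Finset.mem_univ, true_and, List.mem_toFinset,
        List.mem_cons, not_or]
      exact fun x hx => Equiv.swap_apply_of_ne_of_ne hx.2.1 hx.1
    · rw [List.map_cons, List.map_cons, Equiv.swap_apply_right, Equiv.swap_apply_left]
      congr 2
      refine (List.map_congr_left fun x hx => Equiv.swap_apply_of_ne_of_ne ?_ ?_).trans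
        (List.map_id l)
      · rintro rfl; exact hl.2.1 hx
      · rintro rfl; exact hl.1.2 hx
  | trans h1 h2 ih1 ih2 =>
    obtain ⟨τ, hτ, h3⟩ := ih1 hl
    obtain ⟨σ, hσ, h4⟩ := ih2 (h1.nodup hl)
    rw [← List.toFinset_eq_of_perm _ _ h1] at hσ
    exact ⟨σ * τ, mem_permsOf_mul hσ hτ, by
      rw [← h4, ← h3, List.map_map]; rfl⟩

theorem sum_arrangements {M : Type*} [AddCommMonoid M] {J : Finset (Fin n)} {l : List (Fin n)}
    (hl : l.Nodup) (hJ : l.toFinset = J) (f : List (Fin n) → M) :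
    ∑ p ∈ arrangements J, f p = ∑ τ ∈ permsOf J, f (l.map τ) := by
  symm
  subst hJ
  refine Finset.sum_bij (fun τ _ => l.map τ) ?_ ?_ ?_ fun _ _ => rfl
  · intro τ hτ
    refine mem_arrangements.mpr ⟨hl.map τ.injective, ?_⟩
    have hsub : l.toFinset.map τ.toEmbedding = l.toFinset := by
      refine Finset.eq_of_subset_of_card_le (fun y hy => ?_) (by rw [Finset.card_map])
      obtain ⟨x, hx, rfl⟩ := Finset.mem_map.mp hy
      by_contra hn
      have h1 := (Finset.mem_filter.mp hτ).2 _ hn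
      have h2 : τ x = x := τ.injective h1
      exact hn (h2.symm ▸ hx : τ x ∈ l.toFinset)
    rw [← hsub]
    ext y
    simp only [List.mem_toFinset, List.mem_map, Finset.mem_map]
    rfl
  · intro σ hσ τ hτ h
    ext x
    by_cases hx : x ∈ l
    · rw [List.map_inj_left.mp h x hx]
    · have hx' : x ∉ l.toFinset := fun h => hx (List.mem_toFinset.mp h)
      rw [(Finset.mem_filter.mp hσ).2 x hx', (Finset.mem_filter.mp hτ).2 x hx']
  · intro p hp
    obtain ⟨hn, hp⟩ := mem_arrangements.mp hp
    obtain ⟨τ, hτ, h⟩ := exists_map_eq_of_perm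
      (List.perm_of_nodup_nodup_toFinset_eq hl hn hp.symm) hl
    exact ⟨τ, hτ, h⟩

end Sorted

theorem MatrixSystem.entryWord_ofFn {ι K F : Type*} [Field K] [Ring F] {κ : DynKernel ι K}
    (Y : MatrixSystem κ F) {d : ℕ} (f g : Fin d → ι) (m : ℤ) :
    Y.entryWord (List.ofFn f) (List.ofFn g) m
      = (List.ofFn fun k : Fin d => Y.entry (f k) (g k) (m + (k.rev : ℕ))).prod := by
  induction d with
  | zero => simp [entryWord]
  | succ d ih =>
    rw [List.ofFn_succ, List.ofFn_succ, entryWord, ih, List.ofFn_succ, List.prod_cons,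
      List.length_ofFn]
    simp [Fin.val_rev]

theorem ExteriorSystem.word_ofFn {ι K A : Type*} [Field K] [Ring A] {κ : DynKernel ι K}
    (X : ExteriorSystem κ A) {d : ℕ} (f : Fin d → ι) (m : ℤ) :
    X.word (List.ofFn f) m
      = (List.ofFn fun k : Fin d => X.gen (f k) (m + (k.rev : ℕ))).prod := by
  induction d with
  | zero => simp [word]
  | succ d ih =>
    rw [List.ofFn_succ, word, ih, List.ofFn_succ, List.prod_cons, List.length_ofFn]
    simp [Fin.val_rev]

section Normalization

variable (P : Params) {n : ℕ}

theorem pairProd_kernelL_descList (J : Finset (Fin n)) (τ : Fin n → Fin n) :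
    (kernelL P n).pairProd ((descList J).map τ)
      = ∏ x ∈ (J ×ˢ J).filter (fun x => x.1 < x.2), Edyn P (τ x.1) (τ x.2) 1 := by
  rw [DynKernel.pairProd_map_of_pairwise _ (r := (· > ·)) (fun _ _ h => not_lt_of_gt h)
    (pairwise_descList J), toFinset_descList]
  refine Finset.prod_nbij' Prod.swap Prod.swap ?_ ?_ (fun _ _ => rfl) (fun _ _ => rfl)
    fun _ _ => rfl <;>
  · intro x hx
    simp only [Finset.mem_filter, Finset.mem_product, Prod.fst_swap, Prod.snd_swap] at hx ⊢
    exact ⟨hx.1.symm, hx.2⟩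

theorem pairProd_kernelR_ascList (J : Finset (Fin n)) (τ : Fin n → Fin n) :
    (kernelR P n).pairProd ((ascList J).map τ)
      = ∏ x ∈ (J ×ˢ J).filter (fun x => x.1 < x.2), (Edyn P (τ x.1) (τ x.2) 0)⁻¹ := by
  rw [DynKernel.pairProd_map_of_pairwise _ (r := (· < ·)) (fun _ _ h => not_lt_of_gt h)
    (pairwise_ascList J), toFinset_ascList]
  rfl

theorem pairProd_descList_eq_normLow (I : Finset (Fin n)) :
    (kernelL P n).pairProd (descList I) = normLow P I := by
  have h := pairProd_kernelL_descList P I id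
  rwa [List.map_id] at h

theorem pairProd_ascList_eq_normUp_inv (I : Finset (Fin n)) :
    (kernelR P n).pairProd (ascList I) = (normUp P I)⁻¹ := by
  have h := pairProd_kernelR_ascList P I id
  rwa [List.map_id, Finset.prod_inv_distrib] at h

theorem normLow_mul_sgnLow {J : Finset (Fin n)} {τ : Equiv.Perm (Fin n)} (hτ : τ ∈ permsOf J) :
    normLow P J * sgnLow P J τ = (kernelL P n).pairProd ((descList J).map τ) := by
  rw [pairProd_kernelL_descList, normLow, prod_lt_perm hτ (fun i j => Edyn P i j 1), sgnLow,
    ← Finset.filter_filter, Finset.prod_filter (s := Finset.filter _ _), ← Finset.prod_mul_distrib]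
  refine Finset.prod_congr rfl fun x hx => ?_
  have hne : τ x.2 ≠ τ x.1 := fun h => (Finset.mem_filter.mp hx).2.ne' (τ.injective h)
  split_ifs with h
  · exact mul_div_cancel₀ _ (Edyn_ne_zero P hne 1)
  · rw [mul_one]

theorem normUp_inv_mul_sgnUp_inv {J : Finset (Fin n)} {τ : Equiv.Perm (Fin n)}
    (hτ : τ ∈ permsOf J) :
    (normUp P J)⁻¹ * (sgnUp P J τ)⁻¹ = (kernelR P n).pairProd ((ascList J).map τ) := by
  rw [pairProd_kernelR_ascList, normUp, prod_lt_perm hτ (fun i j => Edyn P i j 0), sgnUp,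
    ← Finset.filter_filter, Finset.prod_filter (s := Finset.filter _ _), ← mul_inv,
    ← Finset.prod_mul_distrib, ← Finset.prod_inv_distrib]
  refine Finset.prod_congr rfl fun x hx => ?_
  have hne : τ x.2 ≠ τ x.1 := fun h => (Finset.mem_filter.mp hx).2.ne' (τ.injective h)
  congr 1
  split_ifs with h
  · have h0 := Edyn_ne_zero P hne 0
    rw [Edyn_swap P (τ x.2) (τ x.1)]
    field_simp
  · rw [mul_one]

end Normalization

/-! ### Regularized matrix elements at powers of `q ^ 2` -/

section Regularized

variable (P : Params) {n : ℕ}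

/-- The multiplier that cancels the pole of the R-matrix, normalized for the point `q ^ (2 u)`. -/
noncomputable def regFactor (u : ℤ) (w : ℂ) : ℂ :=
  -(P.q : ℂ) ^ (-(u + 1)) * theta P ((P.q : ℂ) ^ 2 * w)

/-- The value of the regularized `α(ζ_ij, w)` at `w = q ^ (2 u)`. -/
noncomputable def alphaReg (u : ℤ) (i j : Fin n) : Mer n :=
  ellMer P (u : Entire n) * Edyn P i j 1 / Edyn P i j 0

/-- The value of the regularized `β(ζ_ij, w)` at `w = q ^ (2 u)`. -/
noncomputable def betaReg (u : ℤ) (i j : Fin n) : Mer n :=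
  ellMer P (1 : Entire n) * Edyn P i j (-u) / Edyn P i j 0

theorem theta_q_mul_differentiableOn :
    DifferentiableOn ℂ (fun w => theta P ((P.q : ℂ) ^ 2 * w)) {0}ᶜ := fun w hw =>
  ((theta_differentiableAt P (mul_ne_zero (pow_ne_zero 2 P.q_ne_zero) hw)).fun_comp' w
    (by fun_prop)).differentiableWithinAt

theorem regFactor_differentiableOn (u : ℤ) : DifferentiableOn ℂ (regFactor P u) {0}ᶜ :=
  (theta_q_mul_differentiableOn P).const_mul _

theorem regFactor_meromorphicOn (u : ℤ) : MeromorphicOn (regFactor P u) {0}ᶜ :=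
  ((regFactor_differentiableOn P u).analyticOnNhd isOpen_compl_singleton).meromorphicOn

theorem theta_q_sq_ne_zero : theta P ((P.q : ℂ) ^ 2) ≠ 0 := by
  have h1 := theta_qpow P 1
  have h2 := ellE_intCast_ne_zero P one_ne_zero
  rw [mul_one, show (2 : ℂ) = ((2 : ℤ) : ℂ) by norm_num, qpow_intCast] at h1
  rw [show (P.q : ℂ) ^ 2 = (P.q : ℂ) ^ (2 : ℤ) by norm_cast, h1]
  exact neg_ne_zero.mpr (mul_ne_zero (qpow_ne_zero _ _) (by exact_mod_cast h2))

/-- The zeros of `θ(q ^ 2 w)` are isolated. -/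
theorem eventually_theta_ne_zero {w₀ : ℂ} (hw₀ : w₀ ≠ 0) :
    ∀ᶠ w in 𝓝[≠] w₀, theta P ((P.q : ℂ) ^ 2 * w) ≠ 0 := by
  have han := (theta_q_mul_differentiableOn P).analyticOnNhd isOpen_compl_singleton
  refine (han w₀ hw₀).eventually_eq_zero_or_eventually_ne_zero.resolve_left fun h => ?_
  have hconn : IsPreconnected ({0}ᶜ : Set ℂ) :=
    (isConnected_compl_singleton_of_one_lt_rank (by simp) 0).isPreconnected
  have h1 : theta P ((P.q : ℂ) ^ 2 * 1) = 0 :=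
    han.eqOn_of_preconnected_of_eventuallyEq analyticOnNhd_const hconn hw₀ h
      (by simp : (1 : ℂ) ∈ ({0}ᶜ : Set ℂ))
  rw [mul_one] at h1
  exact theta_q_sq_ne_zero P h1

theorem theta_qpow_zpow (u : ℤ) (s : ℂ) :
    theta P (qpow P (2 * s) * (P.q : ℂ) ^ (2 * u)) = -(qpow P (u + s) * ellE P (u + s)) := by
  rw [← theta_qpow, ← qpow_intCast, ← qpow_add]
  congr 2
  push_cast
  ring

theorem regFactor_eq (u : ℤ) :
    regFactor P u ((P.q : ℂ) ^ (2 * u)) = ellE P ((u + 1 : ℤ) : ℂ) := by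
  have h := theta_qpow_zpow P u 1
  rw [mul_one, show (2 : ℂ) = ((2 : ℤ) : ℂ) by norm_num, qpow_intCast] at h
  rw [regFactor, show (P.q : ℂ) ^ 2 = (P.q : ℂ) ^ (2 : ℤ) by norm_cast, h,
    show (u : ℂ) + 1 = ((u + 1 : ℤ) : ℂ) by push_cast; ring, qpow_intCast, zpow_neg]
  have := zpow_ne_zero (u + 1) P.q_ne_zero
  field_simp

theorem continuousAt_theta_mul {c w : ℂ} (hc : c ≠ 0) (hw : w ≠ 0) :
    ContinuousAt (fun w => theta P (c * w)) w :=
  ((theta_differentiableAt P (mul_ne_zero hc hw)).fun_comp' w (by fun_prop)).continuousAt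

/-- The entire function `ζ ↦ E(ζ_ij + c)`. -/
noncomputable def ellEntire (i j : Fin n) (c : ℂ) : Entire n :=
  ⟨fun ζ => ellE P (coord i j ζ + c), ellE_coord_analytic P i j c⟩

theorem ellEntire_ne_zero {i j : Fin n} (hij : i ≠ j) (c : ℂ) : ellEntire P i j c ≠ 0 := fun h =>
  Edyn_ne_zero P hij c (by
    change algebraMap (Entire n) (Mer n) (ellEntire P i j c) = 0
    rw [h, map_zero])

theorem ellMer_intCast (u : ℤ) : ellMer P (u : Entire n)
    = algebraMap (Entire n) (Mer n) (algebraMap ℂ (Entire n) (ellE P u)) := by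
  rw [ellMer, ← map_intCast (algebraMap ℂ (Entire n)) u]
  rfl

theorem isSpectralLimit_alpha (u : ℤ) {i j : Fin n} (hij : i ≠ j) :
    IsSpectralLimit (regFactor P u) (fun ζ w => alpha P (coord i j ζ) w) ((P.q : ℂ) ^ (2 * u))
      (alphaReg P u i j) := by
  have hw₀ : (P.q : ℂ) ^ (2 * u) ≠ 0 := zpow_ne_zero _ P.q_ne_zero
  refine ⟨algebraMap ℂ (Entire n) (ellE P u) * ellEntire P i j 1, ellEntire P i j 0,
    ellEntire_ne_zero P hij 0, ?_, fun ζ hζ => ?_⟩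
  · rw [alphaReg, ellMer_intCast, map_mul]
    rfl
  · change ellE P (coord i j ζ + 0) ≠ 0 at hζ
    change Tendsto _ _ (𝓝 (ellE P u * ellE P (coord i j ζ + 1) / ellE P (coord i j ζ + 0)))
    rw [add_zero] at hζ ⊢
    set s := coord i j ζ
    have hlim : Tendsto (fun w => -(P.q : ℂ) ^ (-(u + 1)) * theta P (1 * w) *
        theta P (qpow P (2 * (s + 1))) / theta P (qpow P (2 * s))) (𝓝[≠] ((P.q : ℂ) ^ (2 * u)))
        (𝓝 (-(P.q : ℂ) ^ (-(u + 1)) * theta P (1 * (P.q : ℂ) ^ (2 * u)) *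
        theta P (qpow P (2 * (s + 1))) / theta P (qpow P (2 * s)))) :=
      (((continuousAt_theta_mul P one_ne_zero hw₀).tendsto.const_mul _).mul_const _).div_const _
        |>.mono_left nhdsWithin_le_nhds
    have hval : -(P.q : ℂ) ^ (-(u + 1)) * theta P (1 * (P.q : ℂ) ^ (2 * u)) *
        theta P (qpow P (2 * (s + 1))) / theta P (qpow P (2 * s))
        = ellE P u * ellE P (s + 1) / ellE P s := by
      have h0 := theta_qpow_zpow P u 0
      rw [mul_zero, add_zero, show qpow P 0 = 1 by simp [qpow]] at h0
      rw [h0, theta_qpow, theta_qpow, qpow_add, qpow_intCast, neg_add, zpow_add₀ P.q_ne_zero,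
        zpow_neg, show qpow P 1 = P.q by simp [qpow]]
      have h1 := qpow_ne_zero P s
      have h2 := zpow_ne_zero u P.q_ne_zero
      have h3 := P.q_ne_zero
      rw [zpow_neg_one]
      field_simp
    rw [← hval]
    refine hlim.congr' ?_
    filter_upwards [eventually_theta_ne_zero P hw₀] with w hw
    change _ = regFactor P u w * alpha P s w
    rw [regFactor, alpha, one_mul]
    field_simp

theorem isSpectralLimit_beta (u : ℤ) {i j : Fin n} (hij : i ≠ j) :
    IsSpectralLimit (regFactor P u) (fun ζ w => beta P (coord i j ζ) w) ((P.q : ℂ) ^ (2 * u))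
      (betaReg P u i j) := by
  have hw₀ : (P.q : ℂ) ^ (2 * u) ≠ 0 := zpow_ne_zero _ P.q_ne_zero
  refine ⟨algebraMap ℂ (Entire n) (ellE P 1) * ellEntire P i j (-u), ellEntire P i j 0,
    ellEntire_ne_zero P hij 0, ?_, fun ζ hζ => ?_⟩
  · have h := ellMer_intCast P (n := n) 1
    push_cast at h
    rw [betaReg, h, map_mul]
    rfl
  · change ellE P (coord i j ζ + 0) ≠ 0 at hζ
    change Tendsto _ _ (𝓝 (ellE P 1 * ellE P (coord i j ζ + -u) / ellE P (coord i j ζ + 0)))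
    rw [add_zero] at hζ ⊢
    set s := coord i j ζ
    have hlim : Tendsto (fun w => -(P.q : ℂ) ^ (-(u + 1)) * theta P ((P.q : ℂ) ^ 2) *
        theta P (qpow P (-2 * s) * w) / theta P (qpow P (-2 * s))) (𝓝[≠] ((P.q : ℂ) ^ (2 * u)))
        (𝓝 (-(P.q : ℂ) ^ (-(u + 1)) * theta P ((P.q : ℂ) ^ 2) *
        theta P (qpow P (-2 * s) * (P.q : ℂ) ^ (2 * u)) / theta P (qpow P (-2 * s)))) :=
      (((continuousAt_theta_mul P (qpow_ne_zero _ _) hw₀).tendsto.const_mul _).div_const _)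
        |>.mono_left nhdsWithin_le_nhds
    have hval : -(P.q : ℂ) ^ (-(u + 1)) * theta P ((P.q : ℂ) ^ 2) *
        theta P (qpow P (-2 * s) * (P.q : ℂ) ^ (2 * u)) / theta P (qpow P (-2 * s))
        = ellE P 1 * ellE P (s + -u) / ellE P s := by
      have h0 := theta_qpow_zpow P u (-s)
      have h1 := theta_qpow P (-s)
      have h2 := theta_qpow P 1
      rw [show ellE P (u + -s) = -ellE P (s + -u) by rw [← ellE_neg]; congr 1; ring, qpow_add] at h0
      rw [ellE_neg] at h1
      rw [show (P.q : ℂ) ^ 2 = qpow P (2 * 1) by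
        rw [mul_one, show (2 : ℂ) = ((2 : ℤ) : ℂ) by norm_num, qpow_intCast]; norm_cast]
      rw [show -2 * s = 2 * -s by ring, h0, h1, h2, qpow_intCast, neg_add, zpow_add₀ P.q_ne_zero,
        zpow_neg, show qpow P 1 = P.q by simp [qpow]]
      have h3 := qpow_ne_zero P (-s)
      have h4 := zpow_ne_zero u P.q_ne_zero
      have h5 := P.q_ne_zero
      rw [zpow_neg_one]
      field_simp
    rw [← hval]
    refine hlim.congr' ?_
    filter_upwards [eventually_theta_ne_zero P hw₀] with w hw
    change _ = regFactor P u w * beta P s w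
    rw [regFactor, beta]
    field_simp

/-- The regularized R-matrix element `R^{ab}_{xy}` at the point `q ^ (2 u)`. -/
noncomputable def Rreg (u : ℤ) (x y a b : Fin n) : Mer n :=
  if a = b then (if x = a ∧ y = a then ellMer P ((u + 1 : ℤ) : Entire n) else 0)
  else if x = a ∧ y = b then alphaReg P u x y
  else if x = b ∧ y = a then betaReg P u x y
  else 0

theorem isSpectralLimit_zero (φ : ℂ → ℂ) (z : ℂ) :
    IsSpectralLimit φ (fun (_ : Dual n) _ => 0) z 0 :=
  ⟨0, 1, one_ne_zero, by simp, fun ζ _ => by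
    change Tendsto _ _ (𝓝 ((0 : ℂ) / 1))
    simp⟩

theorem isSpectralLimit_Rmat (u : ℤ) (x y a b : Fin n) :
    IsSpectralLimit (regFactor P u) (Rmat P x y a b) ((P.q : ℂ) ^ (2 * u)) (Rreg P u x y a b) := by
  unfold Rreg
  unfold Rmat
  by_cases hab : a = b
  · simp only [if_pos hab]
    by_cases hc : x = a ∧ y = a
    · simp only [if_pos hc]
      refine ⟨algebraMap ℂ (Entire n) (ellE P ((u + 1 : ℤ) : ℂ)), 1, one_ne_zero, ?_, fun ζ _ => ?_⟩
      · rw [ellMer_intCast, map_one, div_one]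
      · change Tendsto _ _ (𝓝 (ellE P ((u + 1 : ℤ) : ℂ) / 1))
        have hw₀ : (P.q : ℂ) ^ (2 * u) ≠ 0 := zpow_ne_zero _ P.q_ne_zero
        have := ((regFactor_differentiableOn P u).differentiableAt
          (isOpen_compl_singleton.mem_nhds hw₀)).continuousAt.tendsto
        rw [regFactor_eq] at this
        simpa using this.mono_left nhdsWithin_le_nhds
    · simp only [if_neg hc]
      exact isSpectralLimit_zero _ _
  · simp only [if_neg hab]
    by_cases hc : x = a ∧ y = b
    · simp only [if_pos hc]
      exact isSpectralLimit_alpha P u (hc.1.trans_ne (hab <| ·.trans hc.2))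
    · simp only [if_neg hc]
      by_cases hd : x = b ∧ y = a
      · simp only [if_pos hd]
        exact isSpectralLimit_beta P u fun h => hab (hd.2.symm.trans (h.symm.trans hd.1))
      · simp only [if_neg hd]
        exact isSpectralLimit_zero _ _

end Regularized

/-! ### Consequences of the RLL relations -/

section RLL

variable (P : Params) {n : ℕ}

theorem sum_Rreg_lower {M : Type*} [AddCommMonoid M] (u : ℤ) {a c : Fin n} (hac : a ≠ c)
    (f : Mer n → Fin n → Fin n → M) (hf : ∀ x y, f 0 x y = 0) :
    ∑ x, ∑ y, f (Rreg P u a c x y) x y = f (alphaReg P u a c) a c + f (betaReg P u a c) c a := by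
  have h0 : ∀ x y, ¬ (x = a ∧ y = c) → ¬ (x = c ∧ y = a) → Rreg P u a c x y = 0 := by
    intro x y h1 h2
    rw [Rreg]
    split_ifs with h3 h4 h5 h6
    · exact absurd (h4.1.trans h4.2.symm) hac
    · rfl
    · exact absurd ⟨h5.1.symm, h5.2.symm⟩ h1
    · exact absurd ⟨h6.2.symm, h6.1.symm⟩ h2
    · rfl
  have h1 : Rreg P u a c a c = alphaReg P u a c := by simp [Rreg, hac]
  have h2 : Rreg P u a c c a = betaReg P u a c := by simp [Rreg, hac, hac.symm]
  rw [← Finset.sum_product', Finset.univ_product_univ, ← h1, ← h2]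
  rw [← Finset.sum_subset (Finset.subset_univ {(a, c), (c, a)}), Finset.sum_pair]
  · intro h
    exact hac (Prod.ext_iff.mp h).1
  · intro x _ hx
    simp only [Finset.mem_insert, Finset.mem_singleton, Prod.ext_iff, not_or] at hx
    rw [h0 _ _ hx.1 hx.2, hf]

theorem sum_Rreg_upper {M : Type*} [AddCommMonoid M] (u : ℤ) {b d : Fin n} (hbd : b ≠ d)
    (f : Mer n → Fin n → Fin n → M) (hf : ∀ x y, f 0 x y = 0) :
    ∑ x, ∑ y, f (Rreg P u x y b d) x y = f (alphaReg P u b d) b d + f (betaReg P u d b) d b := by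
  have h0 : ∀ x y, ¬ (x = b ∧ y = d) → ¬ (x = d ∧ y = b) → Rreg P u x y b d = 0 := by
    intro x y h1 h2
    rw [Rreg, if_neg hbd, if_neg h1, if_neg h2]
  have h1 : Rreg P u b d b d = alphaReg P u b d := by simp [Rreg, hbd]
  have h2 : Rreg P u d b b d = betaReg P u d b := by simp [Rreg, hbd, hbd.symm]
  rw [← Finset.sum_product', Finset.univ_product_univ, ← h1, ← h2]
  rw [← Finset.sum_subset (Finset.subset_univ {(b, d), (d, b)}), Finset.sum_pair]
  · intro h
    exact hbd (Prod.ext_iff.mp h).1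
  · intro x _ hx
    simp only [Finset.mem_insert, Finset.mem_singleton, Prod.ext_iff, not_or] at hx
    rw [h0 _ _ hx.1 hx.2, hf]

theorem Rreg_neg_one_self (a x y : Fin n) : Rreg P (-1) x y a a = 0 := by
  have h : ((-1 + 1 : ℤ) : Entire n) = 0 := by norm_num
  rw [Rreg, if_pos rfl, h, ellMer_zero, ite_self]

theorem Rreg_neg_one_of_same (a x y : Fin n) : Rreg P (-1) a a x y = 0 := by
  by_cases h : x = y
  · subst h; exact Rreg_neg_one_self P x a a
  · rw [Rreg, if_neg h, if_neg fun h' => h (h'.1.symm.trans h'.2),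
      if_neg fun h' => h (h'.2.symm.trans h'.1)]

/-- The ratio `E(ζ_ij + 1) / E(ζ_ij)`. -/
noncomputable def ellRatio (i j : Fin n) : Mer n := Edyn P i j 1 / Edyn P i j 0

theorem alphaReg_neg_one (i j : Fin n) :
    alphaReg P (-1) i j = -(ellMer P ((1 : ℤ) : Entire n) * ellRatio P i j) := by
  rw [alphaReg, show ((-1 : ℤ) : Entire n) = -((1 : ℤ) : Entire n) by norm_num, ellMer_neg,
    ellRatio]
  ring

theorem betaReg_neg_one (i j : Fin n) :
    betaReg P (-1) i j = ellMer P ((1 : ℤ) : Entire n) * ellRatio P i j := by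
  rw [betaReg, show (-((-1 : ℤ) : ℂ)) = 1 by norm_num, Int.cast_one, ellRatio]
  ring

theorem ellMer_intCast_ne_zero {u : ℤ} (hu : u ≠ 0) : ellMer P (u : Entire n) ≠ 0 := by
  rw [ellMer_intCast]
  intro h
  have h1 := IsFractionRing.injective (Entire n) (Mer n) (h.trans (map_zero _).symm)
  exact ellE_intCast_ne_zero P hu (congrFun (congrArg Subtype.val h1) 0)

theorem ellRatio_ne_zero {i j : Fin n} (hij : i ≠ j) : ellRatio P i j ≠ 0 :=
  div_ne_zero (Edyn_ne_zero P hij 1) (Edyn_ne_zero P hij 0)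

theorem Edyn_eq_mul_ellRatio {i j : Fin n} (hij : i ≠ j) :
    Edyn P i j 1 = Edyn P i j 0 * ellRatio P i j :=
  (mul_div_cancel₀ _ (Edyn_ne_zero P hij 0)).symm

/-- Elements `e_ab(q ^ (2 k) z)`, at the points `k` of a geometric progression of spectral
parameters, of a ring with two commuting moment maps, that satisfy the defining relations of the
algebra `F_ell(M(n))`. -/
structure RLLSystem (n : ℕ) (F : Type*) [Ring F] where
  lam : Mer n →+* F
  rho : Mer n →+* F
  entry : Fin n → Fin n → ℤ → F
  lam_rho : ∀ f g, lam f * rho g = rho g * lam f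
  lam_entry : ∀ f a b k, lam f * entry a b k = entry a b k * lam (shift (weight a) f)
  rho_entry : ∀ f a b k, rho f * entry a b k = entry a b k * rho (shift (weight b) f)
  lam_const : ∀ u : ℤ, lam (ellMer P (u : Entire n)) = rho (ellMer P (u : Entire n))
  rll : ∀ a b c d k l,
    ∑ x, ∑ y, lam (Rreg P (k - l) a c x y) * entry x b k * entry y d l
      = ∑ x, ∑ y, rho (Rreg P (k - l) x y b d) * entry c y l * entry a x k

namespace RLLSystem

variable {P} {F : Type*} [Ring F] (Z : RLLSystem P n F)

theorem lam_cancel {f : Mer n} (hf : f ≠ 0) {x y : F} (h : Z.lam f * x = Z.lam f * y) : x = y :=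
  ((isUnit_iff_ne_zero.mpr hf).map Z.lam).mul_left_cancel h

theorem rho_cancel {f : Mer n} (hf : f ≠ 0) {x y : F} (h : Z.rho f * x = Z.rho f * y) : x = y :=
  ((isUnit_iff_ne_zero.mpr hf).map Z.rho).mul_left_cancel h

theorem lam_rho_left (f g : Mer n) (x : F) :
    Z.lam f * (Z.rho g * x) = Z.rho g * (Z.lam f * x) := by
  rw [← mul_assoc, Z.lam_rho, mul_assoc]

/-- The RLL relation with distinct rows and distinct columns. -/
theorem rll_of_ne {a b c d : Fin n} (hac : a ≠ c) (hbd : b ≠ d) (k l : ℤ) :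
    Z.lam (alphaReg P (k - l) a c) * Z.entry a b k * Z.entry c d l
        + Z.lam (betaReg P (k - l) a c) * Z.entry c b k * Z.entry a d l
      = Z.rho (alphaReg P (k - l) b d) * Z.entry c d l * Z.entry a b k
        + Z.rho (betaReg P (k - l) d b) * Z.entry c b l * Z.entry a d k := by
  have h := Z.rll a b c d k l
  rwa [sum_Rreg_lower P _ hac (fun f x y => Z.lam f * Z.entry x b k * Z.entry y d l)
      (fun x y => by rw [map_zero, zero_mul, zero_mul]),
    sum_Rreg_upper P _ hbd (fun f x y => Z.rho f * Z.entry c y l * Z.entry a x k)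
      (fun x y => by rw [map_zero, zero_mul, zero_mul])] at h

/-- The residual RLL relation with distinct rows and columns: the `2 × 2` case of the equality of
left and right minors. -/
theorem residual_of_ne {a b c d : Fin n} (hac : a ≠ c) (hbd : b ≠ d) (k : ℤ) :
    Z.lam (ellRatio P a c) * (Z.entry c b k * Z.entry a d (k + 1)
        - Z.entry a b k * Z.entry c d (k + 1))
      = Z.rho (ellRatio P d b) * (Z.entry c b (k + 1) * Z.entry a d k)
        - Z.rho (ellRatio P b d) * (Z.entry c d (k + 1) * Z.entry a b k) := by
  have h := Z.rll_of_ne hac hbd k (k + 1)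
  rw [show k - (k + 1) = -1 by ring] at h
  simp only [alphaReg_neg_one, betaReg_neg_one, map_neg, map_mul] at h
  rw [Z.lam_const] at h
  refine Z.rho_cancel (ellMer_intCast_ne_zero P one_ne_zero) ?_
  rw [← sub_eq_zero] at h ⊢
  rw [← h]
  simp only [mul_sub, neg_mul, mul_assoc]
  abel

/-- The residual RLL relation with equal rows. -/
theorem residual_same_row {a b d : Fin n} (hbd : b ≠ d) (k : ℤ) :
    Z.rho (ellRatio P d b) * (Z.entry a b (k + 1) * Z.entry a d k)
      = Z.rho (ellRatio P b d) * (Z.entry a d (k + 1) * Z.entry a b k) := by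
  have h := Z.rll a b a d k (k + 1)
  rw [show k - (k + 1) = -1 by ring, sum_Rreg_upper P _ hbd (fun f x y =>
      Z.rho f * Z.entry a y (k + 1) * Z.entry a x k)
      (fun x y => by rw [map_zero, zero_mul, zero_mul])] at h
  simp only [Rreg_neg_one_of_same, alphaReg_neg_one, betaReg_neg_one, map_neg, map_mul, map_zero,
    zero_mul, Finset.sum_const_zero] at h
  refine Z.rho_cancel (ellMer_intCast_ne_zero P one_ne_zero) ?_
  rw [← sub_eq_zero, h]
  simp only [neg_mul, mul_assoc]
  abel

/-- The residual RLL relation with equal columns. -/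
theorem residual_same_col {a b c : Fin n} (hac : a ≠ c) (k : ℤ) :
    Z.entry c b k * Z.entry a b (k + 1) = Z.entry a b k * Z.entry c b (k + 1) := by
  have h := Z.rll a b c b k (k + 1)
  rw [show k - (k + 1) = -1 by ring, sum_Rreg_lower P _ hac (fun f x y =>
      Z.lam f * Z.entry x b k * Z.entry y b (k + 1))
      (fun x y => by rw [map_zero, zero_mul, zero_mul])] at h
  simp only [Rreg_neg_one_self, alphaReg_neg_one, betaReg_neg_one, map_neg, map_zero,
    zero_mul, Finset.sum_const_zero] at h
  refine Z.lam_cancel (mul_ne_zero (ellMer_intCast_ne_zero P (u := 1) one_ne_zero)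
    (ellRatio_ne_zero P hac)) ?_
  rw [← sub_eq_zero, ← h]
  simp only [neg_mul, mul_assoc]
  abel

/-! ### The matrix systems behind the left and right minors -/

/-- The matrix `e_ab(q ^ (2 k) z)`, coacting on the left exterior algebra. -/
noncomputable def systemL : MatrixSystem (kernelL P n) F where
  row := Z.lam
  col := Z.rho
  entry := Z.entry
  row_col := Z.lam_rho
  row_entry := Z.lam_entry
  col_entry := Z.rho_entry
  entry_same a b d hbd k := by
    have h := Z.residual_same_row (a := a) hbd k
    simp only [kernelL, Edyn_eq_mul_ellRatio P hbd, Edyn_eq_mul_ellRatio P hbd.symm,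
      Edyn_swap P b d, map_mul, map_neg, mul_assoc, neg_mul]
    rw [h]
    abel
  entry_swap a c b d hac hbd k := by
    have hx : ∀ x y : Fin n, x ≠ y →
        Z.rho ((kernelL P n).G b d) * (Z.entry x b (k + 1) * Z.entry y d k)
          + Z.rho ((kernelL P n).G d b) * (Z.entry x d (k + 1) * Z.entry y b k)
        = Z.rho (Edyn P d b 0) * (Z.lam (ellRatio P y x) *
          (Z.entry x b k * Z.entry y d (k + 1) - Z.entry y b k * Z.entry x d (k + 1))) := by
      intro x y hxy
      rw [Z.residual_of_ne hxy.symm hbd k]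
      simp only [kernelL, Edyn_eq_mul_ellRatio P hbd, Edyn_eq_mul_ellRatio P hbd.symm,
        Edyn_swap P d b, map_mul, map_neg, mul_assoc, mul_sub, neg_mul]
      abel
    rw [hx a c hac, hx c a hac.symm]
    change Z.lam (Edyn P a c 1) * _ = Z.lam (Edyn P c a 1) * _
    rw [Z.lam_rho_left, Z.lam_rho_left, Edyn_eq_mul_ellRatio P hac,
      Edyn_eq_mul_ellRatio P hac.symm, Edyn_swap P a c]
    congr 1
    simp only [← mul_assoc, ← map_mul]
    rw [show -Edyn P a c 0 * ellRatio P c a * ellRatio P a c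
      = -(Edyn P a c 0 * ellRatio P a c * ellRatio P c a) by ring, map_neg, neg_mul, ← mul_neg,
      neg_sub]

/-- The transposed matrix with entries `e_ab(q ^ (-2 k) z)` in row `b` and column `a`, coacting on
the right exterior algebra. -/
noncomputable def systemR : MatrixSystem (kernelR P n) F where
  row := Z.rho
  col := Z.lam
  entry b a k := Z.entry a b (-k)
  row_col f g := (Z.lam_rho g f).symm
  row_entry f b a k := Z.rho_entry f a b _
  col_entry f b a k := Z.lam_entry f a b _
  entry_same b a c hac k := by
    have h := Z.residual_same_col (b := b) hac (-(k + 1))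
    rw [show -(k + 1) + 1 = -k by ring] at h
    rw [h]
    simp only [kernelR, Edyn_swap P a c, inv_neg, map_neg, neg_mul, add_neg_cancel]
  entry_swap b d a c hbd hac k := by
    have hx : ∀ x y : Fin n, x ≠ y →
        Z.lam ((kernelR P n).G a c) * (Z.entry a x (-(k + 1)) * Z.entry c y (-k))
          + Z.lam ((kernelR P n).G c a) * (Z.entry c x (-(k + 1)) * Z.entry a y (-k))
        = Z.lam (-(Edyn P a c 1)⁻¹) *
          (Z.rho (ellRatio P y x) * (Z.entry c x (-k) * Z.entry a y (-(k + 1)))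
          - Z.rho (ellRatio P x y) * (Z.entry c y (-k) * Z.entry a x (-(k + 1)))) := by
      intro x y hxy
      have h := Z.residual_of_ne hac hxy (-(k + 1))
      rw [show -(k + 1) + 1 = -k by ring] at h
      have h1 := Edyn_ne_zero P hac 0
      have h2 := Edyn_ne_zero P hac 1
      have h3 : -(Edyn P a c 1)⁻¹ * ellRatio P a c = -(Edyn P a c 0)⁻¹ := by
        rw [ellRatio]
        field_simp
      rw [← h, ← mul_assoc (Z.lam (-(Edyn P a c 1)⁻¹)), ← map_mul, h3]
      simp only [kernelR, Edyn_swap P a c, inv_neg, map_neg, mul_sub, neg_mul]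
      abel
    rw [hx b d hbd, hx d b hbd.symm]
    change Z.rho (Edyn P d b 0)⁻¹ * _ = Z.rho (Edyn P b d 0)⁻¹ * _
    rw [← Z.lam_rho_left, ← Z.lam_rho_left, Edyn_swap P b d, inv_neg]
    congr 1
    rw [map_neg, neg_mul, ← mul_neg, neg_sub]

end RLLSystem
end RLL

/-! ### Equality of left and right minors -/

section LeftRight

variable (P : Params) {n : ℕ}

theorem kernelL_S_singleton {K : Finset (Fin n)} {x : Fin n} (hx : x ∉ K) :
    (kernelL P n).S K {x} = ∏ i ∈ K, Edyn P x i 1 := by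
  rw [DynKernel.S, if_pos (Finset.disjoint_singleton_right.mpr hx)]
  simp [kernelL]

theorem kernelR_S_singleton {K : Finset (Fin n)} {x : Fin n} (hx : x ∉ K) :
    (kernelR P n).S K {x} = ∏ i ∈ K, (Edyn P i x 0)⁻¹ := by
  rw [DynKernel.S, if_pos (Finset.disjoint_singleton_right.mpr hx)]
  simp [kernelR]

theorem shift_alphaReg (u : ℤ) {i j k : Fin n} (hi : k ≠ i) (hj : k ≠ j) :
    shift (weight k) (alphaReg P u i j) = alphaReg P u i j := by
  have h : shift (weight k) (ellMer P (u : Entire n)) = ellMer P (u : Entire n) := by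
    rw [ellMer_intCast, shift_algebraMap]
    rfl
  rw [alphaReg, map_div₀, map_mul, h, shift_Edyn P hi hj, shift_Edyn P hi hj]

theorem shift_betaReg (u : ℤ) {i j k : Fin n} (hi : k ≠ i) (hj : k ≠ j) :
    shift (weight k) (betaReg P u i j) = betaReg P u i j := by
  have h : shift (weight k) (ellMer P (1 : Entire n)) = ellMer P (1 : Entire n) := by
    rw [← Int.cast_one, ellMer_intCast, shift_algebraMap]
    rfl
  rw [betaReg, map_div₀, map_mul, h, shift_Edyn P hi hj, shift_Edyn P hi hj]

theorem S_mul_alphaReg_row (u : ℤ) {K : Finset (Fin n)} {a k : Fin n} (ha : a ∉ K) (hk : k ∈ K) :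
    (kernelR P n).S (K.erase k) {k} * alphaReg P u a k * (kernelL P n).S (K.erase k) {a}
      = ellMer P (u : Entire n) * (kernelL P n).S K {a} *
        (kernelR P n).S ((insert a K).erase k) {k} := by
  have hak : a ≠ k := fun h => ha (h ▸ hk)
  rw [kernelR_S_singleton P (Finset.notMem_erase k K), kernelR_S_singleton P
    (Finset.notMem_erase k _), kernelL_S_singleton P ha, kernelL_S_singleton P
    (fun h => ha (Finset.mem_of_mem_erase h)), Finset.erase_insert_of_ne hak,
    Finset.prod_insert (fun h => ha (Finset.mem_of_mem_erase h)), ← Finset.mul_prod_erase K _ hk,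
    alphaReg]
  ring

theorem S_mul_alphaReg_col (u : ℤ) {K : Finset (Fin n)} {b l : Fin n} (hb : b ∉ K) (hl : l ∈ K) :
    (kernelL P n).S (K.erase l) {l} * alphaReg P u l b * (kernelR P n).S (K.erase l) {b}
      = ellMer P (u : Entire n) * (kernelR P n).S K {b} *
        (kernelL P n).S ((insert b K).erase l) {l} := by
  have hbl : b ≠ l := fun h => hb (h ▸ hl)
  rw [kernelL_S_singleton P (Finset.notMem_erase l K), kernelL_S_singleton P
    (Finset.notMem_erase l _), kernelR_S_singleton P hb, kernelR_S_singleton P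
    (fun h => hb (Finset.mem_of_mem_erase h)), Finset.erase_insert_of_ne hbl,
    Finset.prod_insert (fun h => hb (Finset.mem_of_mem_erase h)), ← Finset.mul_prod_erase K _ hl,
    alphaReg]
  ring

/-- The partial fraction identity as an identity between structure functions. -/
theorem sum_S_mul_betaReg {K : Finset (Fin n)} {a : Fin n} (ha : a ∉ K) (u : ℤ)
    (hu : u = -K.card) :
    ∑ k ∈ K, (kernelR P n).S (K.erase k) {k} * betaReg P u a k * (kernelL P n).S (K.erase k) {k}
      = ellMer P (u : Entire n) * (kernelL P n).S K {a} * (kernelR P n).S K {a} := by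
  have hne : ∀ j ∈ K, a ≠ j := fun j hj h => ha (h ▸ hj)
  have hpf := ellMer_partialFraction P K (fun j => coordEntire a j)
    (fun j hj => by
      rw [← Edyn_zero_eq_ellMer]
      exact Edyn_ne_zero P (hne j hj) 0)
    (fun j _ k _ hjk => by
      rw [coordEntire_sub, ← Edyn_zero_eq_ellMer]
      exact Edyn_ne_zero P hjk.symm 0)
  have h1 : ∀ i j : Fin n, ellMer P (coordEntire i j + 1) = Edyn P i j 1 := fun i j => by
    rw [Edyn_eq_ellMer, map_one]
  have h2 : ∀ i j : Fin n, ellMer P (coordEntire i j + (K.card : Entire n))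
      = Edyn P i j (-u) := fun i j => by
    rw [Edyn_eq_ellMer, hu]
    congr 2
    rw [Int.cast_neg, neg_neg, Int.cast_natCast, map_natCast]
  have h3 : ellMer P (K.card : Entire n) = -ellMer P (u : Entire n) := by
    rw [← ellMer_neg, hu]
    congr 1
    push_cast
    ring
  simp only [coordEntire_sub, h1, h2, h3, ← Edyn_zero_eq_ellMer] at hpf
  have hL : ∀ k ∈ K, (kernelR P n).S (K.erase k) {k} * betaReg P u a k *
      (kernelL P n).S (K.erase k) {k} = (-1) ^ (K.card - 1) * (ellMer P (1 : Entire n) *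
        (Edyn P a k (-u) / Edyn P a k 0 * ∏ j ∈ K.erase k, Edyn P k j 1 / Edyn P k j 0)) := by
    intro k hk
    rw [kernelR_S_singleton P (Finset.notMem_erase k K), kernelL_S_singleton P
      (Finset.notMem_erase k K), ← Finset.card_erase_of_mem hk, ← Finset.prod_const, betaReg]
    have : ∏ j ∈ K.erase k, (Edyn P j k 0)⁻¹
        = (∏ j ∈ K.erase k, (-1 : Mer n)) * ∏ j ∈ K.erase k, (Edyn P k j 0)⁻¹ := by
      rw [← Finset.prod_mul_distrib]
      refine Finset.prod_congr rfl fun j _ => ?_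
      rw [Edyn_swap P k j, inv_neg, neg_one_mul]
    rw [this]
    simp only [div_eq_mul_inv, Finset.prod_mul_distrib]
    ring
  rw [Finset.sum_congr rfl hL, ← Finset.mul_sum, ← Finset.mul_sum, ← hpf]
  rcases K.eq_empty_or_nonempty with rfl | hK
  · have h0 : ellMer P (u : Entire n) = 0 := by
      have : u = 0 := by simpa using hu
      rw [this, Int.cast_zero, ellMer_zero]
    simp [h0]
  have hc : (-1 : Mer n) ^ K.card = (-1) ^ (K.card - 1) * -1 := by
    rw [← pow_succ, Nat.sub_add_cancel (Finset.card_pos.mpr hK)]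
  have hR : ∏ j ∈ K, (Edyn P j a 0)⁻¹ = (-1) ^ K.card * ∏ j ∈ K, (Edyn P a j 0)⁻¹ := by
    rw [← Finset.prod_const, ← Finset.prod_mul_distrib]
    refine Finset.prod_congr rfl fun j _ => ?_
    rw [Edyn_swap P a j, inv_neg, neg_one_mul]
  rw [kernelL_S_singleton P ha, kernelR_S_singleton P ha, hR, hc]
  simp only [div_eq_mul_inv, Finset.prod_mul_distrib]
  ring

namespace RLLSystem

variable {P} {F : Type*} [Ring F] (Z : RLLSystem P n F)

/-- The left minor with rows `I` and columns `J`, with spectral parameters starting at `m`. -/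
noncomputable def left (I : Finset (Fin n)) (m : ℤ) (J : Finset (Fin n)) : F :=
  Z.systemL.minor I m J

/-- The right minor with rows `I` and columns `J`, with spectral parameters starting at `m`. In
`systemR` the exponents are negated, so the starting point there is the negative of the last
exponent `m + #J - 1`. -/
noncomputable def right (I : Finset (Fin n)) (m : ℤ) (J : Finset (Fin n)) : F :=
  Z.systemR.minor J (1 - J.card - m) I

theorem left_expand {a : Fin n} {I : Finset (Fin n)} (ha : a ∈ I) (m : ℤ) (J : Finset (Fin n)) :
    Z.lam ((kernelL P n).S (I.erase a) {a}) * Z.left I m J = ∑ b ∈ J,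
      Z.rho ((kernelL P n).S (J.erase b) {b}) *
        (Z.left (I.erase a) (m + 1) (J.erase b) * Z.entry a b m) :=
  Z.systemL.row_S_erase_mul_minor ha m J

theorem right_expand {b : Fin n} {J : Finset (Fin n)} (hb : b ∈ J) (m : ℤ) (I : Finset (Fin n)) :
    Z.rho ((kernelR P n).S (J.erase b) {b}) * Z.right I m J = ∑ a ∈ I,
      Z.lam ((kernelR P n).S (I.erase a) {a}) *
        (Z.right (I.erase a) m (J.erase b) * Z.entry a b (m + J.card - 1)) := by
  have h := Z.systemR.row_S_erase_mul_minor hb (1 - J.card - m) I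
  refine h.trans (Finset.sum_congr rfl fun a _ => ?_)
  have hc : (1 - ((J.erase b).card : ℤ) - m) = 1 - J.card - m + 1 := by
    rw [Finset.card_erase_of_mem hb, Nat.cast_sub (Finset.card_pos.mpr ⟨b, hb⟩)]
    push_cast
    ring
  rw [right, hc]
  change _ * (_ * Z.entry a b (-(1 - J.card - m))) = _
  rw [show -(1 - (J.card : ℤ) - m) = m + J.card - 1 by ring]
  rfl

theorem lam_left {f : Mer n} {I : Finset (Fin n)} (hf : ∀ i ∈ I, shift (weight i) f = f) (m : ℤ)
    (J : Finset (Fin n)) : Z.lam f * Z.left I m J = Z.left I m J * Z.lam f :=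
  Z.systemL.row_minor hf m J

theorem rho_left {f : Mer n} {J : Finset (Fin n)} (hf : ∀ i ∈ J, shift (weight i) f = f) (m : ℤ)
    (I : Finset (Fin n)) : Z.rho f * Z.left I m J = Z.left I m J * Z.rho f :=
  Z.systemL.col_minor hf m I

/-- Left and right minors coincide. Both sides are extracted from one sum, over a row `k ≠ a` and
a column `l ≠ b`, of the minors without the rows `a, k` and the columns `b, l`, each multiplied by
an RLL relation between the first and the last spectral parameter. -/
theorem left_eq_right_of_card (d : ℕ) (I J : Finset (Fin n)) (m : ℤ) (hI : I.card = d)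
    (hJ : J.card = d) : Z.left I m J = Z.right I m J := by
  induction d using Nat.strong_induction_on generalizing I J m with
  | _ d ih =>
  rcases Nat.eq_zero_or_pos d with rfl | hd
  · obtain rfl := Finset.card_eq_zero.mp hI
    obtain rfl := Finset.card_eq_zero.mp hJ
    rw [left, right, MatrixSystem.minor_empty, MatrixSystem.minor_empty]
  rcases Nat.eq_or_lt_of_le hd with h1 | hd
  · obtain rfl : d = 1 := h1.symm
    obtain ⟨a, rfl⟩ := Finset.card_eq_one.mp hI
    obtain ⟨b, rfl⟩ := Finset.card_eq_one.mp hJ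
    rw [left, right, MatrixSystem.minor_singleton, MatrixSystem.minor_singleton]
    change Z.entry a b m = Z.entry a b (-(1 - (({b} : Finset (Fin n)).card : ℤ) - m))
    rw [Finset.card_singleton]
    congr 1
    push_cast
    ring
  obtain ⟨a, ha⟩ := Finset.card_pos.mp (hI ▸ Nat.zero_lt_of_lt hd : 0 < I.card)
  obtain ⟨b, hb⟩ := Finset.card_pos.mp (hJ ▸ Nat.zero_lt_of_lt hd : 0 < J.card)
  set I' := I.erase a with hI'
  set J' := J.erase b with hJ'
  have haI : a ∉ I' := Finset.notMem_erase a I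
  have hbJ : b ∉ J' := Finset.notMem_erase b J
  have hIi : insert a I' = I := Finset.insert_erase ha
  have hJi : insert b J' = J := Finset.insert_erase hb
  have hIc : I'.card = d - 1 := by rw [hI', Finset.card_erase_of_mem ha, hI]
  have hJc : J'.card = d - 1 := by rw [hJ', Finset.card_erase_of_mem hb, hJ]
  have hd1 : ((d - 1 : ℕ) : ℤ) = d - 1 := by rw [Nat.cast_sub hd.le]; push_cast; ring
  -- The ratio of the first parameter to the last one is `q ^ (2 u)`.
  set N : ℤ := m + d - 1 with hN
  set u : ℤ := m - N with hu
  have huI : u = -I'.card := by rw [hIc, hd1, hu, hN]; ring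
  have huJ : u = -J'.card := by rw [hJc, hd1, hu, hN]; ring
  have hu0 : u ≠ 0 := by omega
  set M : Fin n → Fin n → F := fun k l => Z.left (I'.erase k) (m + 1) (J'.erase l) with hM
  set μ : Fin n → Mer n := fun k => (kernelR P n).S (I'.erase k) {k} with hμ
  set ν : Fin n → Mer n := fun l => (kernelL P n).S (J'.erase l) {l} with hν
  -- Expansions of the minors of size `d - 1` in which the minors `M k l` occur.
  have F1 : ∀ k ∈ I', Z.lam ((kernelL P n).S (I'.erase k) {a}) * Z.left (I.erase k) m J'
      = ∑ l ∈ J', Z.rho (ν l) * (M k l * Z.entry a l m) := by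
    intro k hk
    have hak : a ∈ I.erase k := Finset.mem_erase.mpr ⟨fun h => haI (h ▸ hk), ha⟩
    have h := Z.left_expand hak m J'
    rwa [Finset.erase_right_comm] at h
  have F1' : ∀ k ∈ I', Z.lam ((kernelL P n).S (I'.erase k) {k}) * Z.left I' m J'
      = ∑ l ∈ J', Z.rho (ν l) * (M k l * Z.entry k l m) := fun k hk => Z.left_expand hk m J'
  have F2 : ∀ l ∈ J', Z.rho ((kernelR P n).S (J'.erase l) {b}) * Z.left I' (m + 1) (J.erase l)
      = ∑ k ∈ I', Z.lam (μ k) * (M k l * Z.entry k b N) := by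
    intro l hl
    have hlJ : l ∈ J := Finset.mem_of_mem_erase hl
    have hbl : b ∈ J.erase l := Finset.mem_erase.mpr ⟨fun h => hbJ (h ▸ hl), hb⟩
    have hc : (J.erase l).card = d - 1 := by rw [Finset.card_erase_of_mem hlJ, hJ]
    have h := Z.right_expand hbl (m + 1) I'
    rw [← ih (d - 1) (by omega) _ _ _ hIc hc, Finset.erase_right_comm, hc, hd1,
      show m + 1 + ((d : ℤ) - 1) - 1 = N by rw [hN]; ring] at h
    rw [h]
    refine Finset.sum_congr rfl fun k hk => ?_
    rw [← ih (d - 1 - 1) (by omega) _ _ _ (by rw [Finset.card_erase_of_mem hk, hIc])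
      (by rw [Finset.card_erase_of_mem hl, hJc])]
  have F2' : ∀ l ∈ J', Z.rho ((kernelR P n).S (J'.erase l) {l}) * Z.left I' (m + 1) J'
      = ∑ k ∈ I', Z.lam (μ k) * (M k l * Z.entry k l N) := by
    intro l hl
    have h := Z.right_expand hl (m + 1) I'
    rw [← ih (d - 1) (by omega) _ _ _ hIc hJc, hJc, hd1,
      show m + 1 + ((d : ℤ) - 1) - 1 = N by rw [hN]; ring] at h
    rw [h]
    refine Finset.sum_congr rfl fun k hk => ?_
    rw [← ih (d - 1 - 1) (by omega) _ _ _ (by rw [Finset.card_erase_of_mem hk, hIc])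
      (by rw [Finset.card_erase_of_mem hl, hJc])]
  have expR : Z.rho ((kernelR P n).S J' {b}) * Z.right I m J = ∑ k ∈ I,
      Z.lam ((kernelR P n).S (I.erase k) {k}) * (Z.left (I.erase k) m J' * Z.entry k b N) := by
    have h := Z.right_expand hb m I
    rw [hJ] at h
    rw [h]
    refine Finset.sum_congr rfl fun k hk => ?_
    rw [ih (d - 1) (by omega) _ _ _ (by rw [Finset.card_erase_of_mem hk, hI]) hJc]
  have expL := Z.left_expand ha m J
  have hsI : ∀ k ∈ I', ∀ i ∈ I'.erase k, i ≠ a ∧ i ≠ k := fun k _ i hi =>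
    ⟨fun h => haI (h ▸ Finset.mem_of_mem_erase hi), Finset.ne_of_mem_erase hi⟩
  have hsJ : ∀ l ∈ J', ∀ j ∈ J'.erase l, j ≠ b ∧ j ≠ l := fun l _ j hj =>
    ⟨fun h => hbJ (h ▸ Finset.mem_of_mem_erase hj), Finset.ne_of_mem_erase hj⟩
  -- The two evaluations of the sum of RLL relations.
  have key : ∀ k ∈ I', ∀ l ∈ J',
      Z.lam (μ k * alphaReg P u a k) * (Z.rho (ν l) * (M k l * Z.entry a l m)) * Z.entry k b N
        + Z.lam (μ k * betaReg P u a k) * (Z.rho (ν l) * (M k l * Z.entry k l m)) * Z.entry a b N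
      = Z.rho (ν l * alphaReg P u l b) * (Z.lam (μ k) * (M k l * Z.entry k b N)) * Z.entry a l m
        + Z.rho (ν l * betaReg P u b l) * (Z.lam (μ k) * (M k l * Z.entry k l N)) *
          Z.entry a b m := by
    intro k hk l hl
    have hr := Z.rll_of_ne (a := a) (c := k) (b := l) (d := b) (fun h => haI (h ▸ hk))
      (fun h => hbJ (h ▸ hl)) m N
    rw [← hu] at hr
    have hr' := congrArg (fun x => Z.lam (μ k) * (Z.rho (ν l) * (M k l * x))) hr
    simp only [mul_add, ← mul_assoc (M k l)] at hr'
    rw [← Z.lam_left fun i hi => shift_alphaReg P u (hsI k hk i hi).1 (hsI k hk i hi).2,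
      ← Z.lam_left fun i hi => shift_betaReg P u (hsI k hk i hi).1 (hsI k hk i hi).2,
      ← Z.rho_left fun j hj => shift_alphaReg P u (hsJ l hl j hj).2 (hsJ l hl j hj).1,
      ← Z.rho_left fun j hj => shift_betaReg P u (hsJ l hl j hj).1 (hsJ l hl j hj).2] at hr'
    simp only [mul_assoc, map_mul] at hr' ⊢
    simp only [← Z.lam_rho_left] at hr' ⊢
    exact hr'
  have hsum := Finset.sum_congr rfl fun k hk => Finset.sum_congr rfl (key k hk)
  have hlhs : ∑ k ∈ I', ∑ l ∈ J',
      (Z.lam (μ k * alphaReg P u a k) * (Z.rho (ν l) * (M k l * Z.entry a l m)) * Z.entry k b N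
        + Z.lam (μ k * betaReg P u a k) * (Z.rho (ν l) * (M k l * Z.entry k l m)) * Z.entry a b N)
      = Z.lam (ellMer P (u : Entire n) * (kernelL P n).S I' {a}) *
        (Z.rho ((kernelR P n).S J' {b}) * Z.right I m J) := by
    simp only [Finset.sum_add_distrib, ← Finset.sum_mul, ← Finset.mul_sum]
    rw [expR, ← Finset.add_sum_erase I _ ha, add_comm, mul_add, Finset.mul_sum]
    congr 1
    · rw [Finset.sum_congr rfl fun k hk => by rw [← F1' k hk, ← mul_assoc, ← map_mul],
        ← Finset.sum_mul, ← map_sum, sum_S_mul_betaReg P haI u huI, ← hI', map_mul, mul_assoc,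
        mul_assoc]
    · refine Finset.sum_congr rfl fun k hk => ?_
      rw [← F1 k hk, ← mul_assoc, ← map_mul, S_mul_alphaReg_row P u haI hk, hIi, map_mul, mul_assoc,
        mul_assoc]
  have hrhs : ∑ k ∈ I', ∑ l ∈ J',
      (Z.rho (ν l * alphaReg P u l b) * (Z.lam (μ k) * (M k l * Z.entry k b N)) * Z.entry a l m
        + Z.rho (ν l * betaReg P u b l) * (Z.lam (μ k) * (M k l * Z.entry k l N)) *
          Z.entry a b m)
      = Z.rho (ellMer P (u : Entire n) * (kernelR P n).S J' {b}) *
        (Z.lam ((kernelL P n).S I' {a}) * Z.left I m J) := by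
    rw [Finset.sum_comm]
    simp only [Finset.sum_add_distrib, ← Finset.sum_mul, ← Finset.mul_sum]
    rw [expL, ← Finset.add_sum_erase J _ hb, add_comm, mul_add, Finset.mul_sum]
    have hβ : ∑ l ∈ J', ν l * betaReg P u b l * (kernelR P n).S (J'.erase l) {l}
        = ellMer P (u : Entire n) * (kernelR P n).S J' {b} * (kernelL P n).S J' {b} := by
      rw [mul_right_comm, ← sum_S_mul_betaReg P hbJ u huJ]
      exact Finset.sum_congr rfl fun l _ => by rw [hν]; ring
    congr 1
    · rw [Finset.sum_congr rfl fun l hl => by rw [← F2' l hl, ← mul_assoc, ← map_mul],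
        ← Finset.sum_mul, ← map_sum, hβ, ← hJ', map_mul, mul_assoc, mul_assoc]
    · refine Finset.sum_congr rfl fun l hl => ?_
      rw [← F2 l hl, ← mul_assoc, ← map_mul, S_mul_alphaReg_col P u hbJ hl, hJi, map_mul, mul_assoc,
        mul_assoc]
  rw [hlhs, hrhs, map_mul, map_mul, Z.lam_const, mul_assoc, mul_assoc] at hsum
  have h1 := Z.rho_cancel (ellMer_intCast_ne_zero P hu0) hsum
  rw [Z.lam_rho_left] at h1
  have h2 := Z.rho_cancel ((kernelR P n).S_ne_zero (Finset.disjoint_singleton_right.mpr hbJ)) h1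
  exact (Z.lam_cancel ((kernelL P n).S_ne_zero (Finset.disjoint_singleton_right.mpr haI)) h2).symm

end RLLSystem
end LeftRight

/-! ### The algebra `F_ell(M(n))` -/

section Fell

variable (P : Params) {n : ℕ}

/-- The left moment map as a ring homomorphism. -/
noncomputable def muLHom : Mer n →+* Fell P n where
  toFun := muL P
  map_one' := by
    have h := RingQuot.mkAlgHom_rel ℂ (FRel.lam_const (P := P) (n := n) 1)
    rw [map_one] at h
    exact h.trans (by rw [map_one, map_one])
  map_zero' := by
    have h := RingQuot.mkAlgHom_rel ℂ (FRel.lam_const (P := P) (n := n) 0)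
    rw [map_zero] at h
    exact h.trans (by rw [map_zero, map_zero])
  map_mul' f g := (RingQuot.mkAlgHom_rel ℂ (FRel.lam_mul (P := P) f g)).trans (map_mul _ _ _)
  map_add' f g := (RingQuot.mkAlgHom_rel ℂ (FRel.lam_add (P := P) f g)).trans (map_add _ _ _)

/-- The right moment map as a ring homomorphism. -/
noncomputable def muRHom : Mer n →+* Fell P n where
  toFun := muR P
  map_one' := by
    have h := RingQuot.mkAlgHom_rel ℂ (FRel.rho_const (P := P) (n := n) 1)
    rw [map_one] at h
    exact h.trans (by rw [map_one, map_one])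
  map_zero' := by
    have h := RingQuot.mkAlgHom_rel ℂ (FRel.rho_const (P := P) (n := n) 0)
    rw [map_zero] at h
    exact h.trans (by rw [map_zero, map_zero])
  map_mul' f g := (RingQuot.mkAlgHom_rel ℂ (FRel.rho_mul (P := P) f g)).trans (map_mul _ _ _)
  map_add' f g := (RingQuot.mkAlgHom_rel ℂ (FRel.rho_add (P := P) f g)).trans (map_add _ _ _)

theorem muL_muR (f g : Mer n) : muL P f * muR P g = muR P g * muL P f := by
  have h := RingQuot.mkAlgHom_rel ℂ (FRel.lam_rho (P := P) f g)
  rwa [map_mul, map_mul] at h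

theorem muL_e (f : Mer n) (i j : Fin n) (z : ℂˣ) :
    muL P f * e P i j z = e P i j z * muL P (shift (weight i) f) := by
  have h := RingQuot.mkAlgHom_rel ℂ (FRel.lam_e (P := P) f i j z)
  rwa [map_mul, map_mul] at h

theorem muR_e (f : Mer n) (i j : Fin n) (z : ℂˣ) :
    muR P f * e P i j z = e P i j z * muR P (shift (weight j) f) := by
  have h := RingQuot.mkAlgHom_rel ℂ (FRel.rho_e (P := P) f i j z)
  rwa [map_mul, map_mul] at h

/-- The spectral parameter `q ^ (2 k) z`, for an integer `k`. -/
noncomputable def qzInt (k : ℤ) (z : ℂˣ) : ℂˣ := P.qUnit ^ (2 * k) * z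

theorem qzInt_natCast (k : ℕ) (z : ℂˣ) : qzInt P k z = qz P k z := by
  rw [qzInt, qz]
  norm_cast

theorem qzInt_qzInt (k l : ℤ) (z : ℂˣ) : qzInt P k (qzInt P l z) = qzInt P (k + l) z := by
  rw [qzInt, qzInt, qzInt, mul_add, zpow_add, mul_assoc]

theorem qzInt_zero (z : ℂˣ) : qzInt P 0 z = z := by simp [qzInt]

theorem qzInt_div (k l : ℤ) (z : ℂˣ) :
    ((qzInt P k z / qzInt P l z : ℂˣ) : ℂ) = (P.q : ℂ) ^ (2 * (k - l)) := by
  rw [qzInt, qzInt, mul_div_mul_right_eq_div, div_eq_mul_inv, ← zpow_sub, ← mul_sub,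
    Units.val_zpow_eq_zpow_val]
  rfl

/-- The regularized RLL relations between two points of a geometric progression. -/
theorem rll (a b c d : Fin n) (k l : ℤ) (z : ℂˣ) :
    ∑ x, ∑ y, muL P (Rreg P (k - l) a c x y) * e P x b (qzInt P k z) * e P y d (qzInt P l z)
      = ∑ x, ∑ y, muR P (Rreg P (k - l) x y b d) * e P c y (qzInt P l z) *
          e P a x (qzInt P k z) := by
  have h := RingQuot.mkAlgHom_rel ℂ (FRel.rll (P := P) (regFactor P (k - l))
    (regFactor_meromorphicOn P _) a b c d (qzInt P k z) (qzInt P l z)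
    (fun x y => Rreg P (k - l) a c x y) (fun x y => Rreg P (k - l) x y b d)
    (fun x y => by rw [qzInt_div]; exact isSpectralLimit_Rmat P _ a c x y)
    (fun x y => by rw [qzInt_div]; exact isSpectralLimit_Rmat P _ x y b d))
  simp only [map_sum, map_mul] at h
  exact h

theorem muL_ellMer_intCast (u : ℤ) :
    muL P (ellMer P (u : Entire n)) = algebraMap ℂ (Fell P n) (ellE P u) := by
  rw [ellMer_intCast, ← IsScalarTower.algebraMap_apply]
  exact (RingQuot.mkAlgHom_rel ℂ (FRel.lam_const (P := P) (n := n) (ellE P u))).trans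
    (AlgHom.commutes _ _)

theorem muR_ellMer_intCast (u : ℤ) :
    muR P (ellMer P (u : Entire n)) = algebraMap ℂ (Fell P n) (ellE P u) := by
  rw [ellMer_intCast, ← IsScalarTower.algebraMap_apply]
  exact (RingQuot.mkAlgHom_rel ℂ (FRel.rho_const (P := P) (n := n) (ellE P u))).trans
    (AlgHom.commutes _ _)


end Fell

/-! ### Laplace expansions of the elliptic minors -/

/-- A sum over the subsets of `J` as a sum over all coverings of `J`, the structure function being
zero on overlapping pairs. -/
theorem sum_powerset_eq_sum_cover {ι M : Type*} [Fintype ι] [DecidableEq ι] [AddCommMonoid M]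
    (J : Finset ι) {f : Finset ι → Finset ι → M} (hf : ∀ K L, ¬ Disjoint K L → f K L = 0) :
    ∑ L ∈ J.powerset, f L (J \ L)
      = ∑ K ∈ (Finset.univ : Finset (Finset ι × Finset ι)).filter (fun K => K.1 ∪ K.2 = J),
        f K.1 K.2 := by
  have hsub : J.powerset.image (fun L => (L, J \ L)) ⊆
      (Finset.univ : Finset (Finset ι × Finset ι)).filter (fun K => K.1 ∪ K.2 = J) := by
    intro K hK
    obtain ⟨L, hL, rfl⟩ := Finset.mem_image.mp hK
    exact Finset.mem_filter.mpr ⟨Finset.mem_univ _,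
      Finset.union_sdiff_of_subset (Finset.mem_powerset.mp hL)⟩
  rw [← Finset.sum_subset hsub, Finset.sum_image]
  · exact fun L _ L' _ h => congrArg Prod.fst h
  · rintro ⟨K, L⟩ hK hK'
    refine hf K L fun hd => hK' (Finset.mem_image.mpr ⟨K, ?_, ?_⟩)
    · exact Finset.mem_powerset.mpr ((Finset.mem_filter.mp hK).2 ▸ Finset.subset_union_left)
    · have h : K ∪ L = J := (Finset.mem_filter.mp hK).2
      rw [← h, Finset.union_sdiff_cancel_left hd]

section Expansions

variable (P : Params) {n : ℕ}

/-- The generators of `F_ell(M(n))` along the progression `q ^ (2 k) z`. -/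
noncomputable def rllSystem (z : ℂˣ) : RLLSystem P n (Fell P n) where
  lam := muLHom P
  rho := muRHom P
  entry a b k := e P a b (qzInt P k z)
  lam_rho := muL_muR P
  lam_entry f a b _ := muL_e P f a b _
  rho_entry f a b _ := muR_e P f a b _
  lam_const u := (muL_ellMer_intCast P u).trans (muR_ellMer_intCast P u).symm
  rll a b c d k l := rll P a b c d k l z

namespace RLLSystem

variable {P} {F : Type*} [Ring F] (Z : RLLSystem P n F)

/-- The expansion of the left minor over the permutations of its columns. -/
theorem left_eq_sum {I J : Finset (Fin n)} (h : J.card = I.card) :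
    Z.left I 0 J = Z.lam (normLow P I)⁻¹ * Z.rho (normLow P J) *
      ∑ τ ∈ permsOf J, Z.rho (sgnLow P J τ) *
        (List.ofFn fun k : Fin I.card =>
          Z.entry (I.orderEmbOfFin rfl k.rev) (τ (J.orderEmbOfFin h k.rev)) (k.rev : ℕ)).prod := by
  have h1 := Z.systemL.minor_eq_sum (nodup_descList I) 0 J
  rw [toFinset_descList] at h1
  rw [left, h1, pairProd_descList_eq_normLow, mul_assoc,
    sum_arrangements (nodup_descList J) (toFinset_descList J)]
  simp only [Finset.mul_sum]
  refine Finset.sum_congr rfl fun τ hτ => ?_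
  rw [← normLow_mul_sgnLow P hτ, descList_eq h, descList, List.map_ofFn,
    MatrixSystem.entryWord_ofFn, ← mul_assoc (Z.rho _), ← map_mul]
  simp only [zero_add]
  rfl

/-- The expansion of the right minor over the permutations of its rows. -/
theorem right_eq_sum {I J : Finset (Fin n)} (h : J.card = I.card) :
    Z.right I 0 J = Z.lam (normUp P I)⁻¹ * Z.rho (normUp P J) *
      ∑ σ ∈ permsOf I, Z.lam (sgnUp P I σ)⁻¹ *
        (List.ofFn fun k : Fin I.card =>
          Z.entry (σ (I.orderEmbOfFin rfl k)) (J.orderEmbOfFin h k) (k : ℕ)).prod := by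
  have h1 := Z.systemR.minor_eq_sum (nodup_ascList J) (1 - J.card - 0) I
  rw [toFinset_ascList] at h1
  rw [right, h1, pairProd_ascList_eq_normUp_inv, inv_inv, Z.lam_rho, mul_assoc,
    sum_arrangements (nodup_ascList I) (toFinset_ascList I)]
  simp only [Finset.mul_sum]
  refine Finset.sum_congr rfl fun σ hσ => ?_
  rw [← normUp_inv_mul_sgnUp_inv P hσ, ascList_eq h, ascList, List.map_ofFn,
    MatrixSystem.entryWord_ofFn, ← mul_assoc (Z.lam _), ← map_mul]
  have hk : ∀ k : Fin I.card, -(1 - (J.card : ℤ) - 0 + (k.rev : ℕ)) = (k : ℕ) := fun k => by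
    have := k.2
    rw [Fin.val_rev, h]
    omega
  congr 4
  funext k
  change Z.entry _ _ (-(1 - (J.card : ℤ) - 0 + (k.rev : ℕ))) = _
  rw [hk]
  rfl

theorem left_of_card_ne {I J : Finset (Fin n)} (h : I.card ≠ J.card) (m : ℤ) : Z.left I m J = 0 :=
  Z.systemL.minor_of_card_ne h m

theorem right_of_card_ne {I J : Finset (Fin n)} (h : I.card ≠ J.card) (m : ℤ) :
    Z.right I m J = 0 :=
  Z.systemR.minor_of_card_ne h.symm _

theorem left_eq_right (I J : Finset (Fin n)) (m : ℤ) : Z.left I m J = Z.right I m J := by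
  by_cases h : I.card = J.card
  · exact Z.left_eq_right_of_card _ I J m rfl h.symm
  · rw [Z.left_of_card_ne h, Z.right_of_card_ne h]

/-- Laplace expansion with respect to rows. -/
theorem left_laplace (I₁ I₂ J : Finset (Fin n)) :
    Z.lam (Sl P I₁ I₂) * Z.left (I₁ ∪ I₂) 0 J =
      ∑ K ∈ (Finset.univ : Finset (Finset (Fin n) × Finset (Fin n))).filter
          (fun K => K.1 ∪ K.2 = J),
        Z.rho (Sl P K.1 K.2) * Z.left I₁ I₂.card K.1 * Z.left I₂ 0 K.2 := by
  have h := Z.systemL.row_S_mul_minor I₁ I₂ 0 J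
  simp only [kernelL_S, zero_add] at h
  rw [sum_powerset_eq_sum_cover J
    (f := fun K L => Z.systemL.col (Sl P K L) *
      (Z.systemL.minor I₁ I₂.card K * Z.systemL.minor I₂ 0 L))] at h
  · simp only [← mul_assoc] at h
    exact h
  · intro K L hKL
    rw [Sl, if_neg hKL, map_zero, zero_mul]

/-- Laplace expansion with respect to columns. -/
theorem right_laplace (J₁ J₂ I : Finset (Fin n)) :
    Z.rho (Sr P J₁ J₂) * Z.right I 0 (J₁ ∪ J₂) =
      ∑ K ∈ (Finset.univ : Finset (Finset (Fin n) × Finset (Fin n))).filter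
          (fun K => K.1 ∪ K.2 = I),
        Z.lam (Sr P K.1 K.2) * Z.right K.1 0 J₁ * Z.right K.2 J₁.card J₂ := by
  have h := Z.systemR.row_S_mul_minor J₁ J₂ (1 - J₂.card - J₁.card) I
  simp only [kernelR_S] at h
  rw [sum_powerset_eq_sum_cover I
    (f := fun K L => Z.systemR.col (Sr P K L) *
      (Z.systemR.minor J₁ (1 - J₂.card - J₁.card + J₂.card) K *
        Z.systemR.minor J₂ (1 - J₂.card - J₁.card) L))
    (fun K L hKL => by rw [Sr, if_neg hKL, map_zero, zero_mul]),
    show (1 : ℤ) - J₂.card - J₁.card + J₂.card = 1 - J₁.card - 0 by ring] at h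
  simp only [← mul_assoc] at h
  -- For overlapping sets the structure function is zero, and the size of the union is irrelevant.
  have hL : Z.rho (Sr P J₁ J₂) * Z.right I 0 (J₁ ∪ J₂) = Z.systemR.row (Sr P J₁ J₂) *
      Z.systemR.minor (J₁ ∪ J₂) (1 - J₂.card - J₁.card) I := by
    by_cases hd : Disjoint J₁ J₂
    · rw [right, Finset.card_union_of_disjoint hd, show (1 : ℤ) - (J₁.card + J₂.card : ℕ) - 0
        = 1 - J₂.card - J₁.card by push_cast; ring]
      rfl
    · rw [Sr, if_neg hd, map_zero, map_zero, zero_mul, zero_mul]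
  exact hL.trans h

end RLLSystem

theorem leftMinor_eq_left (I J : Finset (Fin n)) (z : ℂˣ) :
    leftMinor P I J z = (rllSystem P z).left I 0 J := by
  rw [leftMinor]
  split_ifs with h
  · rw [RLLSystem.left_eq_sum _ h]
    change _ = muL P _ * muR P _ * ∑ τ ∈ permsOf J, muR P _ *
      (List.ofFn fun k : Fin I.card => e P _ _ (qzInt P ((k.rev : ℕ) : ℤ) z)).prod
    simp only [qzInt_natCast]
  · exact (RLLSystem.left_of_card_ne _ (Ne.symm h) 0).symm

theorem rightMinor_eq_right (I J : Finset (Fin n)) (z : ℂˣ) :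
    rightMinor P I J z = (rllSystem P z).right I 0 J := by
  rw [rightMinor]
  split_ifs with h
  · rw [RLLSystem.right_eq_sum _ h]
    change _ = muL P _ * muR P _ * ∑ σ ∈ permsOf I, muL P _ *
      (List.ofFn fun k : Fin I.card => e P _ _ (qzInt P ((k : ℕ) : ℤ) z)).prod
    simp only [qzInt_natCast]
  · exact (RLLSystem.right_of_card_ne _ (Ne.symm h) 0).symm

theorem leftMinor_eq_rightMinor (I J : Finset (Fin n)) (z : ℂˣ) :
    leftMinor P I J z = rightMinor P I J z := by
  rw [leftMinor_eq_left, rightMinor_eq_right]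
  exact RLLSystem.left_eq_right _ I J 0

theorem leftMinor_qz (I J : Finset (Fin n)) (m : ℕ) (z : ℂˣ) :
    leftMinor P I J (qz P m z) = (rllSystem P z).left I m J := by
  rw [leftMinor_eq_left]
  refine (MatrixSystem.minor_shift (rllSystem P z).systemL (Y' := (rllSystem P (qz P m z)).systemL)
    (c := m) rfl rfl (fun a b k => ?_) I 0 J).trans (by rw [zero_add]; rfl)
  change e P a b (qzInt P k (qz P m z)) = e P a b (qzInt P (k + m) z)
  rw [← qzInt_natCast P m, qzInt_qzInt]

theorem leftMinor_laplace_rows (I₁ I₂ J : Finset (Fin n)) (z : ℂˣ) :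
    muL P (Sl P I₁ I₂) * leftMinor P (I₁ ∪ I₂) J z =
      ∑ K ∈ (Finset.univ : Finset (Finset (Fin n) × Finset (Fin n))).filter
          (fun K => K.1 ∪ K.2 = J),
        muR P (Sl P K.1 K.2) * leftMinor P I₁ K.1 (qz P I₂.card z) * leftMinor P I₂ K.2 z := by
  simp only [leftMinor_qz]
  simp only [leftMinor_eq_left]
  exact (rllSystem P z).left_laplace I₁ I₂ J

theorem leftMinor_laplace_columns (J₁ J₂ I : Finset (Fin n)) (z : ℂˣ) :
    muR P (Sr P J₁ J₂) * leftMinor P I (J₁ ∪ J₂) z =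
      ∑ K ∈ (Finset.univ : Finset (Finset (Fin n) × Finset (Fin n))).filter
          (fun K => K.1 ∪ K.2 = I),
        muL P (Sr P K.1 K.2) * leftMinor P K.1 J₁ z *
          leftMinor P K.2 J₂ (qz P J₁.card z) := by
  simp only [leftMinor_qz]
  simp only [leftMinor_eq_left, RLLSystem.left_eq_right]
  exact (rllSystem P z).right_laplace J₁ J₂ I

end Expansions

/-! ### The exterior algebras as exterior systems -/

theorem ExteriorSystem.scal_S_mul_of_not_disjoint {ι K A : Type*} [Field K] [Ring A]
    [DecidableEq ι] {κ : DynKernel ι K} (X : ExteriorSystem κ A) {I J : Finset ι}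
    (h : ¬ Disjoint I J) (x : A) : X.scal (κ.S I J) * x = 0 := by
  rw [DynKernel.S, if_neg h, map_zero, zero_mul]

section Exterior

variable (P : Params) {n : ℕ}

theorem Edyn_neg_one (i j : Fin n) : Edyn P i j (-1) = -Edyn P j i 1 := by
  rw [Edyn_eq_ellMer, Edyn_eq_ellMer, ← ellMer_neg, coordEntire_swap i j]
  congr 1
  rw [map_neg, map_one]
  ring

theorem ellMer_one_ne_zero : ellMer P (1 : Entire n) ≠ 0 := by
  have h := ellMer_intCast_ne_zero P (n := n) one_ne_zero
  rwa [Int.cast_one] at h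

theorem Edyn_mul_alphaReg_one {i j : Fin n} (hij : i ≠ j) :
    Edyn P i j 0 / ellMer P 1 * alphaReg P 1 i j = Edyn P i j 1 := by
  have h1 := Edyn_ne_zero P hij 0
  have h2 := ellMer_one_ne_zero P (n := n)
  rw [alphaReg, Int.cast_one]
  field_simp

theorem Edyn_mul_betaReg_one {i j : Fin n} (hij : i ≠ j) :
    Edyn P i j 0 / ellMer P 1 * betaReg P 1 i j = -Edyn P j i 1 := by
  have h1 := Edyn_ne_zero P hij 0
  have h2 := ellMer_one_ne_zero P (n := n)
  rw [betaReg, Int.cast_one, Edyn_neg_one]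
  field_simp

theorem betaReg_one_swap (i j : Fin n) : betaReg P 1 i j = alphaReg P 1 j i := by
  rw [betaReg, alphaReg, Int.cast_one, Int.cast_one, Edyn_neg_one, Edyn_swap P j i, mul_neg,
    neg_div_neg_eq]

theorem inv_mul_alphaReg_one {i j : Fin n} (hij : i ≠ j) :
    (ellMer P 1 * Edyn P i j 1)⁻¹ * alphaReg P 1 i j = (Edyn P i j 0)⁻¹ := by
  have h1 := Edyn_ne_zero P hij 0
  have h2 := Edyn_ne_zero P hij 1
  have h3 := ellMer_one_ne_zero P (n := n)
  rw [alphaReg, Int.cast_one]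
  field_simp

/-- `f ↦ f(ζ)` as a homomorphism to the left exterior algebra. -/
noncomputable def scalLHom : Mer n →+* ExtL P n where
  toFun := scalL P
  map_one' := by
    have h := RingQuot.mkAlgHom_rel ℂ (LRel.scal_const (P := P) (n := n) 1)
    rw [map_one] at h
    exact h.trans (by rw [map_one, map_one])
  map_zero' := by
    have h := RingQuot.mkAlgHom_rel ℂ (LRel.scal_const (P := P) (n := n) 0)
    rw [map_zero] at h
    exact h.trans (by rw [map_zero, map_zero])
  map_mul' f g := (RingQuot.mkAlgHom_rel ℂ (LRel.scal_mul (P := P) f g)).trans (map_mul _ _ _)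
  map_add' f g := (RingQuot.mkAlgHom_rel ℂ (LRel.scal_add (P := P) f g)).trans (map_add _ _ _)

/-- `f ↦ f(ζ)` as a homomorphism to the right exterior algebra. -/
noncomputable def scalRHom : Mer n →+* ExtR P n where
  toFun := scalR P
  map_one' := by
    have h := RingQuot.mkAlgHom_rel ℂ (RRel.scal_const (P := P) (n := n) 1)
    rw [map_one] at h
    exact h.trans (by rw [map_one, map_one])
  map_zero' := by
    have h := RingQuot.mkAlgHom_rel ℂ (RRel.scal_const (P := P) (n := n) 0)
    rw [map_zero] at h
    exact h.trans (by rw [map_zero, map_zero])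
  map_mul' f g := (RingQuot.mkAlgHom_rel ℂ (RRel.scal_mul (P := P) f g)).trans (map_mul _ _ _)
  map_add' f g := (RingQuot.mkAlgHom_rel ℂ (RRel.scal_add (P := P) f g)).trans (map_add _ _ _)

theorem eq_of_add_eq_zero {A : Type*} [Ring A] (sc : Mer n →+* A) {r s a b c : Mer n} {x y : A}
    (h : sc r * x + sc s * y = 0) (ha : c * r = a) (hb : c * s = -b) : sc a * x = sc b * y := by
  have h1 := congrArg (sc c * ·) h
  simp only [mul_add, ← mul_assoc, ← map_mul, ha, hb, map_neg, neg_mul, mul_zero] at h1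
  exact eq_of_sub_eq_zero ((sub_eq_add_neg _ _).trans h1)

/-- The relations of the left exterior algebra, in terms of the regularized coefficients. -/
noncomputable def exteriorSystemL {A : Type*} [Ring A] (sc : Mer n →+* A) (g : Fin n → ℤ → A)
    (scal_gen : ∀ f i k, sc f * g i k = g i k * sc (shift (weight i) f))
    (gen_sq : ∀ i k, g i (k + 1) * g i k = 0)
    (cross : ∀ i j, i ≠ j → ∀ k, sc (alphaReg P 1 i j) * (g i (k + 1) * g j k)
      + sc (betaReg P 1 i j) * (g j (k + 1) * g i k) = 0) : ExteriorSystem (kernelL P n) A where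
  scal := sc
  gen := g
  scal_gen := scal_gen
  gen_sq := gen_sq
  gen_swap i j hij k := eq_of_add_eq_zero sc (cross i j hij k) (Edyn_mul_alphaReg_one P hij)
    (Edyn_mul_betaReg_one P hij)

/-- The relations of the right exterior algebra, in terms of the regularized coefficients. -/
noncomputable def exteriorSystemR {A : Type*} [Ring A] (sc : Mer n →+* A) (g : Fin n → ℤ → A)
    (scal_gen : ∀ f i k, sc f * g i k = g i k * sc (shift (weight i) f))
    (gen_sq : ∀ i k, g i (k + 1) * g i k = 0)
    (cross : ∀ i j, i ≠ j → ∀ k, sc (alphaReg P 1 j i) * (g i (k + 1) * g j k)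
      + sc (betaReg P 1 i j) * (g j (k + 1) * g i k) = 0) : ExteriorSystem (kernelR P n) A where
  scal := sc
  gen := g
  scal_gen := scal_gen
  gen_sq := gen_sq
  gen_swap i j hij k := eq_of_add_eq_zero sc (cross i j hij k) (inv_mul_alphaReg_one P hij.symm)
    (by rw [betaReg_one_swap, inv_mul_alphaReg_one P hij.symm, Edyn_swap P i j, inv_neg]; rfl)

theorem scalL_v (f : Mer n) (i : Fin n) (z : ℂˣ) :
    scalL P f * v P i z = v P i z * scalL P (shift (weight i) f) := by
  have h := RingQuot.mkAlgHom_rel ℂ (LRel.scal_v (P := P) f i z)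
  rwa [map_mul, map_mul] at h

theorem scalR_w (f : Mer n) (i : Fin n) (z : ℂˣ) :
    scalR P f * w P i z = w P i z * scalR P (shift (weight i) f) := by
  have h := RingQuot.mkAlgHom_rel ℂ (RRel.scal_v (P := P) f i z)
  rwa [map_mul, map_mul] at h

theorem v_mul_v_self (i : Fin n) (z u : ℂˣ) : v P i z * v P i u = 0 := by
  have h := RingQuot.mkAlgHom_rel ℂ (LRel.sq (P := P) i z u)
  rwa [map_mul, map_zero] at h

theorem w_mul_w_self (i : Fin n) (z u : ℂˣ) : w P i z * w P i u = 0 := by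
  have h := RingQuot.mkAlgHom_rel ℂ (RRel.sq (P := P) i z u)
  rwa [map_mul, map_zero] at h

theorem v_cross {i j : Fin n} (hij : i ≠ j) {z u : ℂˣ}
    (hz : ((z / u : ℂˣ) : ℂ) = (P.q : ℂ) ^ (2 * (1 : ℤ))) :
    scalL P (alphaReg P 1 i j) * (v P i z * v P j u)
      + scalL P (betaReg P 1 i j) * (v P j z * v P i u) = 0 := by
  have h := RingQuot.mkAlgHom_rel ℂ (LRel.cross (P := P) (regFactor P 1)
    (regFactor_meromorphicOn P 1) i j hij z u (alphaReg P 1 i j) (betaReg P 1 i j)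
    (by rw [hz]; exact isSpectralLimit_alpha P 1 hij)
    (by rw [hz]; exact isSpectralLimit_beta P 1 hij))
  rwa [map_add, map_mul, map_mul, map_mul, map_mul, map_zero, mul_assoc, mul_assoc] at h

theorem w_cross {i j : Fin n} (hij : i ≠ j) {z u : ℂˣ}
    (hz : ((z / u : ℂˣ) : ℂ) = (P.q : ℂ) ^ (2 * (1 : ℤ))) :
    scalR P (alphaReg P 1 i j) * (w P j u * w P i z)
      + scalR P (betaReg P 1 j i) * (w P i u * w P j z) = 0 := by
  have h := RingQuot.mkAlgHom_rel ℂ (RRel.cross (P := P) (regFactor P 1)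
    (regFactor_meromorphicOn P 1) i j hij z u (alphaReg P 1 i j) (betaReg P 1 j i)
    (by rw [hz]; exact isSpectralLimit_alpha P 1 hij)
    (by rw [hz]; exact isSpectralLimit_beta P 1 hij.symm))
  rwa [map_add, map_mul, map_mul, map_mul, map_mul, map_zero, mul_assoc, mul_assoc] at h

/-- The left exterior algebra along the progression `q ^ (2 k) z`. -/
noncomputable def extLSystem (z : ℂˣ) : ExteriorSystem (kernelL P n) (ExtL P n) :=
  exteriorSystemL P (scalLHom P) (fun i k => v P i (qzInt P k z)) (fun f i _ => scalL_v P f i _)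
    (fun i _ => v_mul_v_self P i _ _)
    (fun _ _ hij _ => v_cross P hij (by rw [qzInt_div, add_sub_cancel_left]))

/-- The right exterior algebra along the progression `q ^ (-2 k) z`. -/
noncomputable def extRSystem (z : ℂˣ) : ExteriorSystem (kernelR P n) (ExtR P n) :=
  exteriorSystemR P (scalRHom P) (fun i k => w P i (qzInt P (-k) z)) (fun f i _ => scalR_w P f i _)
    (fun i _ => w_mul_w_self P i _ _)
    (fun _ _ hij _ => w_cross P hij.symm (by rw [qzInt_div]; congr 1; ring))

theorem vSet_qzInt (I : Finset (Fin n)) (k : ℤ) (z : ℂˣ) :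
    vSet P I (qzInt P k z) = (extLSystem P z).mono (descList I) k := by
  rw [vSet, ExteriorSystem.mono, pairProd_descList_eq_normLow, descList,
    ExteriorSystem.word_ofFn]
  change _ = scalL P _ * (List.ofFn fun l : Fin I.card => v P _ (qzInt P (k + (l.rev : ℕ)) z)).prod
  simp only [← qzInt_natCast, qzInt_qzInt, add_comm k]

theorem wSet_qzInt (I : Finset (Fin n)) (k : ℤ) (z : ℂˣ) :
    wSet P I (qzInt P k z) = (extRSystem P z).mono (ascList I) (1 - I.card - k) := by
  rw [wSet, ExteriorSystem.mono, pairProd_ascList_eq_normUp_inv, inv_inv, ascList,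
    ExteriorSystem.word_ofFn]
  change _ = scalR P _ *
    (List.ofFn fun l : Fin I.card => w P _ (qzInt P (-(1 - I.card - k + (l.rev : ℕ))) z)).prod
  have hl : ∀ l : Fin I.card, -(1 - (I.card : ℤ) - k + (l.rev : ℕ)) = (l : ℕ) + k := fun l => by
    have := l.2
    rw [Fin.val_rev]
    omega
  simp only [← qzInt_natCast, qzInt_qzInt, hl]

theorem vSet_mul_vSet (I J : Finset (Fin n)) (z : ℂˣ) :
    vSet P I (qz P J.card z) * vSet P J z = scalL P (Sl P I J) * vSet P (I ∪ J) z := by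
  have h := (extLSystem P z).monoSet_mul_monoSet I J 0
  have hv : ∀ (I : Finset (Fin n)) (k : ℤ),
      (extLSystem P z).monoSet I k = vSet P I (qzInt P k z) := fun I k => by
    rw [vSet_qzInt, ExteriorSystem.mono_eq_monoSet _ (nodup_descList I), toFinset_descList]
  rw [hv, hv, hv, zero_add, qzInt_natCast, qzInt_zero, kernelL_S] at h
  exact h

theorem wSet_mul_wSet (I J : Finset (Fin n)) (z : ℂˣ) :
    wSet P I z * wSet P J (qz P I.card z) = scalR P (Sr P I J) * wSet P (I ∪ J) z := by
  have h := (extRSystem P z).monoSet_mul_monoSet I J (1 - J.card - I.card)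
  have hw : ∀ (I : Finset (Fin n)) (k : ℤ),
      (extRSystem P z).monoSet I (1 - I.card - k) = wSet P I (qzInt P k z) := fun I k => by
    rw [wSet_qzInt, ExteriorSystem.mono_eq_monoSet _ (nodup_ascList I), toFinset_ascList]
  rw [hw, qzInt_natCast, show (1 : ℤ) - J.card - I.card + J.card = 1 - I.card - 0 by ring, hw,
    qzInt_zero] at h
  rw [← kernelR_S]
  by_cases hd : Disjoint I J
  · rw [show (1 : ℤ) - J.card - I.card = 1 - (I ∪ J).card - 0 by
      rw [Finset.card_union_of_disjoint hd]; push_cast; ring, hw, qzInt_zero] at h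
    exact h
  · rw [(extRSystem P z).scal_S_mul_of_not_disjoint hd] at h
    exact h.trans ((extRSystem P z).scal_S_mul_of_not_disjoint hd _).symm

end Exterior

/-! ### The Fock representation of an exterior algebra -/

section Fock

variable {k ι K : Type*} [CommSemiring k] [Field K] [Algebra k K]

/-- The operators on families of scalars indexed by subsets. -/
abbrev FockEnd (k ι K : Type*) [CommSemiring k] [Field K] [Algebra k K] : Type _ :=
  Module.End k (Finset ι → K)

variable (k ι) in
/-- Multiplication by scalars on families indexed by subsets. -/
def fockScal : K →+* FockEnd k ι K where
  toFun f :=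
    { toFun := fun X J => f * X J
      map_add' := fun X Y => funext fun J => mul_add f (X J) (Y J)
      map_smul' := fun c X => funext fun J => mul_smul_comm c f (X J) }
  map_one' := LinearMap.ext fun X => funext fun J => one_mul (X J)
  map_zero' := LinearMap.ext fun X => funext fun J => zero_mul (X J)
  map_add' f g := LinearMap.ext fun X => funext fun J => add_mul f g (X J)
  map_mul' f g := LinearMap.ext fun X => funext fun J => mul_assoc f g (X J)

/-- The vector supported at the empty set. -/
def fockVac [DecidableEq ι] : Finset ι → K := fun J => if J = ∅ then 1 else 0

theorem fockScal_apply (f : K) (X : Finset ι → K) (J : Finset ι) :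
    fockScal k ι f X J = f * X J := rfl

theorem fockScal_const (c : k) :
    fockScal k ι (algebraMap k K c) = algebraMap k _ c :=
  LinearMap.ext fun X => funext fun J => (Algebra.smul_def c (X J)).symm

variable [DecidableEq ι]

open Classical in
/-- The operator that adds `i` to a subset `S` whose cardinality satisfies `p`, and kills the
other subsets. -/
noncomputable def fockGen (κ : DynKernel ι K) (σ : ι → K ≃ₐ[k] K) (i : ι) (p : ℕ → Prop) :
    FockEnd k ι K where
  toFun X J := if i ∈ J ∧ p (J.erase i).card then
    (∏ j ∈ J.erase i, κ.G i j) * (σ i).symm (X (J.erase i)) else 0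
  map_add' X Y := by
    funext J
    simp only [Pi.add_apply]
    split_ifs
    · rw [map_add, mul_add]
    · rw [add_zero]
  map_smul' c X := by
    funext J
    simp only [Pi.smul_apply, RingHom.id_apply]
    split_ifs
    · rw [map_smul, mul_smul_comm]
    · rw [smul_zero]

variable (κ : DynKernel ι K) (σ : ι → K ≃ₐ[k] K)

theorem fockGen_apply_of_mem {i : ι} {p : ℕ → Prop} {J : Finset ι} (hi : i ∈ J)
    (hp : p (J.erase i).card) (X : Finset ι → K) : fockGen κ σ i p X J
      = (∏ j ∈ J.erase i, κ.G i j) * (σ i).symm (X (J.erase i)) :=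
  if_pos ⟨hi, hp⟩

theorem fockGen_apply_of_not {i : ι} {p : ℕ → Prop} {J : Finset ι}
    (h : ¬ (i ∈ J ∧ p (J.erase i).card)) (X : Finset ι → K) : fockGen κ σ i p X J = 0 :=
  if_neg h

theorem fockScal_fockGen (f : K) (i : ι) (p : ℕ → Prop) :
    fockScal k ι f * fockGen κ σ i p = fockGen κ σ i p * fockScal k ι (σ i f) := by
  refine LinearMap.ext fun X => funext fun J => ?_
  rw [Module.End.mul_apply, Module.End.mul_apply, fockScal_apply]
  by_cases h : i ∈ J ∧ p (J.erase i).card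
  · rw [fockGen_apply_of_mem κ σ h.1 h.2, fockGen_apply_of_mem κ σ h.1 h.2, fockScal_apply, map_mul,
      AlgEquiv.symm_apply_apply]
    ring
  · rw [fockGen_apply_of_not κ σ h, fockGen_apply_of_not κ σ h, mul_zero]

theorem fockGen_mul_self (i : ι) (p p' : ℕ → Prop) : fockGen κ σ i p * fockGen κ σ i p' = 0 := by
  refine LinearMap.ext fun X => funext fun J => ?_
  rw [Module.End.mul_apply]
  by_cases h : i ∈ J ∧ p (J.erase i).card
  · rw [fockGen_apply_of_mem κ σ h.1 h.2,
      fockGen_apply_of_not κ σ (fun h => Finset.notMem_erase i J h.1),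
      map_zero, mul_zero]
    rfl
  · rw [fockGen_apply_of_not κ σ h]
    rfl

variable {κ σ}

theorem fockGen_mul_apply (hκ : ∀ i f, κ.shift i f = σ i f) {i j : ι}
    (hij : i ≠ j) {p p' : ℕ → Prop} {J : Finset ι} (hi : i ∈ J) (hj : j ∈ J)
    (hp : p (((J.erase i).erase j).card + 1)) (hp' : p' ((J.erase i).erase j).card)
    (X : Finset ι → K) :
    (fockGen κ σ i p * fockGen κ σ j p') X J = κ.G i j *
      ((∏ l ∈ (J.erase i).erase j, κ.G i l * κ.G j l)
      * (σ i).symm ((σ j).symm (X ((J.erase i).erase j)))) := by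
  have hj' : j ∈ J.erase i := Finset.mem_erase.mpr ⟨hij.symm, hj⟩
  rw [Module.End.mul_apply,
    fockGen_apply_of_mem κ σ hi (by rwa [Finset.card_erase_add_one hj'] at hp),
    fockGen_apply_of_mem κ σ hj' hp', map_mul, ← Finset.mul_prod_erase _ _ hj',
    Finset.prod_mul_distrib]
  have hinv : (σ i).symm (∏ l ∈ (J.erase i).erase j, κ.G j l)
      = ∏ l ∈ (J.erase i).erase j, κ.G j l := by
    rw [AlgEquiv.symm_apply_eq, map_prod]
    refine Finset.prod_congr rfl fun l hl => ?_
    rw [← hκ, κ.shift_G hij (Finset.ne_of_mem_erase (Finset.mem_of_mem_erase hl)).symm]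
  rw [hinv]
  ring

theorem fockGen_mul_apply_of_not {i j : ι} {p p' : ℕ → Prop} {J : Finset ι}
    (h : ¬ ((i ∈ J ∧ j ∈ J.erase i) ∧ p (((J.erase i).erase j).card + 1) ∧
      p' ((J.erase i).erase j).card)) (X : Finset ι → K) :
    (fockGen κ σ i p * fockGen κ σ j p') X J = 0 := by
  rw [Module.End.mul_apply]
  by_cases hi : i ∈ J ∧ p (J.erase i).card
  · by_cases hj : j ∈ J.erase i ∧ p' ((J.erase i).erase j).card
    · refine absurd ⟨⟨hi.1, hj.1⟩, ?_, hj.2⟩ h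
      rw [Finset.card_erase_add_one hj.1]
      exact hi.2
    · rw [fockGen_apply_of_mem κ σ hi.1 hi.2, fockGen_apply_of_not κ σ hj, map_zero, mul_zero]
  · exact fockGen_apply_of_not κ σ hi _

theorem fockGen_cross
    (hσ : ∀ i j f, (σ i).symm ((σ j).symm f) = (σ j).symm ((σ i).symm f))
    (hκ : ∀ i f, κ.shift i f = σ i f) {i j : ι} (hij : i ≠ j)
    {p p' : ℕ → Prop} {r s : K}
    (h : ∀ d, p (d + 1) → p' d → r * κ.G i j + s * κ.G j i = 0) :
    fockScal k ι r * fockGen κ σ i p * fockGen κ σ j p'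
        + fockScal k ι s * fockGen κ σ j p * fockGen κ σ i p'
      = 0 := by
  refine LinearMap.ext fun X => funext fun J => ?_
  rw [mul_assoc, mul_assoc, LinearMap.add_apply, Pi.add_apply, Module.End.mul_apply,
    Module.End.mul_apply (fockScal k ι s), fockScal_apply, fockScal_apply]
  have hcomm : (J.erase j).erase i = (J.erase i).erase j := Finset.erase_right_comm
  by_cases hc : (i ∈ J ∧ j ∈ J.erase i) ∧ p (((J.erase i).erase j).card + 1) ∧
      p' ((J.erase i).erase j).card
  · obtain ⟨⟨hi, hj⟩, hp, hp'⟩ := hc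
    have hj := Finset.mem_of_mem_erase hj
    rw [fockGen_mul_apply hκ hij hi hj hp hp', fockGen_mul_apply hκ hij.symm hj hi
      (by rwa [hcomm]) (by rwa [hcomm]), hcomm, hσ i j]
    simp only [mul_comm (κ.G j _) (κ.G i _)]
    rw [← mul_assoc, ← mul_assoc s, ← add_mul, h _ hp hp', zero_mul]
    rfl
  · rw [fockGen_mul_apply_of_not hc, fockGen_mul_apply_of_not, mul_zero, mul_zero, add_zero]
    · rfl
    · rw [hcomm]
      rintro ⟨⟨hj, hi⟩, hp⟩
      exact hc ⟨⟨Finset.mem_of_mem_erase hi, Finset.mem_erase.mpr ⟨hij.symm, hj⟩⟩, hp⟩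

theorem fockGen_prod_apply (hκ : ∀ i f, κ.shift i f = σ i f) {d : ℕ}
    {f : Fin d → ι} (hf : (List.ofFn f).Nodup) {p : Fin d → ℕ → Prop}
    (hp : ∀ k, p k (k.rev : ℕ)) :
    (List.ofFn fun k => fockGen κ σ (f k) (p k)).prod fockVac (List.ofFn f).toFinset
      = κ.pairProd (List.ofFn f) := by
  induction d with
  | zero => simp [fockVac, DynKernel.pairProd]
  | succ d ih =>
    have hnd := hf
    rw [List.ofFn_succ, List.nodup_cons] at hnd
    have he : (List.ofFn f).toFinset.erase (f 0)
        = (List.ofFn fun k : Fin d => f k.succ).toFinset := by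
      rw [List.ofFn_succ, List.toFinset_cons, Finset.erase_insert]
      rw [List.mem_toFinset]
      exact hnd.1
    have hcard : ((List.ofFn f).toFinset.erase (f 0)).card = d := by
      rw [he, List.toFinset_card_of_nodup hnd.2, List.length_ofFn]
    rw [List.ofFn_succ (f := fun k => fockGen κ σ (f k) (p k)), List.prod_cons,
      Module.End.mul_apply,
      fockGen_apply_of_mem κ σ (by simp) (by rw [hcard]; simpa [Fin.val_rev] using hp 0), he,
      ih hnd.2 fun k => by simpa [Fin.val_rev] using hp k.succ,
      (AlgEquiv.symm_apply_eq _).mpr ((κ.shift_pairProd hnd.1).symm.trans (hκ _ _)),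
      List.prod_toFinset _ hnd.2]
    rw [List.ofFn_succ (f := f), DynKernel.pairProd]

end Fock

/-! ### Independence of the normalized monomials -/

section Uniqueness

variable {n : ℕ}

/-- The shift by `α` as an automorphism of `ℂ`-algebras. -/
noncomputable def shiftAlg (α : Dual n) : Mer n ≃ₐ[ℂ] Mer n :=
  AlgEquiv.ofRingEquiv (f := shift α) fun c => by
    rw [IsScalarTower.algebraMap_apply ℂ (Entire n) (Mer n), shift_algebraMap]
    rfl

theorem shiftAlg_apply (α : Dual n) (f : Mer n) : shiftAlg α f = shift α f := rfl

theorem shift_comm (α β : Dual n) (x : Mer n) : shift α (shift β x) = shift β (shift α x) := by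
  obtain ⟨a, b, -, rfl⟩ := IsFractionRing.div_surjective (A := Entire n) x
  simp only [map_div₀, shift_algebraMap]
  have h : ∀ f : Entire n, shiftEntire α (shiftEntire β f) = shiftEntire β (shiftEntire α f) :=
    fun f => Subtype.ext (funext fun ζ => congrArg f.1 (add_right_comm ζ α β))
  rw [h, h]

theorem shiftAlg_symm_comm (α β : Dual n) (x : Mer n) :
    (shiftAlg α).symm ((shiftAlg β).symm x) = (shiftAlg β).symm ((shiftAlg α).symm x) := by
  rw [AlgEquiv.symm_apply_eq, AlgEquiv.symm_apply_eq]
  exact ((shift_comm β α _).trans (congrArg (shiftAlg α)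
    ((shiftAlg β).apply_symm_apply ((shiftAlg α).symm x)) |>.trans
      ((shiftAlg α).apply_symm_apply x))).symm

/-- The limits of a pair of functions with respect to two multipliers are proportional. -/
theorem IsSpectralLimit.mul_eq_mul {φ ψ : ℂ → ℂ} {g g' : Dual n → ℂ → ℂ} {z : ℂ}
    {r s r' s' : Mer n} (hr : IsSpectralLimit φ g z r) (hs : IsSpectralLimit φ g' z s)
    (hr' : IsSpectralLimit ψ g z r') (hs' : IsSpectralLimit ψ g' z s') : r * s' = s * r' := by
  obtain ⟨f₁, h₁, hn₁, rfl, H₁⟩ := hr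
  obtain ⟨f₂, h₂, hn₂, rfl, H₂⟩ := hs
  obtain ⟨f₃, h₃, hn₃, rfl, H₃⟩ := hr'
  obtain ⟨f₄, h₄, hn₄, rfl, H₄⟩ := hs'
  have hinj := IsFractionRing.injective (Entire n) (Mer n)
  have hne : ∀ {h : Entire n}, h ≠ 0 → algebraMap (Entire n) (Mer n) h ≠ 0 := fun h =>
    (map_ne_zero_iff _ hinj).mpr h
  have key : f₁ * f₄ * (h₂ * h₃) = f₂ * f₃ * (h₁ * h₄) := by
    refine mul_right_cancel₀ (mul_ne_zero (mul_ne_zero hn₁ hn₄) (mul_ne_zero hn₂ hn₃))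
      (Subtype.ext (funext fun ζ => ?_))
    change f₁.1 ζ * f₄.1 ζ * (h₂.1 ζ * h₃.1 ζ) * (h₁.1 ζ * h₄.1 ζ * (h₂.1 ζ * h₃.1 ζ))
      = f₂.1 ζ * f₃.1 ζ * (h₁.1 ζ * h₄.1 ζ) * (h₁.1 ζ * h₄.1 ζ * (h₂.1 ζ * h₃.1 ζ))
    by_cases h0 : h₁.1 ζ * h₄.1 ζ * (h₂.1 ζ * h₃.1 ζ) = 0
    · rw [h0, mul_zero, mul_zero]
    · have hz := h0
      simp only [mul_ne_zero_iff, ne_eq] at hz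
      obtain ⟨⟨z1, z4⟩, z2, z3⟩ := hz
      have L := (H₁ ζ z1).mul (H₄ ζ z4)
      have R := (H₂ ζ z2).mul (H₃ ζ z3)
      have hfun : (fun w => φ w * g ζ w * (ψ w * g' ζ w))
          = fun w => φ w * g' ζ w * (ψ w * g ζ w) := by
        funext w
        ring
      rw [hfun] at L
      have h := tendsto_nhds_unique L R
      field_simp at h
      linear_combination (h₁.1 ζ * h₄.1 ζ * (h₂.1 ζ * h₃.1 ζ)) * h
  rw [div_mul_div_comm, div_mul_div_comm, div_eq_div_iff (mul_ne_zero (hne hn₁) (hne hn₄))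
    (mul_ne_zero (hne hn₂) (hne hn₃))]
  simpa only [← map_mul] using congrArg (algebraMap (Entire n) (Mer n)) key

variable (P : Params)

theorem div_eq_of_eq_qzInt {z a b : ℂˣ} {k l : ℤ} (ha : a = qzInt P k z) (hb : b = qzInt P l z)
    (h : k - l = 1) : ((a / b : ℂˣ) : ℂ) = (P.q : ℂ) ^ (2 * (1 : ℤ)) := by
  rw [ha, hb, qzInt_div, h]

/-- Whatever the multiplier, the cross relation of the left exterior algebra at neighbouring points
is a multiple of the one with kernel `E(ζ_ji + 1)`. -/
theorem mul_Edyn_add_mul_Edyn_eq_zero {φ : ℂ → ℂ} {i j : Fin n} (hij : i ≠ j) {r s : Mer n}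
    (hr : IsSpectralLimit φ (fun ζ u => alpha P (coord i j ζ) u) ((P.q : ℂ) ^ (2 * (1 : ℤ))) r)
    (hs : IsSpectralLimit φ (fun ζ u => beta P (coord i j ζ) u) ((P.q : ℂ) ^ (2 * (1 : ℤ))) s) :
    r * Edyn P j i 1 + s * Edyn P i j 1 = 0 := by
  have h := congrArg (Edyn P i j 0 / ellMer P 1 * ·) (hr.mul_eq_mul hs
    (isSpectralLimit_alpha P 1 hij) (isSpectralLimit_beta P 1 hij))
  simp only [mul_left_comm _ r, mul_left_comm _ s] at h
  rw [Edyn_mul_betaReg_one P hij, Edyn_mul_alphaReg_one P hij] at h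
  linear_combination -h

/-- Whatever the multiplier, the two coefficients in the cross relation of the right exterior
algebra at neighbouring points are equal. -/
theorem eq_of_isSpectralLimit {φ : ℂ → ℂ} {i j : Fin n} (hij : i ≠ j) {r s : Mer n}
    (hr : IsSpectralLimit φ (fun ζ u => alpha P (coord i j ζ) u) ((P.q : ℂ) ^ (2 * (1 : ℤ))) r)
    (hs : IsSpectralLimit φ (fun ζ u => beta P (coord j i ζ) u) ((P.q : ℂ) ^ (2 * (1 : ℤ))) s) :
    r = s := by
  have h := hr.mul_eq_mul hs (isSpectralLimit_alpha P 1 hij) (isSpectralLimit_beta P 1 hij.symm)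
  rw [betaReg_one_swap] at h
  refine mul_right_cancel₀ (div_ne_zero (mul_ne_zero ?_ (Edyn_ne_zero P hij 1))
    (Edyn_ne_zero P hij 0)) h
  rw [Int.cast_one]
  exact ellMer_one_ne_zero P

/-- The universal property of the left exterior algebra. -/
noncomputable def ExtL.lift {B : Type*} [Semiring B] [Algebra ℂ B] (sc : Mer n →+* B)
    (g : Fin n → ℂˣ → B) (h_const : ∀ c, sc (algebraMap ℂ (Mer n) c) = algebraMap ℂ B c)
    (h_gen : ∀ f i z, sc f * g i z = g i z * sc (shift (weight i) f))
    (h_sq : ∀ i z z', g i z * g i z' = 0)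
    (h_cross : ∀ φ (k j : Fin n), k ≠ j → ∀ (z z' : ℂˣ) (r s : Mer n),
      IsSpectralLimit φ (fun ζ u => alpha P (coord k j ζ) u) (z / z' : ℂˣ) r →
      IsSpectralLimit φ (fun ζ u => beta P (coord k j ζ) u) (z / z' : ℂˣ) s →
      sc r * g k z * g j z' + sc s * g j z * g k z' = 0) : ExtL P n →ₐ[ℂ] B :=
  RingQuot.liftAlgHom ℂ ⟨FreeAlgebra.lift ℂ fun x : EGen n => match x with
    | .scal f => sc f
    | .v i z => g i z, by
    intro a b hab
    cases hab with
    | scal_const c => simpa using h_const c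
    | scal_add f f' =>
      exact (FreeAlgebra.lift_ι_apply _ _).trans ((RingHom.map_add sc f f').trans (by simp))
    | scal_mul f f' =>
      exact (FreeAlgebra.lift_ι_apply _ _).trans ((RingHom.map_mul sc f f').trans (by simp))
    | scal_v f i z => simpa using h_gen f i z
    | sq i z z' => simpa using h_sq i z z'
    | cross φ _ k j hkj z z' r s hr hs => simpa using h_cross φ k j hkj z z' r s hr hs⟩

/-- The universal property of the right exterior algebra. -/
noncomputable def ExtR.lift {B : Type*} [Semiring B] [Algebra ℂ B] (sc : Mer n →+* B)
    (g : Fin n → ℂˣ → B) (h_const : ∀ c, sc (algebraMap ℂ (Mer n) c) = algebraMap ℂ B c)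
    (h_gen : ∀ f i z, sc f * g i z = g i z * sc (shift (weight i) f))
    (h_sq : ∀ i z z', g i z * g i z' = 0)
    (h_cross : ∀ φ (k j : Fin n), k ≠ j → ∀ (z z' : ℂˣ) (r s : Mer n),
      IsSpectralLimit φ (fun ζ u => alpha P (coord k j ζ) u) (z / z' : ℂˣ) r →
      IsSpectralLimit φ (fun ζ u => beta P (coord j k ζ) u) (z / z' : ℂˣ) s →
      sc r * g j z' * g k z + sc s * g k z' * g j z = 0) : ExtR P n →ₐ[ℂ] B :=
  RingQuot.liftAlgHom ℂ ⟨FreeAlgebra.lift ℂ fun x : EGen n => match x with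
    | .scal f => sc f
    | .v i z => g i z, by
    intro a b hab
    cases hab with
    | scal_const c => simpa using h_const c
    | scal_add f f' =>
      exact (FreeAlgebra.lift_ι_apply _ _).trans ((RingHom.map_add sc f f').trans (by simp))
    | scal_mul f f' =>
      exact (FreeAlgebra.lift_ι_apply _ _).trans ((RingHom.map_mul sc f f').trans (by simp))
    | scal_v f i z => simpa using h_gen f i z
    | sq i z z' => simpa using h_sq i z z'
    | cross φ _ k j hkj z z' r s hr hs => simpa using h_cross φ k j hkj z z' r s hr hs⟩

theorem ExtL.lift_scal {B : Type*} [Semiring B] [Algebra ℂ B] (sc : Mer n →+* B)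
    (g : Fin n → ℂˣ → B) (h_const : ∀ c, sc (algebraMap ℂ (Mer n) c) = algebraMap ℂ B c)
    (h_gen : ∀ f i z, sc f * g i z = g i z * sc (shift (weight i) f))
    (h_sq : ∀ i z z', g i z * g i z' = 0)
    (h_cross : ∀ φ (k j : Fin n), k ≠ j → ∀ (z z' : ℂˣ) (r s : Mer n),
      IsSpectralLimit φ (fun ζ u => alpha P (coord k j ζ) u) (z / z' : ℂˣ) r →
      IsSpectralLimit φ (fun ζ u => beta P (coord k j ζ) u) (z / z' : ℂˣ) s →
      sc r * g k z * g j z' + sc s * g j z * g k z' = 0) (f : Mer n) :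
    ExtL.lift P sc g h_const h_gen h_sq h_cross (scalL P f) = sc f :=
  (RingQuot.liftAlgHom_mkAlgHom_apply _ _ _ _).trans (FreeAlgebra.lift_ι_apply _ _)

theorem ExtL.lift_gen {B : Type*} [Semiring B] [Algebra ℂ B] (sc : Mer n →+* B)
    (g : Fin n → ℂˣ → B) (h_const : ∀ c, sc (algebraMap ℂ (Mer n) c) = algebraMap ℂ B c)
    (h_gen : ∀ f i z, sc f * g i z = g i z * sc (shift (weight i) f))
    (h_sq : ∀ i z z', g i z * g i z' = 0)
    (h_cross : ∀ φ (k j : Fin n), k ≠ j → ∀ (z z' : ℂˣ) (r s : Mer n),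
      IsSpectralLimit φ (fun ζ u => alpha P (coord k j ζ) u) (z / z' : ℂˣ) r →
      IsSpectralLimit φ (fun ζ u => beta P (coord k j ζ) u) (z / z' : ℂˣ) s →
      sc r * g k z * g j z' + sc s * g j z * g k z' = 0) (i : Fin n) (z : ℂˣ) :
    ExtL.lift P sc g h_const h_gen h_sq h_cross (v P i z) = g i z :=
  (RingQuot.liftAlgHom_mkAlgHom_apply _ _ _ _).trans (FreeAlgebra.lift_ι_apply _ _)

theorem ExtR.lift_scal {B : Type*} [Semiring B] [Algebra ℂ B] (sc : Mer n →+* B)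
    (g : Fin n → ℂˣ → B) (h_const : ∀ c, sc (algebraMap ℂ (Mer n) c) = algebraMap ℂ B c)
    (h_gen : ∀ f i z, sc f * g i z = g i z * sc (shift (weight i) f))
    (h_sq : ∀ i z z', g i z * g i z' = 0)
    (h_cross : ∀ φ (k j : Fin n), k ≠ j → ∀ (z z' : ℂˣ) (r s : Mer n),
      IsSpectralLimit φ (fun ζ u => alpha P (coord k j ζ) u) (z / z' : ℂˣ) r →
      IsSpectralLimit φ (fun ζ u => beta P (coord j k ζ) u) (z / z' : ℂˣ) s →
      sc r * g j z' * g k z + sc s * g k z' * g j z = 0) (f : Mer n) :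
    ExtR.lift P sc g h_const h_gen h_sq h_cross (scalR P f) = sc f :=
  (RingQuot.liftAlgHom_mkAlgHom_apply _ _ _ _).trans (FreeAlgebra.lift_ι_apply _ _)

theorem ExtR.lift_gen {B : Type*} [Semiring B] [Algebra ℂ B] (sc : Mer n →+* B)
    (g : Fin n → ℂˣ → B) (h_const : ∀ c, sc (algebraMap ℂ (Mer n) c) = algebraMap ℂ B c)
    (h_gen : ∀ f i z, sc f * g i z = g i z * sc (shift (weight i) f))
    (h_sq : ∀ i z z', g i z * g i z' = 0)
    (h_cross : ∀ φ (k j : Fin n), k ≠ j → ∀ (z z' : ℂˣ) (r s : Mer n),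
      IsSpectralLimit φ (fun ζ u => alpha P (coord k j ζ) u) (z / z' : ℂˣ) r →
      IsSpectralLimit φ (fun ζ u => beta P (coord j k ζ) u) (z / z' : ℂˣ) s →
      sc r * g j z' * g k z + sc s * g k z' * g j z = 0) (i : Fin n) (z : ℂˣ) :
    ExtR.lift P sc g h_const h_gen h_sq h_cross (w P i z) = g i z :=
  (RingQuot.liftAlgHom_mkAlgHom_apply _ _ _ _).trans (FreeAlgebra.lift_ι_apply _ _)

/-- A relation between multiples of a normalized monomial holds in every representation. -/
theorem vSet_relation {B : Type*} [Semiring B] [Algebra ℂ B] (sc : Mer n →+* B)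
    (g : Fin n → ℂˣ → B) (h_const : ∀ c, sc (algebraMap ℂ (Mer n) c) = algebraMap ℂ B c)
    (h_gen : ∀ f i z, sc f * g i z = g i z * sc (shift (weight i) f))
    (h_sq : ∀ i z z', g i z * g i z' = 0)
    (h_cross : ∀ φ (k j : Fin n), k ≠ j → ∀ (z z' : ℂˣ) (r s : Mer n),
      IsSpectralLimit φ (fun ζ u => alpha P (coord k j ζ) u) (z / z' : ℂˣ) r →
      IsSpectralLimit φ (fun ζ u => beta P (coord k j ζ) u) (z / z' : ℂˣ) s →
      sc r * g k z * g j z' + sc s * g j z * g k z' = 0)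
    {I : Finset (Fin n)} {u : ℂˣ} {t t' : Mer n}
    (h : scalL P t * vSet P I u = scalL P t' * vSet P I u) :
    sc t * (sc (normLow P I)⁻¹ *
        (List.ofFn fun k : Fin I.card =>
          g (I.orderEmbOfFin rfl k.rev) (qz P k.rev u)).prod)
      = sc t' * (sc (normLow P I)⁻¹ *
          (List.ofFn fun k : Fin I.card =>
            g (I.orderEmbOfFin rfl k.rev) (qz P k.rev u)).prod) := by
  have h1 := congrArg (ExtL.lift P sc g h_const h_gen h_sq h_cross) h
  simpa only [vSet, map_mul, map_list_prod, List.map_ofFn, Function.comp_def, ExtL.lift_scal,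
    ExtL.lift_gen] using h1

/-- A relation between multiples of a normalized monomial holds in every representation. -/
theorem wSet_relation {B : Type*} [Semiring B] [Algebra ℂ B] (sc : Mer n →+* B)
    (g : Fin n → ℂˣ → B) (h_const : ∀ c, sc (algebraMap ℂ (Mer n) c) = algebraMap ℂ B c)
    (h_gen : ∀ f i z, sc f * g i z = g i z * sc (shift (weight i) f))
    (h_sq : ∀ i z z', g i z * g i z' = 0)
    (h_cross : ∀ φ (k j : Fin n), k ≠ j → ∀ (z z' : ℂˣ) (r s : Mer n),
      IsSpectralLimit φ (fun ζ u => alpha P (coord k j ζ) u) (z / z' : ℂˣ) r →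
      IsSpectralLimit φ (fun ζ u => beta P (coord j k ζ) u) (z / z' : ℂˣ) s →
      sc r * g j z' * g k z + sc s * g k z' * g j z = 0)
    {I : Finset (Fin n)} {u : ℂˣ} {t t' : Mer n}
    (h : scalR P t * wSet P I u = scalR P t' * wSet P I u) :
    sc t * (sc (normUp P I) *
        (List.ofFn fun k : Fin I.card =>
          g (I.orderEmbOfFin rfl k) (qz P k u)).prod)
      = sc t' * (sc (normUp P I) *
          (List.ofFn fun k : Fin I.card =>
            g (I.orderEmbOfFin rfl k) (qz P k u)).prod) := by
  have h1 := congrArg (ExtR.lift P sc g h_const h_gen h_sq h_cross) h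
  simpa only [wSet, map_mul, map_list_prod, List.map_ofFn, Function.comp_def, ExtR.lift_scal,
    ExtR.lift_gen] using h1

/-- The operator of `v_i(u)` in the Fock representation based at `z`: for `u = q ^ (2 m) z` it adds
`i` to the subsets with `m` elements. -/
noncomputable def fockL (z : ℂˣ) (i : Fin n) (u : ℂˣ) : FockEnd ℂ (Fin n) (Mer n) :=
  fockGen (kernelL P n) (fun k => shiftAlg (weight k)) i fun m => u = qzInt P m z

/-- The operator of `w^i(u)` in the Fock representation based at `z`: for `u = q ^ (-2 m) z` it adds
`i` to the subsets with `m` elements. -/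
noncomputable def fockR (z : ℂˣ) (i : Fin n) (u : ℂˣ) : FockEnd ℂ (Fin n) (Mer n) :=
  fockGen (kernelR P n) (fun k => shiftAlg (weight k)) i fun m => u = qzInt P (-m) z

theorem fockScal_fockL (z : ℂˣ) (f : Mer n) (i : Fin n) (u : ℂˣ) :
    fockScal ℂ (Fin n) f * fockL P z i u
      = fockL P z i u * fockScal ℂ (Fin n) (shift (weight i) f) := by
  rw [← shiftAlg_apply]
  exact fockScal_fockGen _ _ f i _

theorem fockScal_fockR (z : ℂˣ) (f : Mer n) (i : Fin n) (u : ℂˣ) :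
    fockScal ℂ (Fin n) f * fockR P z i u
      = fockR P z i u * fockScal ℂ (Fin n) (shift (weight i) f) := by
  rw [← shiftAlg_apply]
  exact fockScal_fockGen _ _ f i _

theorem fockL_mul_self (z : ℂˣ) (i : Fin n) (u u' : ℂˣ) : fockL P z i u * fockL P z i u' = 0 :=
  fockGen_mul_self _ _ i _ _

theorem fockR_mul_self (z : ℂˣ) (i : Fin n) (u u' : ℂˣ) : fockR P z i u * fockR P z i u' = 0 :=
  fockGen_mul_self _ _ i _ _

theorem fockL_cross (z : ℂˣ) {φ : ℂ → ℂ} {k j : Fin n} (hkj : k ≠ j) {u u' : ℂˣ} {r s : Mer n}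
    (hr : IsSpectralLimit φ (fun ζ u => alpha P (coord k j ζ) u) (u / u' : ℂˣ) r)
    (hs : IsSpectralLimit φ (fun ζ u => beta P (coord k j ζ) u) (u / u' : ℂˣ) s) :
    fockScal ℂ (Fin n) r * fockL P z k u * fockL P z j u'
      + fockScal ℂ (Fin n) s * fockL P z j u * fockL P z k u' = 0 := by
  refine fockGen_cross (κ := kernelL P n) (σ := fun k => shiftAlg (weight k))
    (fun i j f => shiftAlg_symm_comm (weight i) (weight j) f) (fun _ _ => rfl) hkj
    (fun d hd hd' => ?_)
  rw [div_eq_of_eq_qzInt P hd hd' (by push_cast; ring)] at hr hs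
  exact mul_Edyn_add_mul_Edyn_eq_zero P hkj hr hs

theorem fockR_cross (z : ℂˣ) {φ : ℂ → ℂ} {k j : Fin n} (hkj : k ≠ j) {u u' : ℂˣ} {r s : Mer n}
    (hr : IsSpectralLimit φ (fun ζ u => alpha P (coord k j ζ) u) (u / u' : ℂˣ) r)
    (hs : IsSpectralLimit φ (fun ζ u => beta P (coord j k ζ) u) (u / u' : ℂˣ) s) :
    fockScal ℂ (Fin n) r * fockR P z j u' * fockR P z k u
      + fockScal ℂ (Fin n) s * fockR P z k u' * fockR P z j u = 0 := by
  refine fockGen_cross (κ := kernelR P n) (σ := fun k => shiftAlg (weight k))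
    (fun i j f => shiftAlg_symm_comm (weight i) (weight j) f) (fun _ _ => rfl) hkj.symm
    (fun d hd hd' => ?_)
  rw [div_eq_of_eq_qzInt P hd' hd (by push_cast; ring)] at hr hs
  rw [eq_of_isSpectralLimit P hkj hr hs]
  change s * (Edyn P j k 0)⁻¹ + s * (Edyn P k j 0)⁻¹ = 0
  rw [Edyn_swap P k j, inv_neg]
  ring

theorem eq_of_fockScal_mul_eq {s s' : Mer n} {T : FockEnd ℂ (Fin n) (Mer n)} {I : Finset (Fin n)}
    (hT : T fockVac I = 1) (h : fockScal ℂ (Fin n) s * T = fockScal ℂ (Fin n) s' * T) : s = s' := by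
  have h1 := congrFun (LinearMap.congr_fun h fockVac) I
  rw [Module.End.mul_apply, Module.End.mul_apply, fockScal_apply, fockScal_apply, hT] at h1
  rwa [mul_one, mul_one] at h1

end Uniqueness

section Uniqueness

variable (P : Params) {n : ℕ}

/-- The normalized monomial of `I` sends the vacuum to the basis vector of `I`. -/
theorem fockL_prod_apply (I : Finset (Fin n)) (z : ℂˣ) :
    (fockScal ℂ (Fin n) (normLow P I)⁻¹ * (List.ofFn fun k : Fin I.card =>
      fockL P z (I.orderEmbOfFin rfl k.rev) (qz P k.rev z)).prod) fockVac I = 1 := by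
  have h := fockGen_prod_apply (k := ℂ) (κ := kernelL P n) (σ := fun k => shiftAlg (weight k))
    (fun _ _ => rfl) (nodup_descList I) (p := fun k m => qz P k.rev z = qzInt P m z)
    fun k => (qzInt_natCast P _ z).symm
  change _ = (kernelL P n).pairProd (descList I) at h
  rw [← descList, toFinset_descList, pairProd_descList_eq_normLow] at h
  have hne := (kernelL P n).pairProd_ne_zero (nodup_descList I)
  rw [pairProd_descList_eq_normLow] at hne
  rw [Module.End.mul_apply, fockScal_apply]
  exact (congrArg (_ * ·) h).trans (inv_mul_cancel₀ hne)

/-- The normalized monomial of `I` sends the vacuum to the basis vector of `I`. Its rightmost factor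
has the spectral parameter `q ^ (2 (#I - 1)) z`, which is therefore the base point. -/
theorem fockR_prod_apply (I : Finset (Fin n)) (z : ℂˣ) :
    (fockScal ℂ (Fin n) (normUp P I) * (List.ofFn fun k : Fin I.card =>
      fockR P (qzInt P (I.card - 1) z) (I.orderEmbOfFin rfl k) (qz P k z)).prod) fockVac I = 1 := by
  have h := fockGen_prod_apply (k := ℂ) (κ := kernelR P n) (σ := fun k => shiftAlg (weight k))
    (fun _ _ => rfl) (nodup_ascList I)
    (p := fun k m => qz P k z = qzInt P (-m) (qzInt P (I.card - 1) z))
    fun k => by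
      have := k.2
      rw [qzInt_qzInt, ← qzInt_natCast, Fin.val_rev]
      congr 1
      omega
  change _ = (kernelR P n).pairProd (ascList I) at h
  rw [← ascList, toFinset_ascList, pairProd_ascList_eq_normUp_inv] at h
  have hne := (kernelR P n).pairProd_ne_zero (nodup_ascList I)
  rw [pairProd_ascList_eq_normUp_inv] at hne
  rw [Module.End.mul_apply, fockScal_apply]
  exact (congrArg (_ * ·) h).trans (mul_inv_cancel₀ fun h0 => hne (by rw [h0, inv_zero]))

theorem scalL_mul_vSet_injective {I : Finset (Fin n)} {z : ℂˣ} {s s' : Mer n}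
    (h : scalL P s * vSet P I z = scalL P s' * vSet P I z) : s = s' := by
  have h1 := vSet_relation P (B := FockEnd ℂ (Fin n) (Mer n)) (fockScal ℂ (Fin n)) (fockL P z)
    fockScal_const (fockScal_fockL P _) (fockL_mul_self P _)
    (fun _ _ _ hkj _ _ _ _ => fockL_cross P _ hkj) h
  exact eq_of_fockScal_mul_eq (fockL_prod_apply P I z) h1

theorem scalR_mul_wSet_injective {I : Finset (Fin n)} {z : ℂˣ} {s s' : Mer n}
    (h : scalR P s * wSet P I z = scalR P s' * wSet P I z) : s = s' := by
  have h1 := wSet_relation P (B := FockEnd ℂ (Fin n) (Mer n)) (fockScal ℂ (Fin n))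
    (fockR P (qzInt P (I.card - 1) z)) fockScal_const
    (fockScal_fockR P _) (fockR_mul_self P _) (fun _ _ _ hkj _ _ _ _ => fockR_cross P _ hkj) h
  exact eq_of_fockScal_mul_eq (fockR_prod_apply P I z) h1

end Uniqueness

end EllipticGL

/-- Laplace expansions of elliptic minors: the functions `S_l`, `S_r` are the structure functions
of the normalized monomials in the left and right elliptic exterior algebras, left and right
elliptic minors coincide, and their common value satisfies the left and right expansions. -/
theorem mainTheorem4 (P : Params) (n : ℕ) :
    (∀ (I J : Finset (Fin n)) (z : ℂˣ) (s : Mer n),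
      vSet P I (qz P J.card z) * vSet P J z = scalL P s * vSet P (I ∪ J) z ↔ s = Sl P I J) ∧
    (∀ (I J : Finset (Fin n)) (z : ℂˣ) (s : Mer n),
      wSet P I z * wSet P J (qz P I.card z) = scalR P s * wSet P (I ∪ J) z ↔ s = Sr P I J) ∧
    (∀ (I J : Finset (Fin n)) (z : ℂˣ), leftMinor P I J z = rightMinor P I J z) ∧
    (∀ (I₁ I₂ J : Finset (Fin n)) (z : ℂˣ),
      muL P (Sl P I₁ I₂) * leftMinor P (I₁ ∪ I₂) J z =
        ∑ K ∈ (Finset.univ : Finset (Finset (Fin n) × Finset (Fin n))).filter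
            (fun K => K.1 ∪ K.2 = J),
          muR P (Sl P K.1 K.2) * leftMinor P I₁ K.1 (qz P I₂.card z) * leftMinor P I₂ K.2 z) ∧
    (∀ (J₁ J₂ I : Finset (Fin n)) (z : ℂˣ),
      muR P (Sr P J₁ J₂) * leftMinor P I (J₁ ∪ J₂) z =
        ∑ K ∈ (Finset.univ : Finset (Finset (Fin n) × Finset (Fin n))).filter
            (fun K => K.1 ∪ K.2 = I),
          muL P (Sr P K.1 K.2) * leftMinor P K.1 J₁ z *
            leftMinor P K.2 J₂ (qz P J₁.card z)) := by
  refine ⟨fun I J z s => ⟨fun h => ?_, ?_⟩, fun I J z s => ⟨fun h => ?_, ?_⟩,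
    leftMinor_eq_rightMinor P, leftMinor_laplace_rows P, leftMinor_laplace_columns P⟩
  · exact scalL_mul_vSet_injective P (h.symm.trans (vSet_mul_vSet P I J z))
  · rintro rfl
    exact vSet_mul_vSet P I J z
  · exact scalR_mul_wSet_injective P (h.symm.trans (wSet_mul_wSet P I J z))
  · rintro rfl
    exact wSet_mul_wSet P I J z
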